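/- Let $\kappa\in\{1,-1\}$ and equip $\mathbb R^{n+2}$ ($n\ge 1$) with $\langle x,y\rangle=\sum_{i\le n+1}x_iy_i+\kappa x_{n+2}y_{n+2}$. For $\kappa=1$ let $M=\mathbb S^{n+1}=\{\langle x,x\rangle=1\}$; for $\kappa=-1$ let $M=\mathbb H^{n+1}=\{\langle x,x\rangle=-1,\ x_{n+2}>0\}$. The space of oriented geodesics of $M$ is $$\mathbb L(M)=\{x\wedge y:\ x\in M,\ \langle x,y\rangle=0,\ \langle y,y\rangle=1\}\subset\Lambda^2\mathbb R^{n+2},$$ whose tangent vectors at $x\wedge y$ are $x\wedge X+y\wedge Y$ with $X,Y\perp x,y$. It carries * the metric $G$ induced by $\langle\langle x_1\wedge y_1,x_2\wedge y_2\rangle\rangle=\langle x_1,x_2\rangle\langle y_1,y_2\rangle-\langle x_1,y_2\rangle\langle x_2,y_1\rangle$, the (para-)complex structure $\mathbb J(x\wedge X+y\wedge Y)=y\wedge X-\kappa\,x\wedge Y$ and the symplectic form $\Omega=\kappa\,G(\mathbb J\cdot,\cdot)$ (the (para-)Kähler Einstein structure); * for $n=2$, the structure $\mathbb J'(x\wedge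 X+y\wedge Y)=x\wedge J'X+y\wedge J'Y$, where $J'$ is the rotation by $+\pi/2$ of the plane $(x\wedge y)^\perp$, oriented compatibly with $x\wedge y$, and the neutral, locally conformally flat metric $G'=\Omega(\cdot,\mathbb J'\cdot)$. Let $(\mathcal G,\mathcal J)$ be $(G,\mathbb J)$ or $(G',\mathbb J')$. A Lagrangian immersion $F$ of an $n$-manifold $\Sigma$ in $\mathbb L(M)$ with non-degenerate induced metric $F^*\mathcal G$ is *Hamiltonian minimal* if for every smooth variation $F_t$ of $F$ in $\mathbb L(M)$ with velocity $\partial_tF_t|_{t=0}=\mathcal J\,dF(\nabla u)$, where $u\in C_c^\infty(\Sigma)$ and $\nabla$ is the gradient of $F^*\mathcal G$, and every compact $C\supseteq\operatorname{supp}u$, the volume of $C$ for $|\det F_t^*\mathcal G|^{1/2}$ has derivative $0$ at $t=0$. A hypersurface $\phi$ is a *critical point* of a functional $\int_\Sigma f$ if for every compact $C\subseteq\Sigma$ and every smooth variation $\phi_t$ of $\phi$ through immersed hypersurfaces of $M$ (with unit normals $N_t$ varying smoothly) that is constant in $t$ outside $C$, the integral over $C$ of the integrand of $\phi_t$ with respect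 to the volume of the metric induced by $M$ has derivative $0$ at $t=0$. Let $\phi:\Sigma^n\to M$ be a smooth immersed hypersurface ($\Sigma$ a Hausdorff, second countable smooth manifold) with smooth unit normal field $N$, principal curvatures $k_1,\dots,k_n$, and Gauss map $\Phi=\phi\wedge N:\Sigma\to\mathbb L(M)$. 1. If $M=\mathbb S^{n+1}$, then $\Phi$ is Hamiltonian minimal for $(G,\mathbb J)$ if and only if $\phi$ is a critical point of $\int_\Sigma\sqrt{\prod_{i=1}^n(1+k_i^2)}\,dV$. 2. If $M=\mathbb H^{n+1}$ and $\Phi^*G$ is non-degenerate (i.e. $k_i\ne\pm1$ everywhere), then $\Phi$ is Hamiltonian minimal for $(G,\mathbb J)$ if and only if $\phi$ is a critical point of $\int_\Sigma\sqrt{\prod_{i=1}^n|1-k_i^2|}\,dV$. 3. If $n=2$, $M=\mathbb S^3$ and $\Phi^*G'$ is non-degenerate (i.e. $\phi$ has no umbilic points), then $\Phi$ is Hamiltonian minimal for $(G',\mathbb J')$ if and only if $\phi$ is a critical point of $\int_\Sigma\sqrt{H^2-K+1}\,dA$. 4. If $n=2$, $M=\mathbb H^3$ and $\Phi^*G'$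 is non-degenerate (i.e. $\phi$ has no umbilic points), then $\Phi$ is Hamiltonian minimal for $(G',\mathbb J')$ if and only if $\phi$ is a critical point of $\int_\Sigma\sqrt{H^2-K-1}\,dA$. Here $H=(k_1+k_2)/2$ is the mean curvature and $K$ the (intrinsic) Gaussian curvature of the surface. -/

import Mathlib

open Set MeasureTheory
open scoped Manifold ContDiff

noncomputable section

namespace OrientedGeodesics

/-! ## The ambient space and the two space forms -/

/-- The ambient vector space `ℝ^{n+2}`. -/
abbrev Amb (n : ℕ) : Type := EuclideanSpace ℝ (Fin (n + 2))

/-- The diagonal entries of the ambient scalar product: `1, …, 1, κ`. -/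
def sgn (κ : ℝ) {n : ℕ} (i : Fin (n + 2)) : ℝ := if i = Fin.last (n + 1) then κ else 1

/-- The ambient scalar product `x₁y₁ + … + x_{n+1}y_{n+1} + κ x_{n+2}y_{n+2}`: Euclidean for
`κ = 1`, Lorentzian for `κ = -1`. -/
def form (κ : ℝ) {n : ℕ} (x y : Amb n) : ℝ := ∑ i, sgn κ i * x i * y i

/-- `𝕊^{n+1} = {⟨x,x⟩ = 1}` for `κ = 1`; the upper sheet
`ℍ^{n+1} = {⟨x,x⟩ = -1, x_{n+2} > 0}` of the hyperboloid for `κ = -1`. -/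
def spaceForm (κ : ℝ) (n : ℕ) : Set (Amb n) :=
  {x | form κ x x = κ ∧ (κ = -1 → 0 < x (Fin.last (n + 1)))}

/-! ## The space of oriented geodesics and its structures -/

/-- Bivectors of `ℝ^{n+2}`, realised as (skew-symmetric) square arrays. -/
abbrev Biv (n : ℕ) : Type := Fin (n + 2) → Fin (n + 2) → ℝ

/-- The bivector `x ∧ y`. -/
def wedge {n : ℕ} (x y : Amb n) : Biv n := fun i j => x i * y j - x j * y i

/-- The space of oriented geodesics: the geodesic through `x` with unit velocity `y ∈ T_x` is
the bivector `x ∧ y`. -/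
def geodesics (κ : ℝ) (n : ℕ) : Set (Biv n) :=
  {p | ∃ x y : Amb n, x ∈ spaceForm κ n ∧ form κ x y = 0 ∧ form κ y y = 1 ∧ p = wedge x y}

/-- The flat metric on bivectors; see `metricG_wedge`.  Its restriction to the tangent spaces of
`geodesics κ n` is the Einstein metric `G`. -/
def metricG (κ : ℝ) {n : ℕ} (U V : Biv n) : ℝ :=
  (1 / 2) * ∑ i, ∑ j, sgn κ i * sgn κ j * U i j * V i j

/-- The extension of an endomorphism (with matrix `M`) of `ℝ^{n+2}` to bivectors as a
derivation: `a ∧ b ↦ Ma ∧ b + a ∧ Mb`. -/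
def derivExt {n : ℕ} (M : Matrix (Fin (n + 2)) (Fin (n + 2)) ℝ) (V : Biv n) : Biv n :=
  fun j k => ∑ i, M j i * V i k + ∑ i, M k i * V j i

/-- The (para-)complex structure of the oriented plane `p = x ∧ y`, extended by zero to the
orthogonal complement: `Jx = y`, `Jy = -κ x`. -/
def planeJ (κ : ℝ) {n : ℕ} (p : Biv n) : Matrix (Fin (n + 2)) (Fin (n + 2)) ℝ :=
  fun j i => κ * sgn κ i * p i j

/-- The (para-)complex structure `𝕁` of the space of oriented geodesics at `p`.  On a tangent
vector it is `x ∧ X + y ∧ Y ↦ (Jx) ∧ X + (Jy) ∧ Y`; see `bigJ_tangent`. -/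
def bigJ (κ : ℝ) {n : ℕ} (p V : Biv n) : Biv n := derivExt (planeJ κ p) V

/-- The symplectic form `Ω = κ G(𝕁·,·)` at `p`. -/
def symplectic (κ : ℝ) {n : ℕ} (p U V : Biv n) : ℝ := κ * metricG κ (bigJ κ p U) V

/-- For `p = x ∧ y` this is `det (x, y, v, w)`; see `volForm_wedge`. -/
def volForm (p : Biv 2) (v w : Fin 4 → ℝ) : ℝ :=
  (1 / 2) * ∑ σ : Equiv.Perm (Fin 4),
    ((Equiv.Perm.sign σ : ℤ) : ℝ) * p (σ 0) (σ 1) * v (σ 2) * w (σ 3)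

/-- The complex structure `J'` of the plane orthogonal to `p = x ∧ y` (oriented compatibly with
`p`), extended by zero to the plane itself: `⟨J'v, w⟩ = det (x, y, v, w)`. -/
def normalJ (κ : ℝ) (p : Biv 2) : Matrix (Fin 4) (Fin 4) ℝ :=
  fun d c => sgn κ (n := 2) d * volForm p (Pi.single c 1) (Pi.single d 1)

/-- The structure `𝕁'` at `p`, for `n = 2`:  `x ∧ X + y ∧ Y ↦ x ∧ (J'X) + y ∧ (J'Y)`. -/
def bigJ' (κ : ℝ) (p V : Biv 2) : Biv 2 := derivExt (n := 2) (normalJ κ p) V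

/-- The conformally flat neutral metric `G' = Ω(·, 𝕁'·)` at `p`. -/
def metricG' (κ : ℝ) (p U V : Biv 2) : ℝ := symplectic κ p U (bigJ' κ p V)

/-! ## Induced metrics, volume, Lagrangian immersions, Hamiltonian minimality

`S` is a smooth manifold of dimension `n`, `V` a vector space, and a field of bilinear forms on
`V` is a function `q : V → V → V → ℝ`, `q p` being the form at `p`. -/

section Induced

variable (n : ℕ) {S : Type*} [TopologicalSpace S] [ChartedSpace (EuclideanSpace ℝ (Fin n)) S]
  {V : Type*} [NormedAddCommGroup V] [NormedSpace ℝ V]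

/-- The differential of `F : S → V` at `x`. -/
def diff (F : S → V) (x : S) : TangentSpace (𝓡 n) x →L[ℝ] V := mfderiv (𝓡 n) 𝓘(ℝ, V) F x

/-- The matrix of the induced metric `F^*q` in the chart `e`, at the coordinate point `y`. -/
def gram (q : V → V → V → ℝ) (F : S → V)
    (e : OpenPartialHomeomorph S (EuclideanSpace ℝ (Fin n))) (y : EuclideanSpace ℝ (Fin n)) :
    Matrix (Fin n) (Fin n) ℝ :=
  fun i j => q (F (e.symm y))
    (fderiv ℝ (F ∘ e.symm) y (EuclideanSpace.single i 1))
    (fderiv ℝ (F ∘ e.symm) y (EuclideanSpace.single j 1))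

/-- The measure `√|det (F^*q)_{ij}| dy¹⋯dyⁿ` of a chart domain. -/
def chartVolume [MeasurableSpace S] (q : V → V → V → ℝ) (F : S → V)
    (e : OpenPartialHomeomorph S (EuclideanSpace ℝ (Fin n))) : Measure S :=
  ((volume.restrict e.target).withDensity
    fun y => ENNReal.ofReal (Real.sqrt |(gram n q F e y).det|)).map e.symm

/-- The volume measure on `S` of the induced metric `F^*q`.  The measures of the chart domains
agree on overlaps; the measure they glue to is their least upper bound. -/
def inducedVolume [MeasurableSpace S] (q : V → V → V → ℝ) (F : S → V) : Measure S :=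
  ⨆ e ∈ atlas (EuclideanSpace ℝ (Fin n)) S, chartVolume n q F e

/-- The induced metric `F^*q` is non-degenerate. -/
def NondegenerateInduced (q : V → V → V → ℝ) (F : S → V) : Prop :=
  ∀ (x : S) (v : TangentSpace (𝓡 n) x),
    (∀ w : TangentSpace (𝓡 n) x, q (F x) (diff n F x v) (diff n F x w) = 0) → v = 0

end Induced

section Hamiltonian

variable {n : ℕ} {S : Type*} [TopologicalSpace S] [ChartedSpace (EuclideanSpace ℝ (Fin n)) S]

/-- `F` is a Lagrangian immersion of the `n`-manifold `S` in the `2n`-dimensional symplectic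
manifold of oriented geodesics, with non-degenerate induced metric `F^*q`
(a map with non-degenerate induced metric is an immersion). -/
structure IsLagrangian (κ : ℝ) (q : Biv n → Biv n → Biv n → ℝ) (F : S → Biv n) : Prop where
  smooth : ContMDiff (𝓡 n) 𝓘(ℝ, Biv n) ∞ F
  mem : ∀ x, F x ∈ geodesics κ n
  isotropic : ∀ (x : S) (v w : TangentSpace (𝓡 n) x),
    symplectic κ (F x) (diff n F x v) (diff n F x w) = 0
  nondegenerate : NondegenerateInduced n q F

/-- `Ft t`, `|t| < δ`, is a smooth variation of `F` in the space of oriented geodesics whose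
velocity at `t = 0` is `J∇u`, with `u` smooth of compact support and `∇` the gradient of the
induced metric `F^*q`. -/
structure IsHamiltonianVariation (κ : ℝ) (q : Biv n → Biv n → Biv n → ℝ)
    (J : Biv n → Biv n → Biv n) (F : S → Biv n) (u : S → ℝ) (δ : ℝ) (Ft : ℝ → S → Biv n) :
    Prop where
  pos : 0 < δ
  smooth : ContMDiffOn (𝓘(ℝ, ℝ).prod (𝓡 n)) 𝓘(ℝ, Biv n) ∞
    (fun z : ℝ × S => Ft z.1 z.2) (Ioo (-δ) δ ×ˢ univ)
  mem : ∀ t ∈ Ioo (-δ) δ, ∀ x, Ft t x ∈ geodesics κ n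
  initial : Ft 0 = F
  smooth_u : ContMDiff (𝓡 n) 𝓘(ℝ, ℝ) ∞ u
  compact_u : HasCompactSupport u
  velocity : ∀ x : S, ∃ grad : TangentSpace (𝓡 n) x,
    (∀ v : TangentSpace (𝓡 n) x, q (F x) (diff n F x grad) (diff n F x v) = diff n u x v) ∧
    HasDerivAt (fun t => Ft t x) (J (F x) (diff n F x grad)) 0

/-- Hamiltonian minimality: `F` is Lagrangian (with non-degenerate induced metric) and is a
critical point of the `q`-volume with respect to Hamiltonian variations. The volume is that of
any compact set containing the support of the Hamiltonian `u`. -/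
def IsHamiltonianMinimal [MeasurableSpace S] (κ : ℝ) (q : Biv n → Biv n → Biv n → ℝ)
    (J : Biv n → Biv n → Biv n) (F : S → Biv n) : Prop :=
  IsLagrangian κ q F ∧
    ∀ (u : S → ℝ) (δ : ℝ) (Ft : ℝ → S → Biv n), IsHamiltonianVariation κ q J F u δ Ft →
      ∀ C : Set S, IsCompact C → tsupport u ⊆ C →
        HasDerivAt (fun t => (inducedVolume n q (Ft t)).real C) 0 0

end Hamiltonian

/-! ## Hypersurfaces, curvatures, variational problems -/

section Hypersurface

variable {n : ℕ} {S : Type*} [TopologicalSpace S] [ChartedSpace (EuclideanSpace ℝ (Fin n)) S]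

/-- `φ : S → 𝕊^{n+1}` or `ℍ^{n+1}` is an immersed hypersurface with unit normal field `N`. -/
structure IsHypersurface (κ : ℝ) (φ N : S → Amb n) : Prop where
  smooth : ContMDiff (𝓡 n) 𝓘(ℝ, Amb n) ∞ φ
  smooth_normal : ContMDiff (𝓡 n) 𝓘(ℝ, Amb n) ∞ N
  mem : ∀ x, φ x ∈ spaceForm κ n
  immersion : ∀ x, Function.Injective (diff n φ x)
  normal_unit : ∀ x, form κ (N x) (N x) = 1
  normal_tangent : ∀ x, form κ (φ x) (N x) = 0
  normal_orthogonal : ∀ (x : S) (v : TangentSpace (𝓡 n) x), form κ (N x) (diff n φ x v) = 0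

/-- The Gauss map (normal congruence) `Φ = φ ∧ N`. -/
def gaussMap (φ N : S → Amb n) : S → Biv n := fun x => wedge (φ x) (N x)

/-- The standard basis of the tangent space (the coordinate basis of the chart at `x`). -/
def tangentBasis (x : S) (i : Fin n) : TangentSpace (𝓡 n) x :=
  (EuclideanSpace.single i 1 : EuclideanSpace ℝ (Fin n))

/-- The matrix of the first fundamental form. -/
def firstForm (κ : ℝ) (φ : S → Amb n) (x : S) : Matrix (Fin n) (Fin n) ℝ :=
  fun i j => form κ (diff n φ x (tangentBasis x i)) (diff n φ x (tangentBasis x j))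

/-- The matrix of the second fundamental form `-⟨dN·, dφ·⟩`. -/
def secondForm (κ : ℝ) (φ N : S → Amb n) (x : S) : Matrix (Fin n) (Fin n) ℝ :=
  fun i j => -form κ (diff n N x (tangentBasis x i)) (diff n φ x (tangentBasis x j))

/-- The matrix of the shape operator `A`, `dφ(Av) = -dN(v)`. -/
def shapeOperator (κ : ℝ) (φ N : S → Amb n) (x : S) : Matrix (Fin n) (Fin n) ℝ :=
  (firstForm κ φ x)⁻¹ * secondForm κ φ N x

/-- The principal curvatures `k₁, …, kₙ`: the eigenvalues of the shape operator, with
multiplicity. -/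
def principalCurvatures (κ : ℝ) (φ N : S → Amb n) (x : S) : Multiset ℝ :=
  (shapeOperator κ φ N x).charpoly.roots

/-- The mean curvature `H = (k₁ + ⋯ + kₙ)/n`. -/
def meanCurvature (κ : ℝ) (φ N : S → Amb n) (x : S) : ℝ :=
  (principalCurvatures κ φ N x).sum / n

/-- `(φt t, Nt t)`, `|t| < δ`, is a smooth variation of the hypersurface `φ` (with its normal
field `N`) through hypersurfaces of the space form, which does not move `φ` outside `C`. -/
structure IsVariation (κ : ℝ) (φ N : S → Amb n) (C : Set S) (δ : ℝ)
    (φt Nt : ℝ → S → Amb n) : Prop where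
  pos : 0 < δ
  smooth : ContMDiffOn (𝓘(ℝ, ℝ).prod (𝓡 n)) 𝓘(ℝ, Amb n) ∞
    (fun z : ℝ × S => φt z.1 z.2) (Ioo (-δ) δ ×ˢ univ)
  smooth_normal : ContMDiffOn (𝓘(ℝ, ℝ).prod (𝓡 n)) 𝓘(ℝ, Amb n) ∞
    (fun z : ℝ × S => Nt z.1 z.2) (Ioo (-δ) δ ×ˢ univ)
  hypersurface : ∀ t ∈ Ioo (-δ) δ, IsHypersurface κ (φt t) (Nt t)
  initial : φt 0 = φ
  initial_normal : Nt 0 = N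
  fixed : ∀ t ∈ Ioo (-δ) δ, ∀ x ∉ C, φt t x = φ x

/-- `φ` is a critical point of the functional `∫_S f dV` with respect to compactly supported
variations.  The integrand `f φ N : S → ℝ` is a function on the hypersurface `(φ, N)`, and
`dV` is the volume measure of the metric induced by the space form. -/
def IsCriticalPoint [MeasurableSpace S] (κ : ℝ) (f : (S → Amb n) → (S → Amb n) → S → ℝ)
    (φ N : S → Amb n) : Prop :=
  ∀ (C : Set S) (δ : ℝ) (φt Nt : ℝ → S → Amb n), IsCompact C →
    IsVariation κ φ N C δ φt Nt →
      HasDerivAt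
        (fun t => ∫ x in C, f (φt t) (Nt t) x ∂(inducedVolume n (fun _ => form κ) (φt t))) 0 0

end Hypersurface

/-! ## Gaussian curvature of surfaces -/

section Gauss

/-- The partial derivative `∂_k f`. -/
def pd (k : Fin 2) (f : EuclideanSpace ℝ (Fin 2) → ℝ) (y : EuclideanSpace ℝ (Fin 2)) : ℝ :=
  fderiv ℝ f y (EuclideanSpace.single k 1)

/-- The Christoffel symbols `Γ^l_{ij}` of a metric `g` in coordinates. -/
def christoffel (g : EuclideanSpace ℝ (Fin 2) → Matrix (Fin 2) (Fin 2) ℝ) (l i j : Fin 2)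
    (y : EuclideanSpace ℝ (Fin 2)) : ℝ :=
  (1 / 2) * ∑ m, (g y)⁻¹ l m *
    (pd i (fun z => g z j m) y + pd j (fun z => g z i m) y - pd m (fun z => g z i j) y)

/-- The components of the curvature tensor, `R(∂_i, ∂_j)∂_k = ∑_l R^l_{kij} ∂_l`. -/
def riemann (g : EuclideanSpace ℝ (Fin 2) → Matrix (Fin 2) (Fin 2) ℝ) (l k i j : Fin 2)
    (y : EuclideanSpace ℝ (Fin 2)) : ℝ :=
  pd i (christoffel g l j k) y - pd j (christoffel g l i k) y +
    ∑ m, (christoffel g m j k y * christoffel g l i m y -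
      christoffel g m i k y * christoffel g l j m y)

variable {S : Type*} [TopologicalSpace S] [ChartedSpace (EuclideanSpace ℝ (Fin 2)) S]

/-- The (intrinsic) Gaussian curvature `⟨R(∂₀,∂₁)∂₁,∂₀⟩ / det g` of the metric `g` induced on
the surface by the space form, computed in the chart at `x`. -/
def gaussCurvature (κ : ℝ) (φ : S → Amb 2) (x : S) : ℝ :=
  let e := chartAt (EuclideanSpace ℝ (Fin 2)) x
  let g := gram 2 (fun _ => form κ) φ e
  (∑ l, riemann g l 1 0 1 (e x) * g (e x) l 0) / (g (e x)).det

end Gauss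

/-! ## Consistency checks for the structures on the space of geodesics -/

/-- `⟨⟨x₁∧y₁, x₂∧y₂⟩⟩ = ⟨x₁,x₂⟩⟨y₁,y₂⟩ - ⟨x₁,y₂⟩⟨x₂,y₁⟩`. -/
theorem metricG_wedge (κ : ℝ) {n : ℕ} (x₁ y₁ x₂ y₂ : Amb n) :
    metricG κ (wedge x₁ y₁) (wedge x₂ y₂) =
      form κ x₁ x₂ * form κ y₁ y₂ - form κ x₁ y₂ * form κ x₂ y₁ := by
  have key : ∀ a b c d : Amb n, form κ a b * form κ c d =
      ∑ i, ∑ j, (sgn κ i * a i * b i) * (sgn κ j * c j * d j) := fun a b c d => by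
    simp only [form, Finset.sum_mul_sum]
  have h1 := key x₁ x₂ y₁ y₂
  have h2 : form κ x₁ x₂ * form κ y₁ y₂ =
      ∑ i, ∑ j, (sgn κ i * y₁ i * y₂ i) * (sgn κ j * x₁ j * x₂ j) := by
    rw [← key]; ring
  have h3 := key x₁ y₂ x₂ y₁
  have h4 : form κ x₁ y₂ * form κ x₂ y₁ =
      ∑ i, ∑ j, (sgn κ i * x₂ i * y₁ i) * (sgn κ j * x₁ j * y₂ j) := by
    rw [← key]; ring
  have h5 : form κ x₁ x₂ * form κ y₁ y₂ - form κ x₁ y₂ * form κ x₂ y₁ =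
      (1 / 2) * ((form κ x₁ x₂ * form κ y₁ y₂ + form κ x₁ x₂ * form κ y₁ y₂) -
        (form κ x₁ y₂ * form κ x₂ y₁ + form κ x₁ y₂ * form κ x₂ y₁)) := by ring
  rw [h5]
  nth_rewrite 1 [h1]
  nth_rewrite 1 [h2]
  nth_rewrite 1 [h3]
  nth_rewrite 1 [h4]
  rw [metricG, ← Finset.sum_add_distrib, ← Finset.sum_add_distrib, ← Finset.sum_sub_distrib]
  congr 1
  refine Finset.sum_congr rfl fun i _ => ?_
  rw [← Finset.sum_add_distrib, ← Finset.sum_add_distrib, ← Finset.sum_sub_distrib]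
  refine Finset.sum_congr rfl fun j _ => ?_
  simp only [wedge]
  ring

theorem derivExt_wedge {n : ℕ} (M : Matrix (Fin (n + 2)) (Fin (n + 2)) ℝ) (a b : Amb n) :
    derivExt M (wedge a b) =
      wedge (WithLp.toLp 2 (M.mulVec a)) b + wedge a (WithLp.toLp 2 (M.mulVec b)) := by
  funext j k
  simp only [derivExt, wedge, Pi.add_apply, Matrix.mulVec, dotProduct, Finset.sum_mul,
    Finset.mul_sum, ← Finset.sum_add_distrib, ← Finset.sum_sub_distrib]
  refine Finset.sum_congr rfl fun i _ => ?_
  ring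

theorem planeJ_wedge (κ : ℝ) {n : ℕ} (x y v : Amb n) :
    WithLp.toLp 2 ((planeJ κ (wedge x y)).mulVec v) =
      (κ * form κ x v) • y - (κ * form κ y v) • x := by
  ext j
  simp only [planeJ, wedge, Matrix.mulVec, dotProduct, form, PiLp.sub_apply, PiLp.smul_apply,
    smul_eq_mul, Finset.mul_sum, Finset.sum_mul, ← Finset.sum_sub_distrib]
  refine Finset.sum_congr rfl fun i _ => ?_
  ring

/-- The defining formula of `𝕁` on the tangent vectors of the space of geodesics. -/
theorem bigJ_tangent (κ : ℝ) (hκ : κ * κ = 1) {n : ℕ} (x y X Y : Amb n)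
    (hx : form κ x x = κ) (hxy : form κ x y = 0) (hyx : form κ y x = 0) (hy : form κ y y = 1)
    (hxX : form κ x X = 0) (hyX : form κ y X = 0) (hxY : form κ x Y = 0)
    (hyY : form κ y Y = 0) :
    bigJ κ (wedge x y) (wedge x X + wedge y Y) = wedge y X - κ • wedge x Y := by
  have hadd : bigJ κ (wedge x y) (wedge x X + wedge y Y) =
      bigJ κ (wedge x y) (wedge x X) + bigJ κ (wedge x y) (wedge y Y) := by
    funext j k
    simp only [bigJ, derivExt, Pi.add_apply, mul_add, Finset.sum_add_distrib]
    ring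
  rw [hadd, bigJ, bigJ, derivExt_wedge, derivExt_wedge]
  simp only [planeJ_wedge, hx, hxy, hyx, hy, hxX, hyX, hxY, hyY, hκ]
  funext j k
  simp [wedge]
  ring

theorem volForm_wedge (x y v w : Amb 2) :
    volForm (wedge x y) v w =
      (Matrix.of ![(x : Fin 4 → ℝ), (y : Fin 4 → ℝ), (v : Fin 4 → ℝ), (w : Fin 4 → ℝ)]).det := by
  have key : ∀ a b : Fin 4 → ℝ, (Matrix.of ![a, b, (v : Fin 4 → ℝ), (w : Fin 4 → ℝ)]).det =
      ∑ σ : Equiv.Perm (Fin 4), ((Equiv.Perm.sign σ : ℤ) : ℝ) *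
        (a (σ 0) * b (σ 1) * v (σ 2) * w (σ 3)) := fun a b => by
    rw [← Matrix.det_transpose, Matrix.det_apply']
    refine Finset.sum_congr rfl fun σ _ => ?_
    simp [Fin.prod_univ_four]
  have hswap : (Matrix.of ![(y : Fin 4 → ℝ), x, v, w]).det =
      -(Matrix.of ![(x : Fin 4 → ℝ), y, v, w]).det := by
    rw [Matrix.det_succ_row_zero, Matrix.det_succ_row_zero]
    simp [Fin.sum_univ_succ, Matrix.det_fin_three, Fin.succAbove, Matrix.submatrix]
    ring
  have h : volForm (wedge x y) v w = (1 / 2) *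
      ((Matrix.of ![(x : Fin 4 → ℝ), y, v, w]).det - (Matrix.of ![(y : Fin 4 → ℝ), x, v, w]).det)
      := by
    rw [key, key, ← Finset.sum_sub_distrib, volForm]
    congr 1
    refine Finset.sum_congr rfl fun σ _ => ?_
    simp only [wedge]
    ring
  rw [h, hswap]
  ring

/-- The defining property of `J'`: `⟨J'v, w⟩ = det (x, y, v, w)` for `p = x ∧ y`. -/
theorem form_normalJ (κ : ℝ) (hκ : κ * κ = 1) (p : Biv 2) (v w : Amb 2) :
    form κ (WithLp.toLp 2 ((normalJ κ p).mulVec v) : Amb 2) w = volForm p v w := by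
  have hs : ∀ d : Fin (2 + 2), sgn κ d * sgn κ d = 1 := fun d => by
    unfold sgn; split_ifs <;> simp [hκ]
  have h1 : form κ (WithLp.toLp 2 ((normalJ κ p).mulVec v) : Amb 2) w =
      ∑ d : Fin 4, ∑ c : Fin 4,
        volForm p (Pi.single c 1) (Pi.single d 1) * (v : Fin 4 → ℝ) c * (w : Fin 4 → ℝ) d := by
    simp only [form, Matrix.mulVec, dotProduct, normalJ, Finset.mul_sum, Finset.sum_mul]
    refine Finset.sum_congr rfl fun d _ => Finset.sum_congr rfl fun c _ => ?_
    linear_combination (volForm p (Pi.single c 1) (Pi.single d 1) * v c * w d) * hs d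
  rw [h1]
  simp only [volForm, Finset.mul_sum, Finset.sum_mul]
  rw [Finset.sum_congr rfl fun d _ => Finset.sum_comm, Finset.sum_comm]
  refine Finset.sum_congr rfl fun σ _ => ?_
  rw [Finset.sum_eq_single (σ 3), Finset.sum_eq_single (σ 2)]
  · simp
    ring
  · intro b _ hb
    simp [Pi.single_apply, hb.symm]
  · simp
  · intro b _ hb
    simp [Pi.single_apply, hb.symm]
  · simp

/-- The defining formula of `𝕁'`. -/
theorem bigJ'_tangent (κ : ℝ) (x y X Y : Amb 2) :
    bigJ' κ (wedge x y) (wedge x X + wedge y Y) =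
      wedge x (WithLp.toLp 2 ((normalJ κ (wedge x y)).mulVec X)) +
        wedge y (WithLp.toLp 2 ((normalJ κ (wedge x y)).mulVec Y)) := by
  have hadd : bigJ' κ (wedge x y) (wedge x X + wedge y Y) =
      bigJ' κ (wedge x y) (wedge x X) + bigJ' κ (wedge x y) (wedge y Y) := by
    funext j k
    simp only [bigJ', derivExt, Pi.add_apply, mul_add, Finset.sum_add_distrib]
    ring
  have hM : ∀ a : Amb 2, (∀ w : Amb 2, volForm (wedge x y) a w = 0) →
      (WithLp.toLp 2 ((normalJ κ (wedge x y)).mulVec a) : Amb 2) = 0 := by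
    intro a ha
    ext d
    have h2 := ha (WithLp.toLp 2 (Pi.single d 1))
    have h3 : ((normalJ κ (wedge x y)).mulVec a) d =
        sgn κ (n := 2) d * volForm (wedge x y) a (Pi.single d 1) := by
      simp only [normalJ, Matrix.mulVec, dotProduct, volForm, Finset.mul_sum, Finset.sum_mul]
      rw [Finset.sum_comm]
      refine Finset.sum_congr rfl fun σ _ => ?_
      rw [Finset.sum_eq_single (σ 2)]
      · simp
        ring
      · intro b _ hb
        simp [Pi.single_apply, hb.symm]
      · simp
    have h4 : volForm (wedge x y) a (Pi.single d 1) = 0 := h2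
    simpa [h4] using h3
  have hx := hM x fun w => by
    rw [volForm_wedge]
    exact Matrix.det_zero_of_row_eq (i := 0) (j := 2) (by decide) rfl
  have hy := hM y fun w => by
    rw [volForm_wedge]
    exact Matrix.det_zero_of_row_eq (i := 1) (j := 2) (by decide) rfl
  rw [hadd, bigJ', bigJ', derivExt_wedge, derivExt_wedge, hx, hy]
  funext j k
  simp [wedge]

end OrientedGeodesics

end

open OrientedGeodesics

/-! To first order, moving a hypersurface and moving its Gauss map $\Phi=\phi\wedge N$ by a
Hamiltonian field are the same operation up to reparametrization, and the functional of the
hypersurface is a constant multiple of the volume of the Gauss map.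

The link is the symplectic form. The symmetry of the second fundamental form makes the tangent
spaces of $\Phi$ isotropic, and they are maximal isotropic (`IsFrame.isotropic`,
`IsFrame.mem_range_gaussDiff`). If $(\phi_t,N_t)$ has normal speed $s$, differentiating the
constraints shows that the velocity $W$ of $\phi_t\wedge N_t$ satisfies
$\Omega(d\Phi(v),W)=-\kappa\,ds(v)$ (`IsVariation.gauss_velocity`). Since $\Omega(\cdot,\mathcal
J\cdot)=\mathcal G$, the field $\mathcal J\nabla u$ satisfies $\Omega(d\Phi(v),\mathcal J\nabla
u)=du(v)$ (`symplectic_of_gradient`). For $u=-\kappa s$ the difference of the two fields is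
$\Omega$-orthogonal to the image of $d\Phi$, hence equals $d\Phi(T)$ for some $T$. By the divergence
theorem a tangential field of compact support does not change the volume to first order
(`integral_firstVar_tangential`), so both fields give the same first variation. Each notion
quantifies over all its own variations, so each implication needs a variation of the other kind with
prescribed $u$ or $s$: `exists_hamiltonianVariation` and `exists_normalVariation`. Together these
give `isHamiltonianMinimal_iff_isCriticalPoint`.

The integrands come from linear algebra at a point. The metric induced by $G$ is $g(1+\kappa A^2)$,
whose density relative to $g$ is $\sqrt{\prod|1+\kappa k_i^2|}$ (`IsHypersurface.density_metricG`).
The Gram determinant for $G'$ is $-\det g\,(k_1-k_2)^2$, and $|k_1-k_2|/2=\sqrt{H^2-k_1k_2}$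
(`IsHypersurface.density_metricG'`); the Gauss equation $K=\kappa+k_1k_2$
(`IsHypersurface.gaussCurvature_eq`) brings in $K$. These identities hold for every hypersurface, so
they can be used for all small $t$ of a variation.

The measure theory rests on writing volume densities as functions of 1-jets. A change of chart
multiplies every density by the same Jacobian, so quotients of densities are global functions, and
all volumes become integrals against one fixed locally finite measure, which can be differentiated
under the integral sign (`hasDerivAt_volume`). -/

noncomputable section

namespace OrientedGeodesics

open Filter Topology

/-! ## Jets and their densities -/

section Jets

variable {n : ℕ} {V : Type*} [NormedAddCommGroup V] [NormedSpace ℝ V]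

/-- A field of bilinear forms on `V`, depending smoothly on the base point. -/
structure SmoothBilin (q : V → V → V → ℝ) : Prop where
  add_left : ∀ p u u' v, q p (u + u') v = q p u v + q p u' v
  smul_left : ∀ p (c : ℝ) u v, q p (c • u) v = c * q p u v
  add_right : ∀ p u v v', q p u (v + v') = q p u v + q p u v'
  smul_right : ∀ p (c : ℝ) u v, q p u (c • v) = c * q p u v
  smooth : ContDiff ℝ ∞ (fun z : V × V × V => q z.1 z.2.1 z.2.2)

theorem SmoothBilin.sum_left {q : V → V → V → ℝ} (hq : SmoothBilin q) {ι : Type*} (s : Finset ι)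
    (p : V) (f : ι → V) (v : V) : q p (∑ i ∈ s, f i) v = ∑ i ∈ s, q p (f i) v :=
  map_sum (AddMonoidHom.mk' (fun u => q p u v) fun a b => hq.add_left p a b v) f s

theorem SmoothBilin.sum_right {q : V → V → V → ℝ} (hq : SmoothBilin q) {ι : Type*} (s : Finset ι)
    (p : V) (u : V) (f : ι → V) : q p u (∑ i ∈ s, f i) = ∑ i ∈ s, q p u (f i) :=
  map_sum (AddMonoidHom.mk' (fun v => q p u v) fun a b => hq.add_right p u a b) f s

/-- The space of 1-jets of maps from an `n`-manifold to `V`. -/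
abbrev Jet (n : ℕ) (V : Type*) : Type _ := V × (Fin n → V)

/-- The Gram matrix of a 1-jet. -/
def jetGram (q : V → V → V → ℝ) (z : Jet n V) : Matrix (Fin n) (Fin n) ℝ :=
  fun i j => q z.1 (z.2 i) (z.2 j)

/-- The volume density of a 1-jet. -/
def jetDensity (q : V → V → V → ℝ) (z : Jet n V) : ℝ := Real.sqrt |(jetGram q z).det|

/-- Change of the basis of the tangent space. -/
def jetAct (A : Matrix (Fin n) (Fin n) ℝ) : Jet n V →L[ℝ] Jet n V :=
  (ContinuousLinearMap.fst ℝ V (Fin n → V)).prod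
    (ContinuousLinearMap.pi fun i => ∑ k, A k i •
      ((ContinuousLinearMap.proj k).comp (ContinuousLinearMap.snd ℝ V (Fin n → V))))

@[simp] theorem jetAct_fst (A : Matrix (Fin n) (Fin n) ℝ) (z : Jet n V) :
    (jetAct A z).1 = z.1 := rfl

theorem jetAct_snd (A : Matrix (Fin n) (Fin n) ℝ) (z : Jet n V) (i : Fin n) :
    (jetAct A z).2 i = ∑ k, A k i • z.2 k := by
  simp [jetAct]

theorem jetGram_jetAct {q : V → V → V → ℝ} (hq : SmoothBilin q) (A : Matrix (Fin n) (Fin n) ℝ)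
    (z : Jet n V) : jetGram q (jetAct A z) = A.transpose * jetGram q z * A := by
  ext i j
  simp only [jetGram, jetAct_fst, jetAct_snd, hq.sum_left, hq.sum_right, hq.smul_left,
    hq.smul_right, Matrix.mul_apply, Matrix.transpose_apply, Finset.sum_mul]
  rw [Finset.sum_comm]
  refine Finset.sum_congr rfl fun a _ => Finset.sum_congr rfl fun b _ => ?_
  ring

theorem det_jetGram_jetAct {q : V → V → V → ℝ} (hq : SmoothBilin q)
    (A : Matrix (Fin n) (Fin n) ℝ) (z : Jet n V) :
    (jetGram q (jetAct A z)).det = A.det ^ 2 * (jetGram q z).det := by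
  rw [jetGram_jetAct hq, Matrix.det_mul, Matrix.det_mul, Matrix.det_transpose]
  ring

theorem jetDensity_jetAct {q : V → V → V → ℝ} (hq : SmoothBilin q)
    (A : Matrix (Fin n) (Fin n) ℝ) (z : Jet n V) :
    jetDensity q (jetAct A z) = |A.det| * jetDensity q z := by
  rw [jetDensity, det_jetGram_jetAct hq, abs_mul, Real.sqrt_mul (abs_nonneg _), abs_pow,
    Real.sqrt_sq (abs_nonneg _), jetDensity]

omit [NormedAddCommGroup V] [NormedSpace ℝ V] in
theorem jetDensity_nonneg (q : V → V → V → ℝ) (z : Jet n V) : 0 ≤ jetDensity q z :=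
  Real.sqrt_nonneg _

omit [NormedAddCommGroup V] [NormedSpace ℝ V] in
theorem jetDensity_pos {q : V → V → V → ℝ} {z : Jet n V} (h : (jetGram q z).det ≠ 0) :
    0 < jetDensity q z := Real.sqrt_pos.2 (abs_pos.2 h)

theorem contDiff_det {X : Type*} [NormedAddCommGroup X] [NormedSpace ℝ X] {m : ℕ}
    {f : X → Matrix (Fin m) (Fin m) ℝ} {k : WithTop ℕ∞} (hf : ∀ i j, ContDiff ℝ k fun x => f x i j) :
    ContDiff ℝ k fun x => (f x).det := by
  simp only [Matrix.det_apply']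
  exact ContDiff.sum fun σ _ => contDiff_const.mul (contDiff_prod fun i _ => hf _ _)

theorem contDiff_jetGram {q : V → V → V → ℝ} (hq : SmoothBilin q) (i j : Fin n) :
    ContDiff ℝ ∞ fun z : Jet n V => jetGram q z i j := by
  have : ContDiff ℝ ∞ fun z : Jet n V => (z.1, z.2 i, z.2 j) := by fun_prop
  exact hq.smooth.comp this

theorem contDiff_det_jetGram {q : V → V → V → ℝ} (hq : SmoothBilin q) :
    ContDiff ℝ ∞ fun z : Jet n V => (jetGram q z).det :=
  contDiff_det (contDiff_jetGram hq)

/-- Both the absolute value and the square root are smooth only away from zero, which is where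
non-degeneracy of the induced metric enters the analysis. -/
theorem contDiffAt_jetDensity {q : V → V → V → ℝ} (hq : SmoothBilin q) {z : Jet n V}
    (hz : (jetGram q z).det ≠ 0) : ContDiffAt ℝ ∞ (jetDensity q) z := by
  have h1 := (contDiff_det_jetGram (n := n) hq).contDiffAt (x := z)
  have h2 : ContDiffAt ℝ ∞ (fun z : Jet n V => |(jetGram q z).det|) z :=
    ContDiffAt.comp (g := fun r : ℝ => |r|) z (contDiffAt_abs hz) h1
  exact h2.sqrt (abs_pos.2 hz).ne'

theorem continuous_jetDensity {q : V → V → V → ℝ} (hq : SmoothBilin q) :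
    Continuous (jetDensity (n := n) q) :=
  Real.continuous_sqrt.comp (contDiff_det_jetGram hq).continuous.abs

/-- Differentiates the identity `jetDensity_jetAct`, using that `jetAct A` is linear. The derivative
of the density scales by the same Jacobian as the density itself, so their quotient `firstVar` does
not depend on the chart. -/
theorem fderiv_jetDensity_jetAct {q : V → V → V → ℝ} (hq : SmoothBilin q)
    {A : Matrix (Fin n) (Fin n) ℝ} (hA : A.det ≠ 0) {z : Jet n V} (hz : (jetGram q z).det ≠ 0)
    (w : Jet n V) :
    fderiv ℝ (jetDensity q) (jetAct A z) (jetAct A w) = |A.det| * fderiv ℝ (jetDensity q) z w := by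
  have hz' : (jetGram q (jetAct A z)).det ≠ 0 := by
    rw [det_jetGram_jetAct hq]; positivity
  have h1 := ((contDiffAt_jetDensity hq hz').differentiableAt (by simp)).hasFDerivAt.comp z
    (jetAct (V := V) A).hasFDerivAt
  have h2 := ((contDiffAt_jetDensity hq hz).differentiableAt (by simp)).hasFDerivAt.const_mul
    |A.det|
  have h3 : jetDensity q ∘ (jetAct (V := V) A) = fun z => |A.det| * jetDensity q z :=
    funext fun z => jetDensity_jetAct hq A z
  rw [h3] at h1
  simpa using congrArg (fun L => L w) (h1.unique h2)

end Jets

/-! ## Jets of maps on manifolds -/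

section ChartJets

variable {n : ℕ} {S : Type*} [TopologicalSpace S] [ChartedSpace (EuclideanSpace ℝ (Fin n)) S]
  {V : Type*} [NormedAddCommGroup V] [NormedSpace ℝ V]

/-- The 1-jet of `F` at `x`, in the coordinate basis of the chart at `x`. -/
def jet (F : S → V) (x : S) : Jet n V := (F x, fun i => diff n F x (tangentBasis x i))

/-- The 1-jet of `F` in the chart `e`, at the coordinate point `y`. -/
def jetIn (e : OpenPartialHomeomorph S (EuclideanSpace ℝ (Fin n))) (F : S → V)
    (y : EuclideanSpace ℝ (Fin n)) : Jet n V :=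
  (F (e.symm y), fun i => fderiv ℝ (F ∘ e.symm) y (EuclideanSpace.single i 1))

/-- The differential of the chart `e` at `x`, as an endomorphism of the model space. -/
def chartLin (e : OpenPartialHomeomorph S (EuclideanSpace ℝ (Fin n))) (x : S) :
    EuclideanSpace ℝ (Fin n) →L[ℝ] EuclideanSpace ℝ (Fin n) :=
  mfderiv (𝓡 n) (𝓡 n) e x

/-- The matrix of the differential of the chart `e` at `x`. -/
def chartMat (e : OpenPartialHomeomorph S (EuclideanSpace ℝ (Fin n))) (x : S) :
    Matrix (Fin n) (Fin n) ℝ :=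
  fun k i => chartLin e x (EuclideanSpace.single i 1) k

theorem euclidean_sum_single (v : EuclideanSpace ℝ (Fin n)) :
    v = ∑ k, v k • EuclideanSpace.single k (1 : ℝ) := by
  ext j
  simp [Finset.sum_apply, Pi.single_apply]

theorem diff_eq_sum (F : S → V) (x : S) (v : EuclideanSpace ℝ (Fin n)) :
    diff n F x v = ∑ k, v k • (jet F x).2 k := by
  have h : diff n F x v = ∑ k, diff n F x (v k • EuclideanSpace.single k (1 : ℝ)) := by
    conv_lhs => rw [euclidean_sum_single v]
    exact map_sum (diff n F x) _ _
  rw [h]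
  exact Finset.sum_congr rfl fun k _ => map_smul (diff n F x) _ _

variable [IsManifold (𝓡 n) ∞ S] {e : OpenPartialHomeomorph S (EuclideanSpace ℝ (Fin n))}

theorem mem_maximalAtlas_of_atlas (he : e ∈ atlas (EuclideanSpace ℝ (Fin n)) S) :
    e ∈ IsManifold.maximalAtlas (𝓡 n) ∞ S :=
  IsManifold.subset_maximalAtlas he

theorem contMDiffOn_chart' (he : e ∈ atlas (EuclideanSpace ℝ (Fin n)) S) :
    ContMDiffOn (𝓡 n) (𝓡 n) ∞ e e.source :=
  contMDiffOn_of_mem_maximalAtlas (mem_maximalAtlas_of_atlas he)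

theorem contMDiffOn_chart_symm' (he : e ∈ atlas (EuclideanSpace ℝ (Fin n)) S) :
    ContMDiffOn (𝓡 n) (𝓡 n) ∞ e.symm e.target :=
  contMDiffOn_symm_of_mem_maximalAtlas (mem_maximalAtlas_of_atlas he)

theorem contMDiffAt_chart'' (he : e ∈ atlas (EuclideanSpace ℝ (Fin n)) S) {x : S}
    (hx : x ∈ e.source) : ContMDiffAt (𝓡 n) (𝓡 n) ∞ e x :=
  (contMDiffOn_chart' he).contMDiffAt (e.open_source.mem_nhds hx)

theorem contMDiffAt_chart_symm'' (he : e ∈ atlas (EuclideanSpace ℝ (Fin n)) S)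
    {y : EuclideanSpace ℝ (Fin n)} (hy : y ∈ e.target) : ContMDiffAt (𝓡 n) (𝓡 n) ∞ e.symm y :=
  (contMDiffOn_chart_symm' he).contMDiffAt (e.open_target.mem_nhds hy)

/-- The differential in terms of the chart `e`. -/
theorem diff_eq_fderiv (he : e ∈ atlas (EuclideanSpace ℝ (Fin n)) S) {x : S} (hx : x ∈ e.source)
    {F : S → V} (hF : MDifferentiableAt (𝓡 n) 𝓘(ℝ, V) F x) (v : TangentSpace (𝓡 n) x) :
    diff n F x v = fderiv ℝ (F ∘ e.symm) (e x) (chartLin e x v) := by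
  have h1 : MDifferentiableAt (𝓡 n) (𝓡 n) e x :=
    (contMDiffAt_chart'' he hx).mdifferentiableAt (by simp)
  have h2 : MDifferentiableAt (𝓡 n) (𝓡 n) e.symm (e x) :=
    (contMDiffAt_chart_symm'' he (e.map_source hx)).mdifferentiableAt (by simp)
  have h3 : MDifferentiableAt (𝓡 n) 𝓘(ℝ, V) F (e.symm (e x)) := by rwa [e.left_inv hx]
  have h4 := mfderiv_comp x (h3.comp (e x) h2) h1
  have h5 : ((F ∘ e.symm) ∘ e) =ᶠ[𝓝 x] F := by
    filter_upwards [e.open_source.mem_nhds hx] with z hz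
    simp [e.left_inv hz]
  rw [h5.mfderiv_eq] at h4
  rw [diff, h4, mfderiv_eq_fderiv]
  rfl

theorem mfderiv_symm_chartLin (he : e ∈ atlas (EuclideanSpace ℝ (Fin n)) S) {x : S}
    (hx : x ∈ e.source) (v : EuclideanSpace ℝ (Fin n)) :
    mfderiv (𝓡 n) (𝓡 n) e.symm (e x) (chartLin e x v) = v := by
  have h1 : MDifferentiableAt (𝓡 n) (𝓡 n) e x :=
    (contMDiffAt_chart'' he hx).mdifferentiableAt (by simp)
  have h2 : MDifferentiableAt (𝓡 n) (𝓡 n) e.symm (e x) :=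
    (contMDiffAt_chart_symm'' he (e.map_source hx)).mdifferentiableAt (by simp)
  have h4 := mfderiv_comp x h2 h1
  have h5 : (e.symm ∘ e) =ᶠ[𝓝 x] id := by
    filter_upwards [e.open_source.mem_nhds hx] with z hz
    simp [e.left_inv hz]
  rw [h5.mfderiv_eq, mfderiv_id] at h4
  exact (congrArg (fun L => L v) h4).symm

theorem chartLin_injective (he : e ∈ atlas (EuclideanSpace ℝ (Fin n)) S) {x : S}
    (hx : x ∈ e.source) : Function.Injective (chartLin e x) := by
  intro v w hvw
  rw [← mfderiv_symm_chartLin he hx v, hvw, mfderiv_symm_chartLin he hx w]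

theorem chartLin_surjective (he : e ∈ atlas (EuclideanSpace ℝ (Fin n)) S) {x : S}
    (hx : x ∈ e.source) : Function.Surjective (chartLin e x) :=
  LinearMap.injective_iff_surjective (f := (chartLin e x).toLinearMap).1 (chartLin_injective he hx)

theorem clm_eq_sum {W : Type*} [AddCommGroup W] [Module ℝ W] [TopologicalSpace W]
    (L : EuclideanSpace ℝ (Fin n) →L[ℝ] W) (v : EuclideanSpace ℝ (Fin n)) :
    L v = ∑ i, v i • L (EuclideanSpace.single i 1) := by
  conv_lhs => rw [euclidean_sum_single v, map_sum]
  simp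

theorem det_chartMat_ne_zero (he : e ∈ atlas (EuclideanSpace ℝ (Fin n)) S) {x : S}
    (hx : x ∈ e.source) : (chartMat e x).det ≠ 0 := by
  intro h0
  obtain ⟨v, hv, hv0⟩ := Matrix.exists_mulVec_eq_zero_iff.2 h0
  apply hv
  have h1 : chartLin e x (WithLp.toLp 2 v) = 0 := by
    rw [clm_eq_sum]
    ext k
    have := congrFun hv0 k
    simp only [Matrix.mulVec, dotProduct, chartMat] at this
    simpa [mul_comm] using this
  have h4 := chartLin_injective he hx (h1.trans (map_zero _).symm)
  exact congrArg WithLp.ofLp h4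

/-- The chart in which `jet F x` is taken changes with `x`. This lemma moves the jet into one fixed
chart at the cost of an invertible change of basis, which all invariant constructions then absorb.
-/
theorem jet_eq_jetAct (he : e ∈ atlas (EuclideanSpace ℝ (Fin n)) S) {x : S} (hx : x ∈ e.source)
    {F : S → V} (hF : MDifferentiableAt (𝓡 n) 𝓘(ℝ, V) F x) :
    jet F x = jetAct (chartMat e x) (jetIn e F (e x)) := by
  refine Prod.ext ?_ ?_
  · simp [jet, jetIn, e.left_inv hx]
  · funext i
    rw [jetAct_snd]
    simp only [jet, jetIn]
    rw [diff_eq_fderiv he hx hF]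
    rw [clm_eq_sum]
    rfl

-- Mathlib trivializes the tangent space at `x` by the preferred chart at `x`, so in that chart no
-- change of basis appears.
omit [IsManifold (𝓡 n) ∞ S] in
theorem jet_eq_jetIn_chartAt {x : S} {F : S → V} (hF : MDifferentiableAt (𝓡 n) 𝓘(ℝ, V) F x) :
    jet F x = jetIn (chartAt (EuclideanSpace ℝ (Fin n)) x) F
      (chartAt (EuclideanSpace ℝ (Fin n)) x x) := by
  refine Prod.ext ?_ ?_
  · simp [jet, jetIn]
  · funext i
    simp only [jet, jetIn, diff]
    rw [hF.mfderiv]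
    simp [writtenInExtChartAt, tangentBasis]
    rfl

end ChartJets

end OrientedGeodesics
end

noncomputable section

namespace OrientedGeodesics

open Filter Topology

/-- The regularity threshold for the symmetry of second derivatives over the reals. -/
theorem two_le_smooth : minSmoothness ℝ 2 ≤ (∞ : WithTop ℕ∞) := by
  rw [minSmoothness_of_isRCLikeNormedField]
  exact WithTop.coe_le_coe.2 (OrderTop.le_top (2 : ℕ∞))

/-! ### Smooth maps and one-parameter families in a chart -/

section ChartSmooth

variable {n : ℕ} {S : Type*} [TopologicalSpace S] [ChartedSpace (EuclideanSpace ℝ (Fin n)) S]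
  {V : Type*} [NormedAddCommGroup V] [NormedSpace ℝ V]
  [IsManifold (𝓡 n) ∞ S] {e : OpenPartialHomeomorph S (EuclideanSpace ℝ (Fin n))}

theorem contDiffOn_comp_symm (he : e ∈ atlas (EuclideanSpace ℝ (Fin n)) S) {F : S → V}
    (hF : ContMDiff (𝓡 n) 𝓘(ℝ, V) ∞ F) : ContDiffOn ℝ ∞ (F ∘ e.symm) e.target := by
  rw [← contMDiffOn_iff_contDiffOn]
  exact hF.comp_contMDiffOn (contMDiffOn_chart_symm' he)

/-- A family of maps, smooth in the time and the space variable. -/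
def SmoothFamily (n : ℕ) {S : Type*} [TopologicalSpace S]
    [ChartedSpace (EuclideanSpace ℝ (Fin n)) S] {V : Type*} [NormedAddCommGroup V]
    [NormedSpace ℝ V] (δ : ℝ) (F : ℝ → S → V) : Prop :=
  ContMDiffOn (𝓘(ℝ, ℝ).prod (𝓡 n)) 𝓘(ℝ, V) ∞ (fun z : ℝ × S => F z.1 z.2) (Ioo (-δ) δ ×ˢ univ)

/-- The coordinate expression of a family of maps. -/
def famIn (e : OpenPartialHomeomorph S (EuclideanSpace ℝ (Fin n))) (F : ℝ → S → V) :
    ℝ × EuclideanSpace ℝ (Fin n) → V := fun z => F z.1 (e.symm z.2)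

theorem SmoothFamily.contDiffOn {δ : ℝ} {F : ℝ → S → V} (hF : SmoothFamily n δ F)
    (he : e ∈ atlas (EuclideanSpace ℝ (Fin n)) S) :
    ContDiffOn ℝ ∞ (famIn e F) (Ioo (-δ) δ ×ˢ e.target) := by
  rw [← contMDiffOn_iff_contDiffOn, modelWithCornersSelf_prod, ← chartedSpaceSelf_prod]
  have h : ContMDiffOn (𝓘(ℝ, ℝ).prod (𝓡 n)) (𝓘(ℝ, ℝ).prod (𝓡 n)) ∞
      (fun z : ℝ × EuclideanSpace ℝ (Fin n) => (z.1, e.symm z.2)) (Ioo (-δ) δ ×ˢ e.target) :=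
    (contMDiff_fst.contMDiffOn).prodMk
      ((contMDiffOn_chart_symm' he).comp contMDiff_snd.contMDiffOn fun z hz => hz.2)
  exact ContMDiffOn.comp hF h fun z hz => ⟨hz.1, mem_univ _⟩

theorem contMDiffAt_of_chart (he : e ∈ atlas (EuclideanSpace ℝ (Fin n)) S) {x : S}
    (hx : x ∈ e.source) {f : S → V} {G : EuclideanSpace ℝ (Fin n) → V}
    (hG : ContDiffAt ℝ ∞ G (e x)) (hf : ∀ᶠ z in 𝓝 x, f z = G (e z)) :
    ContMDiffAt (𝓡 n) 𝓘(ℝ, V) ∞ f x := by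
  have h : ContMDiffAt (𝓡 n) 𝓘(ℝ, V) ∞ (G ∘ e) x :=
    hG.contMDiffAt.comp x (contMDiffAt_chart'' he hx)
  exact h.congr_of_eventuallyEq hf

theorem contMDiffAt_family_of_chart (he : e ∈ atlas (EuclideanSpace ℝ (Fin n)) S) {x : S}
    (hx : x ∈ e.source) {t : ℝ} {f : ℝ → S → V} {G : ℝ × EuclideanSpace ℝ (Fin n) → V}
    (hG : ContDiffAt ℝ ∞ G (t, e x)) (hf : ∀ᶠ z in 𝓝 (t, x), f z.1 z.2 = G (z.1, e z.2)) :
    ContMDiffAt (𝓘(ℝ, ℝ).prod (𝓡 n)) 𝓘(ℝ, V) ∞ (fun z : ℝ × S => f z.1 z.2) (t, x) := by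
  have h1 : ContMDiffAt (𝓘(ℝ, ℝ).prod (𝓡 n)) 𝓘(ℝ, ℝ × EuclideanSpace ℝ (Fin n)) ∞
      (fun z : ℝ × S => (z.1, e z.2)) (t, x) := by
    rw [modelWithCornersSelf_prod, ← chartedSpaceSelf_prod]
    exact contMDiffAt_fst.prodMk
      (ContMDiffAt.comp (g := e) (t, x) (contMDiffAt_chart'' he hx) contMDiffAt_snd)
  have h : ContMDiffAt (𝓘(ℝ, ℝ).prod (𝓡 n)) 𝓘(ℝ, V) ∞ (G ∘ fun z : ℝ × S => (z.1, e z.2)) (t, x) :=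
    ContMDiffAt.comp (t, x) hG.contMDiffAt h1
  exact h.congr_of_eventuallyEq hf

omit [IsManifold (𝓡 n) ∞ S] in
theorem SmoothFamily.contMDiff {δ : ℝ} {F : ℝ → S → V} (hF : SmoothFamily n δ F) {t : ℝ}
    (ht : t ∈ Ioo (-δ) δ) : ContMDiff (𝓡 n) 𝓘(ℝ, V) ∞ (F t) := by
  rw [← contMDiffOn_univ]
  have h : ContMDiffOn (𝓡 n) (𝓘(ℝ, ℝ).prod (𝓡 n)) ∞ (fun x : S => (t, x)) univ :=
    contMDiffOn_const.prodMk contMDiffOn_id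
  exact ContMDiffOn.comp (g := fun z : ℝ × S => F z.1 z.2) hF h fun x _ => ⟨ht, mem_univ _⟩

theorem SmoothFamily.hasFDerivAt_famIn {δ : ℝ} {F : ℝ → S → V} (hF : SmoothFamily n δ F)
    (he : e ∈ atlas (EuclideanSpace ℝ (Fin n)) S) {z : ℝ × EuclideanSpace ℝ (Fin n)}
    (hz : z ∈ Ioo (-δ) δ ×ˢ e.target) : HasFDerivAt (famIn e F) (fderiv ℝ (famIn e F) z) z :=
  (((hF.contDiffOn he).contDiffAt ((isOpen_Ioo.prod e.open_target).mem_nhds hz)).differentiableAt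
    (by simp)).hasFDerivAt

theorem SmoothFamily.fderiv_comp_symm {δ : ℝ} {F : ℝ → S → V} (hF : SmoothFamily n δ F)
    (he : e ∈ atlas (EuclideanSpace ℝ (Fin n)) S) {z : ℝ × EuclideanSpace ℝ (Fin n)}
    (hz : z ∈ Ioo (-δ) δ ×ˢ e.target) (v : EuclideanSpace ℝ (Fin n)) :
    fderiv ℝ (F z.1 ∘ e.symm) z.2 v = fderiv ℝ (famIn e F) z (0, v) := by
  have h := HasFDerivAt.comp (g := famIn e F) z.2 (hF.hasFDerivAt_famIn he hz)
    (hasFDerivAt_prodMk_right (𝕜 := ℝ) z.1 z.2)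
  rw [show F z.1 ∘ e.symm = famIn e F ∘ fun y => (z.1, y) from rfl, h.fderiv]
  rfl

theorem SmoothFamily.hasDerivAt_time {δ : ℝ} {F : ℝ → S → V} (hF : SmoothFamily n δ F)
    (he : e ∈ atlas (EuclideanSpace ℝ (Fin n)) S) {z : ℝ × EuclideanSpace ℝ (Fin n)}
    (hz : z ∈ Ioo (-δ) δ ×ˢ e.target) :
    HasDerivAt (fun t => F t (e.symm z.2)) (fderiv ℝ (famIn e F) z (1, 0)) z.1 := by
  have h := HasFDerivAt.comp (g := famIn e F) z.1 (hF.hasFDerivAt_famIn he hz)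
    (hasFDerivAt_prodMk_left (𝕜 := ℝ) z.1 z.2)
  exact h.hasDerivAt

theorem SmoothFamily.contDiffOn_jetIn {δ : ℝ} {F : ℝ → S → V} (hF : SmoothFamily n δ F)
    (he : e ∈ atlas (EuclideanSpace ℝ (Fin n)) S) :
    ContDiffOn ℝ ∞ (fun z : ℝ × EuclideanSpace ℝ (Fin n) => jetIn e (F z.1) z.2)
      (Ioo (-δ) δ ×ˢ e.target) := by
  have ho : IsOpen (Ioo (-δ) δ ×ˢ e.target) := isOpen_Ioo.prod e.open_target
  have h1 : ContDiffOn ℝ ∞ (fderiv ℝ (famIn e F)) (Ioo (-δ) δ ×ˢ e.target) :=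
    (hF.contDiffOn he).fderiv_of_isOpen ho (by simp)
  refine ContDiffOn.prodMk (hF.contDiffOn he) (contDiffOn_pi.2 fun i => ?_)
  refine (h1.clm_apply (contDiffOn_const (c := ((0 : ℝ),
    (EuclideanSpace.single i 1 : EuclideanSpace ℝ (Fin n)))))).congr fun z hz => ?_
  exact hF.fderiv_comp_symm he hz _

/-- The initial velocity of a family of maps. -/
def velocity (F : ℝ → S → V) (x : S) : V := deriv (fun t => F t x) 0

theorem zero_mem_Ioo {δ : ℝ} (hδ : 0 < δ) : (0 : ℝ) ∈ Ioo (-δ) δ := ⟨by linarith, hδ⟩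

theorem SmoothFamily.velocity_symm {δ : ℝ} (hδ : 0 < δ) {F : ℝ → S → V}
    (hF : SmoothFamily n δ F) (he : e ∈ atlas (EuclideanSpace ℝ (Fin n)) S)
    {y : EuclideanSpace ℝ (Fin n)} (hy : y ∈ e.target) :
    velocity F (e.symm y) = fderiv ℝ (famIn e F) (0, y) (1, 0) :=
  (hF.hasDerivAt_time he (z := (0, y)) ⟨zero_mem_Ioo hδ, hy⟩).deriv

theorem SmoothFamily.hasDerivAt_velocity {δ : ℝ} (hδ : 0 < δ) {F : ℝ → S → V}
    (hF : SmoothFamily n δ F) (x : S) : HasDerivAt (fun t => F t x) (velocity F x) 0 := by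
  have h := hF.hasDerivAt_time (chart_mem_atlas (EuclideanSpace ℝ (Fin n)) x)
    (z := (0, chartAt (EuclideanSpace ℝ (Fin n)) x x)) ⟨zero_mem_Ioo hδ, mem_chart_target _ _⟩
  simp only [mem_chart_source, OpenPartialHomeomorph.left_inv] at h
  exact h.differentiableAt.hasDerivAt

theorem SmoothFamily.contDiffOn_velocity {δ : ℝ} (hδ : 0 < δ) {F : ℝ → S → V}
    (hF : SmoothFamily n δ F) (he : e ∈ atlas (EuclideanSpace ℝ (Fin n)) S) :
    ContDiffOn ℝ ∞ (velocity F ∘ e.symm) e.target := by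
  have ho : IsOpen (Ioo (-δ) δ ×ˢ e.target) := isOpen_Ioo.prod e.open_target
  have h1 : ContDiffOn ℝ ∞ (fderiv ℝ (famIn e F)) (Ioo (-δ) δ ×ˢ e.target) :=
    (hF.contDiffOn he).fderiv_of_isOpen ho (by simp)
  have h2 : ContDiffOn ℝ ∞ (fun y : EuclideanSpace ℝ (Fin n) => ((0 : ℝ), y)) e.target := by
    fun_prop
  have h3 := (h1.comp h2 fun y hy => ⟨zero_mem_Ioo hδ, hy⟩).clm_apply
    (contDiffOn_const (c := ((1 : ℝ), (0 : EuclideanSpace ℝ (Fin n)))))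
  exact h3.congr fun y hy => hF.velocity_symm hδ he hy

theorem SmoothFamily.contMDiff_velocity {δ : ℝ} (hδ : 0 < δ) {F : ℝ → S → V}
    (hF : SmoothFamily n δ F) : ContMDiff (𝓡 n) 𝓘(ℝ, V) ∞ (velocity F) := by
  intro x
  have he := chart_mem_atlas (EuclideanSpace ℝ (Fin n)) x
  refine contMDiffAt_of_chart he (mem_chart_source _ x)
    ((hF.contDiffOn_velocity hδ he).contDiffAt
      ((chartAt (EuclideanSpace ℝ (Fin n)) x).open_target.mem_nhds (mem_chart_target _ x))) ?_
  filter_upwards [(chartAt (EuclideanSpace ℝ (Fin n)) x).open_source.mem_nhds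
    (mem_chart_source _ x)] with z hz
  simp [OpenPartialHomeomorph.left_inv _ hz]

/-- Time and space derivatives commute: the symmetry of the second derivative of the joint map
`famIn e F` at the vectors `(1, 0)` and `(0, v)`. -/
theorem SmoothFamily.hasDerivAt_jetIn {δ : ℝ} (hδ : 0 < δ) {F : ℝ → S → V}
    (hF : SmoothFamily n δ F) (he : e ∈ atlas (EuclideanSpace ℝ (Fin n)) S)
    {y : EuclideanSpace ℝ (Fin n)} (hy : y ∈ e.target) :
    HasDerivAt (fun t => jetIn e (F t) y) (jetIn e (velocity F) y) 0 := by
  have ho : IsOpen (Ioo (-δ) δ ×ˢ e.target) := isOpen_Ioo.prod e.open_target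
  have hm : ((0 : ℝ), y) ∈ Ioo (-δ) δ ×ˢ e.target := ⟨zero_mem_Ioo hδ, hy⟩
  have hc := (hF.contDiffOn he).contDiffAt (ho.mem_nhds hm)
  refine HasDerivAt.prodMk ?_ (hasDerivAt_pi.2 fun i => ?_)
  · have := hF.hasDerivAt_time he hm
    rwa [← hF.velocity_symm hδ he hy] at this
  · have hd : DifferentiableAt ℝ (fderiv ℝ (famIn e F)) (0, y) :=
      (hc.fderiv_right (m := ∞) (by simp)).differentiableAt (by simp)
    have h1 : HasDerivAt (fun t : ℝ => fderiv ℝ (famIn e F) (t, y) (0, EuclideanSpace.single i 1))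
        (fderiv ℝ (fderiv ℝ (famIn e F)) (0, y) (1, 0) (0, EuclideanSpace.single i 1)) 0 := by
      have := (hd.hasFDerivAt.comp (0 : ℝ) (hasFDerivAt_prodMk_left (0 : ℝ) y)).hasDerivAt
      simpa using this.clm_apply (hasDerivAt_const (0 : ℝ)
        ((0 : ℝ), (EuclideanSpace.single i 1 : EuclideanSpace ℝ (Fin n))))
    have h2 : fderiv ℝ (velocity F ∘ e.symm) y (EuclideanSpace.single i 1) =
        fderiv ℝ (fderiv ℝ (famIn e F)) (0, y) (0, EuclideanSpace.single i 1) (1, 0) := by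
      have h3 := (hd.hasFDerivAt.comp y (hasFDerivAt_prodMk_right (0 : ℝ) y)).clm_apply
        (hasFDerivAt_const ((1 : ℝ), (0 : EuclideanSpace ℝ (Fin n))) y)
      have h4 : (velocity F ∘ e.symm) =ᶠ[𝓝 y] fun y => fderiv ℝ (famIn e F) (0, y) (1, 0) := by
        filter_upwards [e.open_target.mem_nhds hy] with z hz
        exact hF.velocity_symm hδ he hz
      rw [h4.fderiv_eq]
      erw [h3.fderiv]
      simp
    have h5 : IsSymmSndFDerivAt ℝ (famIn e F) (0, y) :=
      hc.isSymmSndFDerivAt two_le_smooth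
    change HasDerivAt _ (fderiv ℝ (velocity F ∘ e.symm) y (EuclideanSpace.single i 1)) 0
    rw [h2, h5.eq]
    refine h1.congr_of_eventuallyEq ?_
    filter_upwards [isOpen_Ioo.mem_nhds (zero_mem_Ioo hδ)] with t ht
    exact hF.fderiv_comp_symm he (z := (t, y)) ⟨ht, hy⟩ _

theorem SmoothFamily.hasDerivAt_jet {δ : ℝ} (hδ : 0 < δ) {F : ℝ → S → V}
    (hF : SmoothFamily n δ F) (x : S) :
    HasDerivAt (fun t => jet (n := n) (F t) x) (jet (n := n) (velocity F) x) 0 := by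
  have he := chart_mem_atlas (EuclideanSpace ℝ (Fin n)) x
  have hx := mem_chart_source (EuclideanSpace ℝ (Fin n)) x
  rw [jet_eq_jetAct he hx ((hF.contMDiff_velocity hδ).mdifferentiableAt (by simp))]
  have h := (jetAct (V := V) (chartMat (chartAt (EuclideanSpace ℝ (Fin n)) x) x)).hasFDerivAt
    |>.comp_hasDerivAt (0 : ℝ) (hF.hasDerivAt_jetIn hδ he (mem_chart_target _ x))
  refine h.congr_of_eventuallyEq ?_
  filter_upwards [isOpen_Ioo.mem_nhds (zero_mem_Ioo hδ)] with t ht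
  exact jet_eq_jetAct he hx ((hF.contMDiff ht).mdifferentiableAt (by simp))

theorem SmoothFamily.hasDerivAt_diff {δ : ℝ} (hδ : 0 < δ) {F : ℝ → S → V}
    (hF : SmoothFamily n δ F) (x : S) (v : EuclideanSpace ℝ (Fin n)) :
    HasDerivAt (fun t => diff n (F t) x v) (diff n (velocity F) x v) 0 := by
  simp only [diff_eq_sum]
  have h := hasDerivAt_pi.1 (hF.hasDerivAt_jet hδ x).snd
  exact HasDerivAt.fun_sum fun k _ => (h k).const_smul (v k)

/-- The jets of a smooth map are smooth in a chart. -/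
theorem contDiffOn_jetIn (he : e ∈ atlas (EuclideanSpace ℝ (Fin n)) S) {F : S → V}
    (hF : ContMDiff (𝓡 n) 𝓘(ℝ, V) ∞ F) : ContDiffOn ℝ ∞ (jetIn e F) e.target := by
  have h1 := (contDiffOn_comp_symm he hF).fderiv_of_isOpen (m := ∞) e.open_target (by simp)
  refine ContDiffOn.prodMk (contDiffOn_comp_symm he hF) (contDiffOn_pi.2 fun i => ?_)
  exact h1.clm_apply contDiffOn_const

/-- The matrix of an endomorphism of the model space. -/
def endMat (L : EuclideanSpace ℝ (Fin n) →L[ℝ] EuclideanSpace ℝ (Fin n)) :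
    Matrix (Fin n) (Fin n) ℝ := fun k i => L (EuclideanSpace.single i 1) k

theorem det_endMat (L : EuclideanSpace ℝ (Fin n) →L[ℝ] EuclideanSpace ℝ (Fin n)) :
    (endMat L).det = L.det := by
  rw [ContinuousLinearMap.det, ← LinearMap.det_toMatrix (EuclideanSpace.basisFun (Fin n) ℝ).toBasis]
  congr 1

/-- The chain rule for the transition map. The change of basis is its Jacobian matrix, which is what
the change of variables formula for the densities requires. -/
theorem jetIn_transition {e' : OpenPartialHomeomorph S (EuclideanSpace ℝ (Fin n))}
    (he : e ∈ atlas (EuclideanSpace ℝ (Fin n)) S)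
    {F : S → V} (hF : ContMDiff (𝓡 n) 𝓘(ℝ, V) ∞ F) {y : EuclideanSpace ℝ (Fin n)}
    (hy : y ∈ e'.target) (hy' : e'.symm y ∈ e.source) 
    (hd : DifferentiableAt ℝ (e ∘ e'.symm) y) :
    jetIn e' F y = jetAct (endMat (fderiv ℝ (e ∘ e'.symm) y))
      (jetIn e F (e (e'.symm y))) := by
  refine Prod.ext ?_ ?_
  · simp [jetIn, e.left_inv hy']
  · funext i
    rw [jetAct_snd]
    simp only [jetIn]
    have h1 : (F ∘ e'.symm) =ᶠ[𝓝 y] (F ∘ e.symm) ∘ (e ∘ e'.symm) := by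
      filter_upwards [(e'.symm.continuousAt hy).preimage_mem_nhds (e.open_source.mem_nhds hy')]
        with z hz
      simp [e.left_inv hz]
    have h2 : DifferentiableAt ℝ (F ∘ e.symm) ((e ∘ e'.symm) y) :=
      ((contDiffOn_comp_symm he hF).contDiffAt
        (e.open_target.mem_nhds (e.map_source hy'))).differentiableAt (by simp)
    rw [h1.fderiv_eq, fderiv_comp y h2 hd, ContinuousLinearMap.comp_apply, clm_eq_sum]
    rfl

end ChartSmooth

end OrientedGeodesics
end

noncomputable section

namespace OrientedGeodesics

open Filter Topology

/-! ## The induced volume measure -/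

section Volume

variable {n : ℕ} {S : Type*} [TopologicalSpace S] [ChartedSpace (EuclideanSpace ℝ (Fin n)) S]
  {V : Type*} [NormedAddCommGroup V] [NormedSpace ℝ V]
  [IsManifold (𝓡 n) ∞ S] [MeasurableSpace S] [BorelSpace S]
  {e e' : OpenPartialHomeomorph S (EuclideanSpace ℝ (Fin n))}
  {q : V → V → V → ℝ} {F : S → V}

omit [ChartedSpace (EuclideanSpace ℝ (Fin n)) S] [IsManifold (𝓡 n) ∞ S] in
theorem aemeasurable_chart_symm (e : OpenPartialHomeomorph S (EuclideanSpace ℝ (Fin n))) :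
    AEMeasurable e.symm (volume.restrict e.target) :=
  e.continuousOn_symm.aemeasurable e.open_target.measurableSet

omit [ChartedSpace (EuclideanSpace ℝ (Fin n)) S] [IsManifold (𝓡 n) ∞ S] in
theorem measurableSet_target_inter_preimage
    (e : OpenPartialHomeomorph S (EuclideanSpace ℝ (Fin n))) {B : Set S} (hB : MeasurableSet B) :
    MeasurableSet (e.target ∩ e.symm ⁻¹' B) := by
  have h : Measurable (e.target.domRestrict e.symm) :=
    (continuousOn_iff_continuous_domRestrict.1 e.continuousOn_symm).measurable
  have h2 := MeasurableSet.subtype_image e.open_target.measurableSet (h hB)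
  convert h2 using 1
  ext y
  simp [and_comm]

/-- The volume density in the chart `e`. -/
def chartDensity (q : V → V → V → ℝ) (F : S → V)
    (e : OpenPartialHomeomorph S (EuclideanSpace ℝ (Fin n))) (y : EuclideanSpace ℝ (Fin n)) : ℝ :=
  jetDensity q (jetIn e F y)

omit [ChartedSpace (EuclideanSpace ℝ (Fin n)) S] [IsManifold (𝓡 n) ∞ S] [BorelSpace S] in
theorem chartVolume_eq : chartVolume n q F e = ((volume.restrict e.target).withDensity
    fun y => ENNReal.ofReal (chartDensity q F e y)).map e.symm := rfl

omit [ChartedSpace (EuclideanSpace ℝ (Fin n)) S] [IsManifold (𝓡 n) ∞ S] in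
theorem chartVolume_apply {B : Set S} (hB : MeasurableSet B) :
    chartVolume n q F e B =
      ∫⁻ y in e.target ∩ e.symm ⁻¹' B, ENNReal.ofReal (chartDensity q F e y) := by
  rw [chartVolume_eq, Measure.map_apply_of_aemeasurable
    ((aemeasurable_chart_symm e).mono_ac (withDensity_absolutelyContinuous _ _)) hB,
    withDensity_apply', Measure.restrict_restrict' e.open_target.measurableSet, inter_comm]

/-- The change of variables formula along the transition map. There is only an inequality because
`e'` may cover just a part of `B`, whereas `e` covers all of it. -/
theorem chartVolume_le (hq : SmoothBilin q) (he : e ∈ atlas (EuclideanSpace ℝ (Fin n)) S)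
    (he' : e' ∈ atlas (EuclideanSpace ℝ (Fin n)) S) (hF : ContMDiff (𝓡 n) 𝓘(ℝ, V) ∞ F)
    {B : Set S} (hB : MeasurableSet B) (hBe : B ⊆ e.source) :
    chartVolume n q F e' B ≤ chartVolume n q F e B := by
  rw [chartVolume_apply hB, chartVolume_apply hB]
  set s := e'.target ∩ e'.symm ⁻¹' B with hs
  have hd : ∀ y ∈ s, DifferentiableAt ℝ (e ∘ e'.symm) y := fun y hy => by
    have h1 : ContMDiffAt (𝓡 n) (𝓡 n) ∞ (e ∘ e'.symm) y :=
      (contMDiffAt_chart'' he (hBe hy.2)).comp y (contMDiffAt_chart_symm'' he' hy.1)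
    exact h1.contDiffAt.differentiableAt (by simp)
  have hinj : InjOn (e ∘ e'.symm) s := by
    intro y hy z hz hyz
    have := e.injOn (hBe hy.2) (hBe hz.2) hyz
    exact e'.symm.injOn hy.1 hz.1 this
  have himg : (e ∘ e'.symm) '' s ⊆ e.target ∩ e.symm ⁻¹' B := by
    rintro _ ⟨y, hy, rfl⟩
    refine ⟨e.map_source (hBe hy.2), ?_⟩
    simpa [e.left_inv (hBe hy.2)] using hy.2
  refine le_trans (le_of_eq ?_) (lintegral_mono_set himg)
  rw [lintegral_image_eq_lintegral_abs_det_fderiv_mul volume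
    (measurableSet_target_inter_preimage e' hB)
    (fun y hy => (hd y hy).hasFDerivAt.hasFDerivWithinAt) hinj]
  refine setLIntegral_congr_fun (measurableSet_target_inter_preimage e' hB) fun y hy => ?_
  simp only [chartDensity]
  rw [jetIn_transition he hF hy.1 (hBe hy.2) (hd y hy), jetDensity_jetAct hq, det_endMat,
    ENNReal.ofReal_mul (abs_nonneg _)]
  rfl

/-- The supremum over all charts is attained by any chart containing the set. As suprema of measures
are not computed setwise, the upper bound goes through a single measure dominating all chart
volumes. -/
theorem inducedVolume_apply (hq : SmoothBilin q) (he : e ∈ atlas (EuclideanSpace ℝ (Fin n)) S)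
    (hF : ContMDiff (𝓡 n) 𝓘(ℝ, V) ∞ F) {B : Set S} (hB : MeasurableSet B) (hBe : B ⊆ e.source) :
    inducedVolume n q F B = chartVolume n q F e B := by
  apply le_antisymm
  -- `ν` agrees with the volume of `e` on subsets of its source and is infinite on every set that
  -- leaves the source; this makes it an upper bound for all chart volumes.
  · set ν : Measure S := chartVolume n q F e +
      (⊤ : ENNReal) • (Measure.count.restrict e.sourceᶜ) with hν
    have h1 : inducedVolume n q F ≤ ν := by
      refine iSup₂_le fun e' he' => Measure.le_iff.2 fun B hB => ?_
      by_cases hBe : B ⊆ e.source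
      · exact (chartVolume_le hq he he' hF hB hBe).trans
          ((Measure.le_iff.1 (Measure.le_add_right le_rfl)) B hB)
      · obtain ⟨x, hxB, hx⟩ := not_subset.1 hBe
        have h2 : ν B = ⊤ := by
          simp only [hν, Measure.add_apply, Measure.smul_apply, Measure.restrict_apply hB,
            smul_eq_mul]
          rw [ENNReal.top_mul, add_top]
          exact Measure.count_ne_zero ⟨x, hxB, hx⟩
        rw [h2]
        exact le_top
    refine (h1 B).trans (le_of_eq ?_)
    simp only [hν, Measure.add_apply, Measure.smul_apply, Measure.restrict_apply hB, smul_eq_mul]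
    rw [show B ∩ e.sourceᶜ = ∅ from by
      rw [← Set.sdiff_eq, Set.sdiff_eq_empty]; exact hBe]
    simp
  · exact (le_iSup₂ (f := fun e' (_ : e' ∈ atlas (EuclideanSpace ℝ (Fin n)) S) =>
      chartVolume n q F e') e he) B

theorem inducedVolume_restrict (hq : SmoothBilin q) (he : e ∈ atlas (EuclideanSpace ℝ (Fin n)) S)
    (hF : ContMDiff (𝓡 n) 𝓘(ℝ, V) ∞ F) :
    (inducedVolume n q F).restrict e.source = chartVolume n q F e := by
  ext B hB
  have hs := e.open_source.measurableSet
  rw [Measure.restrict_apply hB, inducedVolume_apply hq he hF (hB.inter hs) inter_subset_right,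
    chartVolume_apply hB, chartVolume_apply (hB.inter hs)]
  congr 2
  ext y
  simp only [mem_inter_iff, mem_preimage]
  exact ⟨fun h => ⟨h.1, h.2.1⟩, fun h => ⟨h.1, h.2, e.map_target h.1⟩⟩

omit [MeasurableSpace S] [BorelSpace S] in
theorem continuousOn_chartDensity (hq : SmoothBilin q)
    (he : e ∈ atlas (EuclideanSpace ℝ (Fin n)) S) (hF : ContMDiff (𝓡 n) 𝓘(ℝ, V) ∞ F) :
    ContinuousOn (chartDensity q F e) e.target :=
  (continuous_jetDensity hq).comp_continuousOn (contDiffOn_jetIn he hF).continuousOn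

/-- The continuous density is integrable on a closed ball inside the chart target, and the chart
pulls the open ball back to a neighbourhood of the point. -/
theorem isLocallyFiniteMeasure_inducedVolume (hq : SmoothBilin q)
    (hF : ContMDiff (𝓡 n) 𝓘(ℝ, V) ∞ F) : IsLocallyFiniteMeasure (inducedVolume n q F) := by
  refine ⟨fun x => ?_⟩
  set e := chartAt (EuclideanSpace ℝ (Fin n)) x
  have he : e ∈ atlas (EuclideanSpace ℝ (Fin n)) S := chart_mem_atlas _ x
  have hx : x ∈ e.source := mem_chart_source _ x
  obtain ⟨r, hr, hrt⟩ := Metric.nhds_basis_closedBall.mem_iff.1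
    (e.open_target.mem_nhds (e.map_source hx))
  have hU : e.source ∩ e ⁻¹' Metric.ball (e x) r ∈ 𝓝 x :=
    inter_mem (e.open_source.mem_nhds hx)
      ((e.continuousAt hx).preimage_mem_nhds (Metric.ball_mem_nhds _ hr))
  refine ⟨_, hU, ?_⟩
  have ho : IsOpen (e.source ∩ e ⁻¹' Metric.ball (e x) r) :=
    e.isOpen_inter_preimage Metric.isOpen_ball
  rw [inducedVolume_apply hq he hF ho.measurableSet inter_subset_left,
    chartVolume_apply ho.measurableSet]
  have hi : IntegrableOn (chartDensity q F e) (Metric.closedBall (e x) r) :=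
    ((continuousOn_chartDensity hq he hF).mono hrt).integrableOn_compact (isCompact_closedBall _ _)
  refine lt_of_le_of_lt (lintegral_mono_set ?_) hi.lintegral_lt_top
  intro y hy
  have h2 := hy.2.2
  simp only [mem_preimage, e.right_inv hy.1] at h2
  exact Metric.ball_subset_closedBall h2

/-- The ratio of two volume densities. -/
def densityRatio {V' : Type*} [NormedAddCommGroup V'] [NormedSpace ℝ V'] (q' : V' → V' → V' → ℝ)
    (F' : S → V') (q : V → V → V → ℝ) (F : S → V) (x : S) : ℝ :=
  jetDensity q' (jet (n := n) F' x) / jetDensity q (jet (n := n) F x)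

variable {V' : Type*} [NormedAddCommGroup V'] [NormedSpace ℝ V'] {q' : V' → V' → V' → ℝ}
  {F' : S → V'}

omit [MeasurableSpace S] [BorelSpace S] in
-- Both densities change by the same factor $|\det|$, which cancels; the ratio is thus a global
-- function although it is defined with a chart depending on the point.
theorem densityRatio_eq (hq : SmoothBilin q) (hq' : SmoothBilin q')
    (hF : ContMDiff (𝓡 n) 𝓘(ℝ, V) ∞ F) (hF' : ContMDiff (𝓡 n) 𝓘(ℝ, V') ∞ F')
    (he : e ∈ atlas (EuclideanSpace ℝ (Fin n)) S) {x : S} (hx : x ∈ e.source) :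
    densityRatio (n := n) q' F' q F x = chartDensity q' F' e (e x) / chartDensity q F e (e x) := by
  rw [densityRatio, jet_eq_jetAct he hx (hF'.mdifferentiableAt (by simp)),
    jet_eq_jetAct he hx (hF.mdifferentiableAt (by simp)), jetDensity_jetAct hq,
    jetDensity_jetAct hq', mul_div_mul_left _ _ (abs_pos.2 (det_chartMat_ne_zero he hx)).ne']
  rfl

/-- The induced metric is non-degenerate at every point. -/
def DetNeZero (n : ℕ) {S : Type*} [TopologicalSpace S]
    [ChartedSpace (EuclideanSpace ℝ (Fin n)) S] {V : Type*} [NormedAddCommGroup V]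
    [NormedSpace ℝ V] (q : V → V → V → ℝ) (F : S → V) : Prop :=
  ∀ x : S, (jetGram q (jet (n := n) F x)).det ≠ 0

omit [MeasurableSpace S] [BorelSpace S] in
theorem DetNeZero.jetIn_ne_zero (h : DetNeZero n q F) (hq : SmoothBilin q)
    (hF : ContMDiff (𝓡 n) 𝓘(ℝ, V) ∞ F) (he : e ∈ atlas (EuclideanSpace ℝ (Fin n)) S)
    {y : EuclideanSpace ℝ (Fin n)} (hy : y ∈ e.target) :
    (jetGram q (jetIn e F y)).det ≠ 0 := by
  have h1 := h (e.symm y)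
  rw [jet_eq_jetAct he (e.map_target hy) (hF.mdifferentiableAt (by simp)),
    det_jetGram_jetAct hq, e.right_inv hy] at h1
  exact right_ne_zero_of_mul h1

omit [IsManifold (𝓡 n) ∞ S] [MeasurableSpace S] [BorelSpace S] in
theorem continuous_of_charts {X : Type*} [TopologicalSpace X] {f : S → X}
    (h : ∀ e ∈ atlas (EuclideanSpace ℝ (Fin n)) S, ∃ g : EuclideanSpace ℝ (Fin n) → X,
      ContinuousOn g e.target ∧ ∀ x ∈ e.source, f x = g (e x)) : Continuous f := by
  refine continuous_iff_continuousAt.2 fun x => ?_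
  obtain ⟨g, hg, hfg⟩ := h _ (chart_mem_atlas (EuclideanSpace ℝ (Fin n)) x)
  set e := chartAt (EuclideanSpace ℝ (Fin n)) x
  have hx : x ∈ e.source := mem_chart_source _ x
  have h1 : ContinuousAt (g ∘ e) x :=
    ContinuousAt.comp (hg.continuousAt (e.open_target.mem_nhds (e.map_source hx)))
      (e.continuousAt hx)
  refine h1.congr ?_
  filter_upwards [e.open_source.mem_nhds hx] with z hz
  exact (hfg z hz).symm

omit [MeasurableSpace S] [BorelSpace S] in
theorem continuous_densityRatio (hq : SmoothBilin q) (hq' : SmoothBilin q')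
    (hF : ContMDiff (𝓡 n) 𝓘(ℝ, V) ∞ F) (hF' : ContMDiff (𝓡 n) 𝓘(ℝ, V') ∞ F')
    (h : DetNeZero n q F) : Continuous (densityRatio (n := n) q' F' q F) := by
  refine continuous_of_charts (n := n) fun e he =>
    ⟨fun y => chartDensity q' F' e y / chartDensity q F e y, ?_, fun x hx => densityRatio_eq hq hq' hF hF' he hx⟩
  refine (continuousOn_chartDensity hq' he hF').div (continuousOn_chartDensity hq he hF) ?_
  intro y hy
  exact (jetDensity_pos (h.jetIn_ne_zero hq hF he hy)).ne'

omit [IsManifold (𝓡 n) ∞ S] [MeasurableSpace S] [BorelSpace S] in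
theorem densityRatio_nonneg (x : S) : 0 ≤ densityRatio (n := n) q' F' q F x :=
  div_nonneg (jetDensity_nonneg _ _) (jetDensity_nonneg _ _)

variable [SecondCountableTopology S]

/-- Two induced volume measures differ by the ratio of the densities. -/
theorem inducedVolume_eq_withDensity (hq : SmoothBilin q) (hq' : SmoothBilin q')
    (hF : ContMDiff (𝓡 n) 𝓘(ℝ, V) ∞ F) (hF' : ContMDiff (𝓡 n) 𝓘(ℝ, V') ∞ F')
    (h : DetNeZero n q F) :
    inducedVolume n q' F' = (inducedVolume n q F).withDensity
      fun x => ENNReal.ofReal (densityRatio (n := n) q' F' q F x) := by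
  obtain ⟨s, hs, hsU⟩ := TopologicalSpace.countable_cover_nhds
    (fun x : S => (chartAt (EuclideanSpace ℝ (Fin n)) x).open_source.mem_nhds
      (mem_chart_source _ x))
  have hmeas : Measurable fun x => ENNReal.ofReal (densityRatio (n := n) q' F' q F x) :=
    (continuous_densityRatio hq hq' hF hF' h).measurable.ennreal_ofReal
  -- By second countability countably many chart domains cover `S`, so it is enough to compare the
  -- two measures on each domain.
  refine Measure.ext_of_biUnion_eq_univ hs hsU fun x _ => ?_
  set e := chartAt (EuclideanSpace ℝ (Fin n)) x
  have he : e ∈ atlas (EuclideanSpace ℝ (Fin n)) S := chart_mem_atlas _ x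
  rw [inducedVolume_restrict hq' he hF', restrict_withDensity e.open_source.measurableSet,
    inducedVolume_restrict hq he hF]
  have hsymm : AEMeasurable e.symm ((volume.restrict e.target).withDensity
      fun y => ENNReal.ofReal (chartDensity q F e y)) :=
    (aemeasurable_chart_symm e).mono_ac (withDensity_absolutelyContinuous _ _)
  have hD : AEMeasurable (fun y => ENNReal.ofReal (chartDensity q F e y))
      (volume.restrict e.target) :=
    ((continuousOn_chartDensity hq he hF).aemeasurable
      e.open_target.measurableSet).ennreal_ofReal
  ext B hB
  rw [withDensity_apply _ hB, chartVolume_eq (F := F),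
    Measure.restrict_map_of_aemeasurable hsymm hB,
    lintegral_map' hmeas.aemeasurable
      (hsymm.mono_measure Measure.restrict_le_self), chartVolume_apply hB,
    setLIntegral_withDensity_eq_setLIntegral_mul_non_measurable₀' _ _ hD.restrict _
      (ae_of_all _ fun _ => ENNReal.ofReal_lt_top),
    Measure.restrict_restrict' e.open_target.measurableSet, inter_comm]
  rw [inter_comm]
  refine setLIntegral_congr_fun (measurableSet_target_inter_preimage e hB) fun y hy => ?_
  have h0 : 0 < chartDensity q F e y := jetDensity_pos (h.jetIn_ne_zero hq hF he hy.1)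
  simp only [Pi.mul_apply]
  rw [densityRatio_eq hq hq' hF hF' he (e.map_target hy.1), e.right_inv hy.1,
    ← ENNReal.ofReal_mul h0.le, mul_div_cancel₀ _ h0.ne']

end Volume

end OrientedGeodesics
end

noncomputable section

namespace OrientedGeodesics

open Filter Topology

/-! ## The first variation of the volume -/

section FirstVariation

variable {n : ℕ} {S : Type*} [TopologicalSpace S] [ChartedSpace (EuclideanSpace ℝ (Fin n)) S]
  {V : Type*} [NormedAddCommGroup V] [NormedSpace ℝ V]
  [IsManifold (𝓡 n) ∞ S] {e : OpenPartialHomeomorph S (EuclideanSpace ℝ (Fin n))}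
  {q : V → V → V → ℝ} {Φ W : S → V}

/-- The first variation of the volume density at `Φ` in the direction `W`, relative to the
volume density of `Φ`. -/
def firstVar (n : ℕ) {S : Type*} [TopologicalSpace S]
    [ChartedSpace (EuclideanSpace ℝ (Fin n)) S] {V : Type*} [NormedAddCommGroup V]
    [NormedSpace ℝ V] (q : V → V → V → ℝ) (Φ W : S → V) (x : S) : ℝ :=
  fderiv ℝ (jetDensity q) (jet (n := n) Φ x) (jet (n := n) W x) /
    jetDensity q (jet (n := n) Φ x)

theorem firstVar_eq (hq : SmoothBilin q) (hΦ : ContMDiff (𝓡 n) 𝓘(ℝ, V) ∞ Φ)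
    (h0 : DetNeZero n q Φ) (hW : ContMDiff (𝓡 n) 𝓘(ℝ, V) ∞ W)
    (he : e ∈ atlas (EuclideanSpace ℝ (Fin n)) S) {x : S} (hx : x ∈ e.source) :
    firstVar n q Φ W x = fderiv ℝ (jetDensity q) (jetIn e Φ (e x)) (jetIn e W (e x)) /
      chartDensity q Φ e (e x) := by
  have hA := det_chartMat_ne_zero he hx
  rw [firstVar, jet_eq_jetAct he hx (hΦ.mdifferentiableAt (by simp)),
    jet_eq_jetAct he hx (hW.mdifferentiableAt (by simp)),
    fderiv_jetDensity_jetAct hq hA (h0.jetIn_ne_zero hq hΦ he (e.map_source hx)),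
    jetDensity_jetAct hq, mul_div_mul_left _ _ (abs_pos.2 hA).ne']
  rfl

theorem contDiffOn_chartDensity (hq : SmoothBilin q) (hΦ : ContMDiff (𝓡 n) 𝓘(ℝ, V) ∞ Φ)
    (h0 : DetNeZero n q Φ) (he : e ∈ atlas (EuclideanSpace ℝ (Fin n)) S) :
    ContDiffOn ℝ ∞ (chartDensity q Φ e) e.target := fun y hy =>
  (ContDiffAt.comp y (contDiffAt_jetDensity hq (h0.jetIn_ne_zero hq hΦ he hy))
    ((contDiffOn_jetIn he hΦ).contDiffAt (e.open_target.mem_nhds hy))).contDiffWithinAt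

theorem continuousOn_fderiv_jetDensity (hq : SmoothBilin q)
    (hΦ : ContMDiff (𝓡 n) 𝓘(ℝ, V) ∞ Φ)
    (h0 : DetNeZero n q Φ) (hW : ContMDiff (𝓡 n) 𝓘(ℝ, V) ∞ W)
    (he : e ∈ atlas (EuclideanSpace ℝ (Fin n)) S) :
    ContinuousOn (fun y => fderiv ℝ (jetDensity q) (jetIn e Φ y) (jetIn e W y)) e.target := by
  refine ContinuousOn.clm_apply (fun y hy => ?_) (contDiffOn_jetIn he hW).continuousOn
  have h1 : ContinuousAt (fderiv ℝ (jetDensity q)) (jetIn e Φ y) :=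
    ((contDiffAt_jetDensity hq (h0.jetIn_ne_zero hq hΦ he hy)).fderiv_right (m := ∞)
      (by simp)).continuousAt
  exact ContinuousAt.comp_continuousWithinAt (g := fderiv ℝ (jetDensity q)) h1
    ((contDiffOn_jetIn he hΦ).continuousOn y hy)

theorem continuous_firstVar (hq : SmoothBilin q) (hΦ : ContMDiff (𝓡 n) 𝓘(ℝ, V) ∞ Φ)
    (h0 : DetNeZero n q Φ) (hW : ContMDiff (𝓡 n) 𝓘(ℝ, V) ∞ W) :
    Continuous (firstVar n q Φ W) := by
  refine continuous_of_charts (n := n) fun e he =>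
    ⟨fun y => fderiv ℝ (jetDensity q) (jetIn e Φ y) (jetIn e W y) / chartDensity q Φ e y, ?_,
      fun x hx => firstVar_eq hq hΦ h0 hW he hx⟩
  refine (continuousOn_fderiv_jetDensity hq hΦ h0 hW he).div
    (continuousOn_chartDensity hq he hΦ) fun y hy => ?_
  exact (jetDensity_pos (h0.jetIn_ne_zero hq hΦ he hy)).ne'

omit [IsManifold (𝓡 n) ∞ S] in
theorem jet_zero (x : S) : jet (n := n) (fun _ : S => (0 : V)) x = 0 := by
  refine Prod.ext rfl ?_
  funext i
  have h : mfderiv (𝓡 n) 𝓘(ℝ, V) (fun _ : S => (0 : V)) x = 0 := mfderiv_const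
  exact congrArg (fun L => L (tangentBasis x i)) h

omit [IsManifold (𝓡 n) ∞ S] in
theorem jet_add {f g : S → V} {x : S} (hf : MDifferentiableAt (𝓡 n) 𝓘(ℝ, V) f x)
    (hg : MDifferentiableAt (𝓡 n) 𝓘(ℝ, V) g x) :
    jet (n := n) (fun y => f y + g y) x = jet (n := n) f x + jet (n := n) g x := by
  refine Prod.ext rfl ?_
  funext i
  exact congrArg (fun L => L (tangentBasis x i)) (hf.hasMFDerivAt.add hg.hasMFDerivAt).mfderiv

omit [IsManifold (𝓡 n) ∞ S] in
theorem mdifferentiableAt_sum {ι : Type*} {s : Finset ι} {f : ι → S → V} {x : S}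
    (hf : ∀ i ∈ s, MDifferentiableAt (𝓡 n) 𝓘(ℝ, V) (f i) x) :
    MDifferentiableAt (𝓡 n) 𝓘(ℝ, V) (fun y => ∑ i ∈ s, f i y) x := by
  classical
  induction s using Finset.induction_on with
  | empty => simpa using mdifferentiableAt_const
  | insert a s ha ih =>
    simp only [Finset.sum_insert ha]
    exact (hf a (Finset.mem_insert_self _ _)).add
      (ih fun i hi => hf i (Finset.mem_insert_of_mem hi))

omit [IsManifold (𝓡 n) ∞ S] in
theorem jet_sum {ι : Type*} {s : Finset ι} {f : ι → S → V} {x : S}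
    (hf : ∀ i ∈ s, MDifferentiableAt (𝓡 n) 𝓘(ℝ, V) (f i) x) :
    jet (n := n) (fun y => ∑ i ∈ s, f i y) x = ∑ i ∈ s, jet (n := n) (f i) x := by
  classical
  induction s using Finset.induction_on with
  | empty => simpa using jet_zero x
  | insert a s ha ih =>
    have h2 : ∀ i ∈ s, MDifferentiableAt (𝓡 n) 𝓘(ℝ, V) (f i) x :=
      fun i hi => hf i (Finset.mem_insert_of_mem hi)
    simp only [Finset.sum_insert ha]
    rw [jet_add (hf a (Finset.mem_insert_self _ _)) (mdifferentiableAt_sum h2), ih h2]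

omit [IsManifold (𝓡 n) ∞ S] in
theorem firstVar_sum {ι : Type*} {s : Finset ι} {f : ι → S → V} {x : S}
    (hf : ∀ i ∈ s, MDifferentiableAt (𝓡 n) 𝓘(ℝ, V) (f i) x) :
    firstVar n q Φ (fun y => ∑ i ∈ s, f i y) x = ∑ i ∈ s, firstVar n q Φ (f i) x := by
  simp only [firstVar, jet_sum hf, map_sum, Finset.sum_div]

omit [IsManifold (𝓡 n) ∞ S] in
theorem jet_congr {f g : S → V} {x : S} (h : f =ᶠ[𝓝 x] g) :
    jet (n := n) f x = jet (n := n) g x := by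
  simp only [jet, diff, h.mfderiv_eq, h.eq_of_nhds]

omit [IsManifold (𝓡 n) ∞ S] in
theorem firstVar_eq_zero {x : S} (hx : x ∉ tsupport W) : firstVar n q Φ W x = 0 := by
  have h : W =ᶠ[𝓝 x] fun _ => 0 := notMem_tsupport_iff_eventuallyEq.1 hx
  rw [firstVar, jet_congr h, jet_zero, map_zero, zero_div]

theorem hasDerivAt_densityRatio (hq : SmoothBilin q) {δ : ℝ} (hδ : 0 < δ) {F : ℝ → S → V}
    (hF : SmoothFamily n δ F) (h0 : DetNeZero n q (F 0)) (x : S) :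
    HasDerivAt (fun t => densityRatio (n := n) q (F t) q (F 0) x)
      (firstVar n q (F 0) (velocity F) x) 0 := by
  have h1 := ((contDiffAt_jetDensity hq (h0 x)).differentiableAt (by simp)).hasFDerivAt
  have h2 := HasFDerivAt.comp_hasDerivAt (l := jetDensity q) (0 : ℝ) h1
    (hF.hasDerivAt_jet hδ x)
  exact h2.div_const _

/-- The local bound needed for dominated convergence: in a chart the ratio is jointly $C^1$ near
time zero, because the denominator does not depend on time and the numerator is non-degenerate at
the centre, hence smooth nearby. -/
theorem eventually_densityRatio (hq : SmoothBilin q) {δ : ℝ} (hδ : 0 < δ) {F : ℝ → S → V}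
    (hF : SmoothFamily n δ F) (h0 : DetNeZero n q (F 0)) (x₀ : S) :
    ∃ M : ℝ, ∀ᶠ z : ℝ × S in 𝓝 (0, x₀),
      DifferentiableAt ℝ (fun t => densityRatio (n := n) q (F t) q (F 0) z.2) z.1 ∧
        ‖deriv (fun t => densityRatio (n := n) q (F t) q (F 0) z.2) z.1‖ ≤ M := by
  set e := chartAt (EuclideanSpace ℝ (Fin n)) x₀
  have he : e ∈ atlas (EuclideanSpace ℝ (Fin n)) S := chart_mem_atlas _ x₀
  have hx : x₀ ∈ e.source := mem_chart_source _ x₀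
  have hF0 := hF.contMDiff (zero_mem_Ioo hδ)
  set R : ℝ × EuclideanSpace ℝ (Fin n) → ℝ := fun z =>
    jetDensity q (jetIn e (F z.1) z.2) / chartDensity q (F 0) e z.2 with hR
  have hy := e.map_source hx
  have hRc : ContDiffAt ℝ 1 R (0, e x₀) := by
    have h1 := h0.jetIn_ne_zero hq hF0 he hy
    have h2 : ContDiffAt ℝ ∞ (fun z : ℝ × EuclideanSpace ℝ (Fin n) =>
        jetDensity q (jetIn e (F z.1) z.2)) (0, e x₀) :=
      ContDiffAt.comp (g := jetDensity q) (0, e x₀) (contDiffAt_jetDensity hq h1)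
        ((hF.contDiffOn_jetIn he).contDiffAt
          ((isOpen_Ioo.prod e.open_target).mem_nhds ⟨zero_mem_Ioo hδ, hy⟩))
    have h3 : ContDiffAt ℝ ∞ (fun z : ℝ × EuclideanSpace ℝ (Fin n) =>
        chartDensity q (F 0) e z.2) (0, e x₀) :=
      ContDiffAt.comp (g := chartDensity q (F 0) e) (0, e x₀)
        ((contDiffOn_chartDensity hq hF0 h0 he).contDiffAt (e.open_target.mem_nhds hy))
        contDiffAt_snd
    exact (h2.div h3 (jetDensity_pos h1).ne').of_le (by simp)
  have hev : ∀ᶠ z in 𝓝 ((0 : ℝ), e x₀), ContDiffAt ℝ 1 R z ∧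
      ‖fderiv ℝ R z‖ < ‖fderiv ℝ R (0, e x₀)‖ + 1 := by
    refine (hRc.eventually (by simp)).and ?_
    have h1 : ContinuousAt (fderiv ℝ R) (0, e x₀) :=
      (hRc.fderiv_right (m := 0) (by simp)).continuousAt
    exact h1.norm.eventually_lt_const (lt_add_one _)
  have hcont : ContinuousAt (fun z : ℝ × S => (z.1, e z.2)) (0, x₀) :=
    continuousAt_fst.prodMk (ContinuousAt.comp (g := e) (e.continuousAt hx) continuousAt_snd)
  refine ⟨‖fderiv ℝ R (0, e x₀)‖ + 1, ?_⟩
  filter_upwards [hcont.eventually hev,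
    (isOpen_Ioo.prod e.open_source).mem_nhds (show ((0 : ℝ), x₀) ∈ Ioo (-δ) δ ×ˢ e.source from
      ⟨zero_mem_Ioo hδ, hx⟩)] with z hz hz'
  have hd : HasDerivAt (fun t => R (t, e z.2)) (fderiv ℝ R (z.1, e z.2) (1, 0)) z.1 :=
    (HasFDerivAt.comp (g := R) z.1 (hz.1.differentiableAt (by simp)).hasFDerivAt
      (hasFDerivAt_prodMk_left (𝕜 := ℝ) z.1 (e z.2))).hasDerivAt
  have hd' : HasDerivAt (fun t => densityRatio (n := n) q (F t) q (F 0) z.2)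
      (fderiv ℝ R (z.1, e z.2) (1, 0)) z.1 := by
    refine hd.congr_of_eventuallyEq ?_
    filter_upwards [isOpen_Ioo.mem_nhds hz'.1] with t ht
    exact densityRatio_eq hq hq hF0 (hF.contMDiff ht) he hz'.2
  refine ⟨hd'.differentiableAt, ?_⟩
  rw [hd'.deriv]
  refine (ContinuousLinearMap.le_opNorm _ _).trans ?_
  have h1 : ‖((1 : ℝ), (0 : EuclideanSpace ℝ (Fin n)))‖ = 1 := by simp
  rw [h1, mul_one]
  exact hz.2.le

/-- Patches the local bounds over the compact set: the property passes to subsets and finite unions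
and holds near every point. -/
theorem exists_bound_densityRatio (hq : SmoothBilin q) {δ : ℝ} (hδ : 0 < δ) {F : ℝ → S → V}
    (hF : SmoothFamily n δ F) (h0 : DetNeZero n q (F 0)) {C : Set S} (hC : IsCompact C) :
    ∃ ε > 0, ∃ M : ℝ, ∀ x ∈ C, ∀ t ∈ Metric.ball (0 : ℝ) ε,
      DifferentiableAt ℝ (fun t => densityRatio (n := n) q (F t) q (F 0) x) t ∧
        ‖deriv (fun t => densityRatio (n := n) q (F t) q (F 0) x) t‖ ≤ M := by
  refine hC.induction_on (p := fun C => ∃ ε > 0, ∃ M : ℝ, ∀ x ∈ C, ∀ t ∈ Metric.ball (0 : ℝ) ε,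
      DifferentiableAt ℝ (fun t => densityRatio (n := n) q (F t) q (F 0) x) t ∧
        ‖deriv (fun t => densityRatio (n := n) q (F t) q (F 0) x) t‖ ≤ M) ?_ ?_ ?_ ?_
  · exact ⟨1, one_pos, 0, fun x hx => hx.elim⟩
  · rintro s t hst ⟨ε, hε, M, h⟩
    exact ⟨ε, hε, M, fun x hx => h x (hst hx)⟩
  · rintro s t ⟨ε, hε, M, h⟩ ⟨ε', hε', M', h'⟩
    refine ⟨min ε ε', lt_min hε hε', max M M', fun x hx t ht => ?_⟩
    rw [Metric.mem_ball, lt_min_iff] at ht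
    rcases hx with hx | hx
    · exact ⟨(h x hx t ht.1).1, (h x hx t ht.1).2.trans (le_max_left _ _)⟩
    · exact ⟨(h' x hx t ht.2).1, (h' x hx t ht.2).2.trans (le_max_right _ _)⟩
  · intro x _
    obtain ⟨M, hM⟩ := eventually_densityRatio hq hδ hF h0 x
    obtain ⟨u, hu, v, hv, huv⟩ := mem_nhds_prod_iff.1 hM
    obtain ⟨ε, hε, hεu⟩ := Metric.mem_nhds_iff.1 hu
    exact ⟨v, mem_nhdsWithin_of_mem_nhds hv, ε, hε, M, fun x hx t ht =>
      huv (mk_mem_prod (hεu ht) hx)⟩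

variable [MeasurableSpace S] [BorelSpace S] [SecondCountableTopology S]

/-- Turns a volume into an integral against a fixed reference measure. The reference may come from
another map into another space: this is used both to compare different times of a family and to
compare the Gauss map with its hypersurface. -/
theorem measureReal_inducedVolume {V' : Type*} [NormedAddCommGroup V'] [NormedSpace ℝ V']
    {q' : V' → V' → V' → ℝ} {Φ' : S → V'} (hq : SmoothBilin q) (hq' : SmoothBilin q')
    (hΦ : ContMDiff (𝓡 n) 𝓘(ℝ, V) ∞ Φ) (hΦ' : ContMDiff (𝓡 n) 𝓘(ℝ, V') ∞ Φ')
    (h0 : DetNeZero n q Φ) {C : Set S} (hC : MeasurableSet C) :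
    (inducedVolume n q' Φ').real C =
      ∫ x in C, densityRatio (n := n) q' Φ' q Φ x ∂inducedVolume n q Φ := by
  rw [measureReal_def, inducedVolume_eq_withDensity hq hq' hΦ hΦ' h0, withDensity_apply _ hC,
    integral_eq_lintegral_of_nonneg_ae (ae_of_all _ fun x => densityRatio_nonneg x)
      (continuous_densityRatio hq hq' hΦ hΦ' h0).aestronglyMeasurable]

/-- With the measure of the initial map as reference, only the density ratio depends on time, and
the derivative passes under the integral. Non-degeneracy is required only at time zero. -/
theorem hasDerivAt_volume [T2Space S] (hq : SmoothBilin q) {δ : ℝ} (hδ : 0 < δ) {F : ℝ → S → V}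
    (hF : SmoothFamily n δ F) (h0 : DetNeZero n q (F 0)) {C : Set S} (hC : IsCompact C) :
    HasDerivAt (fun t => (inducedVolume n q (F t)).real C)
      (∫ x in C, firstVar n q (F 0) (velocity F) x ∂inducedVolume n q (F 0)) 0 := by
  have hF0 := hF.contMDiff (zero_mem_Ioo hδ)
  have hlf : IsLocallyFiniteMeasure (inducedVolume n q (F 0)) :=
    isLocallyFiniteMeasure_inducedVolume hq hF0
  obtain ⟨ε, hε, M, hM⟩ := exists_bound_densityRatio hq hδ hF h0 hC
  have hmem : ∀ᶠ t in 𝓝 (0 : ℝ), t ∈ Ioo (-δ) δ := isOpen_Ioo.mem_nhds (zero_mem_Ioo hδ)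
  have hfin : IsFiniteMeasure ((inducedVolume n q (F 0)).restrict C) :=
    ⟨by simpa using hC.measure_lt_top⟩
  have hderiv : ∀ x, deriv (fun t => densityRatio (n := n) q (F t) q (F 0) x) 0 =
      firstVar n q (F 0) (velocity F) x := fun x => (hasDerivAt_densityRatio hq hδ hF h0 x).deriv
  have hint := (hasDerivAt_integral_of_dominated_loc_of_deriv_le
    (μ := (inducedVolume n q (F 0)).restrict C) (x₀ := (0 : ℝ)) (bound := fun _ => M)
    (F := fun t x => densityRatio (n := n) q (F t) q (F 0) x)
    (F' := fun t x => deriv (fun t => densityRatio (n := n) q (F t) q (F 0) x) t)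
    (Metric.ball_mem_nhds 0 hε) ?_ ?_ ?_ ?_ (integrable_const M) ?_).2
  · simp only [hderiv] at hint
    refine hint.congr_of_eventuallyEq ?_
    filter_upwards [hmem] with t ht
    exact measureReal_inducedVolume hq hq hF0 (hF.contMDiff ht) h0 hC.measurableSet
  · filter_upwards [hmem] with t ht
    exact (continuous_densityRatio hq hq hF0 (hF.contMDiff ht) h0).aestronglyMeasurable
  · exact ((continuous_densityRatio hq hq hF0 hF0 h0).continuousOn.integrableOn_compact hC)
  · simp only [hderiv]
    exact (continuous_firstVar hq hF0 h0 (hF.contMDiff_velocity hδ)).aestronglyMeasurable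
  · filter_upwards [ae_restrict_mem hC.measurableSet] with x hx t ht
    exact (hM x hx t ht).2
  · filter_upwards [ae_restrict_mem hC.measurableSet] with x hx t ht
    exact (hM x hx t ht).1.hasDerivAt

end FirstVariation

end OrientedGeodesics
end

noncomputable section

namespace OrientedGeodesics

open Filter Topology

/-! ## Tangential variations do not change the volume -/

theorem contDiff_adjugate {X : Type*} [NormedAddCommGroup X] [NormedSpace ℝ X] {m : ℕ}
    {f : X → Matrix (Fin m) (Fin m) ℝ} {k : WithTop ℕ∞} (hf : ∀ i j, ContDiff ℝ k fun x => f x i j)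
    (i j : Fin m) : ContDiff ℝ k fun x => (f x).adjugate i j := by
  simp only [Matrix.adjugate_apply]
  refine contDiff_det fun a b => ?_
  simp only [Matrix.updateRow_apply]
  split_ifs
  · exact contDiff_const
  · exact hf a b

theorem hasDerivAt_det_one_add_smul {m : ℕ} (B : Matrix (Fin m) (Fin m) ℝ) :
    HasDerivAt (fun s : ℝ => (1 + s • B).det) B.trace 0 := by
  obtain ⟨p, hp⟩ : ∃ p : Polynomial ℝ, ∀ s : ℝ, (1 + s • B).det =
      1 + B.trace * s + p.eval s * s ^ 2 :=
    ⟨_, fun s => Matrix.det_one_add_smul s B⟩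
  have h1 : HasDerivAt (fun s : ℝ => 1 + B.trace * s + p.eval s * s ^ 2) B.trace 0 := by
    have h2 := (((hasDerivAt_id (0 : ℝ)).const_mul B.trace).const_add 1).add
      ((p.hasDerivAt 0).mul ((hasDerivAt_id (0 : ℝ)).pow 2))
    refine h2.congr_deriv ?_
    simp
  simpa only [hp] using h1

section Tangential

variable {n : ℕ} {V : Type*} [NormedAddCommGroup V] [NormedSpace ℝ V] {q : V → V → V → ℝ}

/-- The infinitesimal form of `jetDensity_jetAct` along the curve $1+sB$ of changes of basis:
$\det(1+sB)$ is positive for small $s$ and has derivative $\operatorname{tr}B$ at $0$. -/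
theorem fderiv_jetDensity_linear (hq : SmoothBilin q) {z : Jet n V}
    (hz : (jetGram q z).det ≠ 0) (B : Matrix (Fin n) (Fin n) ℝ) :
    fderiv ℝ (jetDensity q) z (0, fun i => ∑ k, B k i • z.2 k) = B.trace * jetDensity q z := by
  set w : Jet n V := (0, fun i => ∑ k, B k i • z.2 k) with hw
  have h1 : ∀ s : ℝ, jetAct (1 + s • B) z = z + s • w := by
    intro s
    refine Prod.ext ?_ ?_
    · simp [hw]
    · funext i
      rw [jetAct_snd]
      simp [hw, Matrix.one_apply, add_smul, Finset.sum_add_distrib, ite_smul, Finset.smul_sum,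
        smul_smul]
  have h2 : HasDerivAt (fun s : ℝ => jetDensity q (z + s • w)) (fderiv ℝ (jetDensity q) z w) 0 := by
    have h3 : HasDerivAt (fun s : ℝ => z + s • w) w 0 := by
      simpa using ((hasDerivAt_id (0 : ℝ)).smul_const w).const_add z
    have h4 := ((contDiffAt_jetDensity hq hz).differentiableAt (by simp)).hasFDerivAt
    exact HasFDerivAt.comp_hasDerivAt_of_eq (l := jetDensity q) (0 : ℝ) h4 h3 (by simp)
  have h5 : HasDerivAt (fun s : ℝ => (1 + s • B).det * jetDensity q z)
      (B.trace * jetDensity q z) 0 := (hasDerivAt_det_one_add_smul B).mul_const _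
  refine h2.unique (h5.congr_of_eventuallyEq ?_)
  have h6 : ∀ᶠ s : ℝ in 𝓝 0, 0 < (1 + s • B).det := by
    have := (hasDerivAt_det_one_add_smul B).continuousAt
    refine this.eventually_const_lt ?_
    simp
  filter_upwards [h6] with s hs
  rw [← h1, jetDensity_jetAct hq, abs_of_pos hs]

/-- The divergence theorem for vector fields of compact support in a coordinate domain. -/
theorem integral_divergence_eq_zero {X : Fin n → EuclideanSpace ℝ (Fin n) → ℝ}
    (hX : ∀ i, ContDiff ℝ 1 (X i)) (hs : ∀ i, HasCompactSupport (X i)) :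
    ∫ y, ∑ i, fderiv ℝ (X i) y (EuclideanSpace.single i 1) = 0 := by
  have hint : ∀ i, Integrable fun y => fderiv ℝ (X i) y (EuclideanSpace.single i 1) := by
    intro i
    refine Continuous.integrable_of_hasCompactSupport ?_ ?_
    · exact ((hX i).continuous_fderiv (by simp)).clm_apply continuous_const
    · exact (hs i).fderiv_apply ℝ _
  rw [integral_finsetSum _ fun i _ => hint i]
  refine Finset.sum_eq_zero fun i _ => ?_
  -- Integration by parts against the constant function one.
  have h := integral_mul_fderiv_eq_neg_fderiv_mul_of_integrable (μ := volume)
    (f := fun _ : EuclideanSpace ℝ (Fin n) => (1 : ℝ)) (g := X i)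
    (v := EuclideanSpace.single i 1) (by simp) (by simpa using hint i)
    (by simpa using (hX i).continuous.integrable_of_hasCompactSupport (hs i))
    (fun x _ => differentiableAt_const _) (fun x _ => (hX i).differentiable (by simp) x)
  simpa using h

variable {S : Type*} [TopologicalSpace S] [ChartedSpace (EuclideanSpace ℝ (Fin n)) S]
  [IsManifold (𝓡 n) ∞ S] {e : OpenPartialHomeomorph S (EuclideanSpace ℝ (Fin n))}
  {Φ W : S → V}

/-- The components, in the chart `e`, of the vector field `T` with `W = dΦ(T)`. -/
def tangentCoord (q : V → V → V → ℝ) (Φ W : S → V)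
    (e : OpenPartialHomeomorph S (EuclideanSpace ℝ (Fin n))) (i : Fin n)
    (y : EuclideanSpace ℝ (Fin n)) : ℝ :=
  ((jetGram q (jetIn e Φ y)).det)⁻¹ * ∑ j, q (Φ (e.symm y)) (W (e.symm y)) ((jetIn e Φ y).2 j) *
    (jetGram q (jetIn e Φ y)).adjugate j i

theorem contDiffOn_tangentCoord (hq : SmoothBilin q) (hΦ : ContMDiff (𝓡 n) 𝓘(ℝ, V) ∞ Φ)
    (h0 : DetNeZero n q Φ) (hW : ContMDiff (𝓡 n) 𝓘(ℝ, V) ∞ W)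
    (he : e ∈ atlas (EuclideanSpace ℝ (Fin n)) S) (i : Fin n) :
    ContDiffOn ℝ ∞ (tangentCoord q Φ W e i) e.target := by
  have hj := contDiffOn_jetIn he hΦ
  have hjs : ∀ j, ContDiffOn ℝ ∞ (fun y => (jetIn e Φ y).2 j) e.target := fun j =>
    contDiffOn_pi.1 hj.snd j
  refine ContDiffOn.mul ?_ (ContDiffOn.sum fun j _ => ContDiffOn.mul ?_ ?_)
  · exact ((contDiff_det_jetGram hq).comp_contDiffOn hj).inv
      fun y hy => h0.jetIn_ne_zero hq hΦ he hy
  · exact hq.smooth.comp_contDiffOn ((contDiffOn_comp_symm he hΦ).prodMk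
      ((contDiffOn_comp_symm he hW).prodMk (hjs j)))
  · exact (contDiff_adjugate (contDiff_jetGram hq) j i).comp_contDiffOn hj

omit [ChartedSpace (EuclideanSpace ℝ (Fin n)) S] [IsManifold (𝓡 n) ∞ S] in
theorem tangentCoord_eq_zero (hq : SmoothBilin q) {i : Fin n} {y : EuclideanSpace ℝ (Fin n)}
    (h : W (e.symm y) = 0) : tangentCoord q Φ W e i y = 0 := by
  have h1 : ∀ v, q (Φ (e.symm y)) 0 v = 0 := fun v => by
    have := hq.smul_left (Φ (e.symm y)) 0 0 v
    simpa using this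
  simp [tangentCoord, h, h1]

/-- Cramer's rule: pairing $W=\sum_i c_i\partial_i\Phi$ with the frame gives $c$ times the Gram
matrix, which the adjugate inverts up to the determinant. The formula with the adjugate is what
makes the components of the field visibly smooth. -/
theorem sum_tangentCoord (hq : SmoothBilin q) (hΦ : ContMDiff (𝓡 n) 𝓘(ℝ, V) ∞ Φ)
    (h0 : DetNeZero n q Φ)
    (hT : ∀ x, ∃ v : EuclideanSpace ℝ (Fin n), W x = diff n Φ x v)
    (he : e ∈ atlas (EuclideanSpace ℝ (Fin n)) S) {y : EuclideanSpace ℝ (Fin n)}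
    (hy : y ∈ e.target) :
    W (e.symm y) = ∑ i, tangentCoord q Φ W e i y • (jetIn e Φ y).2 i := by
  obtain ⟨v, hv⟩ := hT (e.symm y)
  replace hv := hv.trans
    (diff_eq_fderiv he (e.map_target hy) (hΦ.mdifferentiableAt (by simp)) v)
  rw [e.right_inv hy, clm_eq_sum] at hv
  set c : Fin n → ℝ := (chartLin e (e.symm y) v).ofLp with hc
  have hv' : W (e.symm y) = ∑ i, c i • (jetIn e Φ y).2 i := hv
  have hd := h0.jetIn_ne_zero hq hΦ he hy
  set M := jetGram q (jetIn e Φ y) with hM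
  have hb : ∀ j, q (Φ (e.symm y)) (W (e.symm y)) ((jetIn e Φ y).2 j) = Matrix.vecMul c M j := by
    intro j
    rw [hv', hq.sum_left]
    simp only [hq.smul_left, Matrix.vecMul, dotProduct]
    rfl
  have ht : ∀ i, tangentCoord q Φ W e i y = c i := by
    intro i
    rw [tangentCoord]
    simp only [hb]
    have h2 : (∑ j, Matrix.vecMul c M j * M.adjugate j i) = M.det * c i := by
      have : (Matrix.vecMul (Matrix.vecMul c M) M.adjugate) i = M.det * c i := by
        rw [Matrix.vecMul_vecMul, Matrix.mul_adjugate, Matrix.vecMul_smul, Matrix.vecMul_one]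
        simp
      exact this
    rw [h2, ← mul_assoc, inv_mul_cancel₀ hd, one_mul]
  simp only [ht]
  exact hv'

/-- The Lie derivative of a density along a vector field is a divergence. The jet of $d\Phi(T)$
splits into the derivative of the jet of $\Phi$ along $T$, which differentiates the density by the
chain rule, and the action of the matrix $\partial T$, which contributes its trace. The sum is
$\sum_i\partial_i(T^i\rho)$ with $\rho$ the density. -/
theorem fderiv_jetDensity_tangential (hq : SmoothBilin q) (hΦ : ContMDiff (𝓡 n) 𝓘(ℝ, V) ∞ Φ)
    (h0 : DetNeZero n q Φ) (hW : ContMDiff (𝓡 n) 𝓘(ℝ, V) ∞ W)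
    (hT : ∀ x, ∃ v : EuclideanSpace ℝ (Fin n), W x = diff n Φ x v)
    (he : e ∈ atlas (EuclideanSpace ℝ (Fin n)) S) {y : EuclideanSpace ℝ (Fin n)}
    (hy : y ∈ e.target) :
    fderiv ℝ (jetDensity q) (jetIn e Φ y) (jetIn e W y) =
      ∑ i, fderiv ℝ (fun z => tangentCoord q Φ W e i z * chartDensity q Φ e z) y
        (EuclideanSpace.single i 1) := by
  have hnhds := e.open_target.mem_nhds hy
  have hTd : ∀ i, DifferentiableAt ℝ (tangentCoord q Φ W e i) y := fun i =>
    ((contDiffOn_tangentCoord hq hΦ h0 hW he i).contDiffAt hnhds).differentiableAt (by simp)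
  have hDd : DifferentiableAt ℝ (chartDensity q Φ e) y :=
    ((contDiffOn_chartDensity hq hΦ h0 he).contDiffAt hnhds).differentiableAt (by simp)
  have hJd : DifferentiableAt ℝ (jetIn e Φ) y :=
    ((contDiffOn_jetIn he hΦ).contDiffAt hnhds).differentiableAt (by simp)
  have hz := h0.jetIn_ne_zero hq hΦ he hy
  have hcd : ContDiffAt ℝ ∞ (Φ ∘ e.symm) y := (contDiffOn_comp_symm he hΦ).contDiffAt hnhds
  have hdd : DifferentiableAt ℝ (fderiv ℝ (Φ ∘ e.symm)) y :=
    (hcd.fderiv_right (m := ∞) (by simp)).differentiableAt (by simp)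
  have hsymm : IsSymmSndFDerivAt ℝ (Φ ∘ e.symm) y := hcd.isSymmSndFDerivAt two_le_smooth
  set B : Matrix (Fin n) (Fin n) ℝ := fun k i =>
    fderiv ℝ (tangentCoord q Φ W e k) y (EuclideanSpace.single i 1) with hB
  have hJ2 : ∀ i j, (fderiv ℝ (jetIn e Φ) y (EuclideanSpace.single i 1)).2 j =
      fderiv ℝ (fderiv ℝ (Φ ∘ e.symm)) y (EuclideanSpace.single i 1)
        (EuclideanSpace.single j 1) := by
    intro i j
    have h1 := (hasFDerivAt_pi'.1 hJd.hasFDerivAt.snd) j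
    have h2 := hdd.hasFDerivAt.clm_apply
      (hasFDerivAt_const (EuclideanSpace.single j 1 : EuclideanSpace ℝ (Fin n)) y)
    have h3 := congrArg (fun L => L (EuclideanSpace.single i 1)) (h1.unique h2)
    simpa using h3
  have hJ1 : ∀ i, (fderiv ℝ (jetIn e Φ) y (EuclideanSpace.single i 1)).1 = (jetIn e Φ y).2 i := by
    intro i
    exact (congrArg (fun L => L (EuclideanSpace.single i 1)) hJd.hasFDerivAt.fst.fderiv).symm
  have hWev : (W ∘ e.symm) =ᶠ[𝓝 y] fun z => ∑ i, tangentCoord q Φ W e i z •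
      fderiv ℝ (Φ ∘ e.symm) z (EuclideanSpace.single i 1) := by
    filter_upwards [hnhds] with z hz
    exact sum_tangentCoord hq hΦ h0 hT he hz
  -- The splitting just described; it uses that the second derivatives of $\Phi$ are symmetric, so
  -- that differentiating the $i$-th frame vector in direction $j$ is differentiating the $j$-th one
  -- in direction $i$.
  have hjet : jetIn e W y = (∑ i, tangentCoord q Φ W e i y •
      fderiv ℝ (jetIn e Φ) y (EuclideanSpace.single i 1)) +
        (0, fun i => ∑ k, B k i • (jetIn e Φ y).2 k) := by
    refine Prod.ext ?_ ?_
    · simp only [Prod.fst_add, Prod.fst_sum, Prod.smul_fst, hJ1, add_zero]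
      exact sum_tangentCoord hq hΦ h0 hT he hy
    · funext j
      simp only [Prod.snd_add, Prod.snd_sum, Prod.smul_snd, Pi.add_apply, Finset.sum_apply,
        Pi.smul_apply, hJ2]
      change fderiv ℝ (W ∘ e.symm) y (EuclideanSpace.single j 1) = _
      rw [hWev.fderiv_eq]
      have h4 : HasFDerivAt (fun z => ∑ i, tangentCoord q Φ W e i z •
          fderiv ℝ (Φ ∘ e.symm) z (EuclideanSpace.single i 1)) _ y :=
        HasFDerivAt.fun_sum fun i _ => (hTd i).hasFDerivAt.smul (hdd.hasFDerivAt.clm_apply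
          (hasFDerivAt_const (EuclideanSpace.single i 1 : EuclideanSpace ℝ (Fin n)) y))
      rw [h4.fderiv]
      simp only [← Finset.sum_add_distrib]
      rw [_root_.sum_apply]
      refine Finset.sum_congr rfl fun i _ => ?_
      rw [hsymm.eq (EuclideanSpace.single i 1)]
      simp [hB, jetIn]
  rw [hjet, map_add, fderiv_jetDensity_linear hq hz, map_sum]
  have h5 : ∀ i, fderiv ℝ (fun z => tangentCoord q Φ W e i z * chartDensity q Φ e z) y
      (EuclideanSpace.single i 1) = tangentCoord q Φ W e i y *
        fderiv ℝ (jetDensity q) (jetIn e Φ y)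
          (fderiv ℝ (jetIn e Φ) y (EuclideanSpace.single i 1)) +
        B i i * jetDensity q (jetIn e Φ y) := by
    intro i
    have h6 : fderiv ℝ (chartDensity q Φ e) y =
        (fderiv ℝ (jetDensity q) (jetIn e Φ y)).comp (fderiv ℝ (jetIn e Φ) y) :=
      fderiv_comp (g := jetDensity q) y
        ((contDiffAt_jetDensity hq hz).differentiableAt (by simp)) hJd
    rw [fderiv_fun_mul (hTd i) hDd, h6]
    simp only [add_apply, smul_apply, ContinuousLinearMap.comp_apply, smul_eq_mul, hB]
    rw [chartDensity]
    ring
  simp only [h5, Finset.sum_add_distrib, map_smul, smul_eq_mul, Matrix.trace, Matrix.diag,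
    Finset.sum_mul]

variable [MeasurableSpace S] [BorelSpace S]

theorem integral_inducedVolume_chart (hq : SmoothBilin q) (hΦ : ContMDiff (𝓡 n) 𝓘(ℝ, V) ∞ Φ)
    (he : e ∈ atlas (EuclideanSpace ℝ (Fin n)) S) {g : S → ℝ} (hg : Continuous g)
    (hs : ∀ x ∉ e.source, g x = 0) :
    ∫ x, g x ∂inducedVolume n q Φ =
      ∫ y in e.target, chartDensity q Φ e y * g (e.symm y) := by
  have hsymm : AEMeasurable e.symm ((volume.restrict e.target).withDensity
      fun y => ENNReal.ofReal (chartDensity q Φ e y)) :=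
    (aemeasurable_chart_symm e).mono_ac (withDensity_absolutelyContinuous _ _)
  have hD : AEMeasurable (fun y => ENNReal.ofReal (chartDensity q Φ e y))
      (volume.restrict e.target) :=
    ((continuousOn_chartDensity hq he hΦ).aemeasurable
      e.open_target.measurableSet).ennreal_ofReal
  rw [← setIntegral_eq_integral_of_forall_compl_eq_zero hs, inducedVolume_restrict hq he hΦ,
    chartVolume_eq, integral_map hsymm hg.measurable.aestronglyMeasurable,
    integral_withDensity_eq_integral_toReal_smul₀ hD
      (ae_of_all _ fun _ => ENNReal.ofReal_lt_top)]
  refine integral_congr_ae (ae_of_all _ fun y => ?_)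
  simp only [smul_eq_mul]
  rw [ENNReal.toReal_ofReal]
  exact jetDensity_nonneg _ _

/-- When the support lies in one chart, the first variation is the integral of a divergence of
compact support in the coordinate space. -/
theorem integral_firstVar_tangential_chart [T2Space S] (hq : SmoothBilin q)
    (hΦ : ContMDiff (𝓡 n) 𝓘(ℝ, V) ∞ Φ)
    (h0 : DetNeZero n q Φ) (hW : ContMDiff (𝓡 n) 𝓘(ℝ, V) ∞ W)
    (hT : ∀ x, ∃ v : EuclideanSpace ℝ (Fin n), W x = diff n Φ x v)
    (he : e ∈ atlas (EuclideanSpace ℝ (Fin n)) S) (hc : HasCompactSupport W)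
    (hs : tsupport W ⊆ e.source) :
    ∫ x, firstVar n q Φ W x ∂inducedVolume n q Φ = 0 := by
  rw [integral_inducedVolume_chart hq hΦ he (continuous_firstVar hq hΦ h0 hW)
    fun x hx => firstVar_eq_zero fun h => hx (hs h)]
  set K : Set (EuclideanSpace ℝ (Fin n)) := e '' tsupport W with hK
  have hKc : IsCompact K := hc.isCompact.image_of_continuousOn (e.continuousOn.mono hs)
  have hKt : K ⊆ e.target := by
    rintro _ ⟨x, hx, rfl⟩
    exact e.map_source (hs hx)
  -- The coordinate field times the density, extended by zero. The extension is $C^1$ because the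
  -- field vanishes outside `K`, a compact subset of the chart target.
  set X : Fin n → EuclideanSpace ℝ (Fin n) → ℝ := fun i =>
    e.target.indicator fun z => tangentCoord q Φ W e i z * chartDensity q Φ e z with hX
  have hX0 : ∀ i, ∀ y ∉ K, X i y = 0 := by
    intro i y hy
    by_cases hyt : y ∈ e.target
    · simp only [hX]
      rw [indicator_of_mem hyt, tangentCoord_eq_zero hq, zero_mul]
      by_contra hne
      exact hy ⟨e.symm y, subset_tsupport _ hne, e.right_inv hyt⟩
    · exact indicator_of_notMem hyt _
  have hXs : ∀ i, HasCompactSupport (X i) := fun i => HasCompactSupport.intro hKc (hX0 i)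
  have hXev : ∀ i, ∀ y ∈ e.target, X i =ᶠ[𝓝 y]
      fun z => tangentCoord q Φ W e i z * chartDensity q Φ e z := by
    intro i y hy
    filter_upwards [e.open_target.mem_nhds hy] with z hz
    exact indicator_of_mem hz _
  have hXc : ∀ i, ContDiff ℝ 1 (X i) := by
    intro i
    refine contDiff_iff_contDiffAt.2 fun y => ?_
    by_cases hyt : y ∈ e.target
    · refine ContDiffAt.congr_of_eventuallyEq ?_ (hXev i y hyt)
      exact (((contDiffOn_tangentCoord hq hΦ h0 hW he i).mul
        (contDiffOn_chartDensity hq hΦ h0 he)).contDiffAt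
          (e.open_target.mem_nhds hyt)).of_le (by simp)
    · refine ContDiffAt.congr_of_eventuallyEq (contDiffAt_const (c := (0 : ℝ))) ?_
      filter_upwards [hKc.isClosed.isOpen_compl.mem_nhds fun h => hyt (hKt h)] with z hz
      exact hX0 i z hz
  rw [← integral_divergence_eq_zero hXc hXs]
  have h1 : ∀ y ∉ e.target, (∑ i, fderiv ℝ (X i) y (EuclideanSpace.single i 1)) = 0 := by
    intro y hy
    refine Finset.sum_eq_zero fun i _ => ?_
    have h2 : X i =ᶠ[𝓝 y] fun _ => 0 := by
      filter_upwards [hKc.isClosed.isOpen_compl.mem_nhds fun h => hy (hKt h)] with z hz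
      exact hX0 i z hz
    rw [h2.fderiv_eq]
    simp
  rw [← setIntegral_eq_integral_of_forall_compl_eq_zero h1]
  refine setIntegral_congr_fun e.open_target.measurableSet fun y hy => ?_
  have hpos : 0 < chartDensity q Φ e y := jetDensity_pos (h0.jetIn_ne_zero hq hΦ he hy)
  rw [firstVar_eq hq hΦ h0 hW he (e.map_target hy), e.right_inv hy, mul_div_cancel₀ _ hpos.ne',
    fderiv_jetDensity_tangential hq hΦ h0 hW hT he hy]
  exact Finset.sum_congr rfl fun i _ => by rw [(hXev i y hy).fderiv_eq]

/-- The first variation in the direction of a tangential field of compact support is zero. -/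
theorem integral_firstVar_tangential [T2Space S] [SecondCountableTopology S] (hq : SmoothBilin q)
    (hΦ : ContMDiff (𝓡 n) 𝓘(ℝ, V) ∞ Φ)
    (h0 : DetNeZero n q Φ) (hW : ContMDiff (𝓡 n) 𝓘(ℝ, V) ∞ W)
    (hT : ∀ x, ∃ v : EuclideanSpace ℝ (Fin n), W x = diff n Φ x v) (hc : HasCompactSupport W) :
    ∫ x, firstVar n q Φ W x ∂inducedVolume n q Φ = 0 := by
  have hlc : LocallyCompactSpace S :=
    ChartedSpace.locallyCompactSpace (EuclideanSpace ℝ (Fin n)) S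
  have hlf := isLocallyFiniteMeasure_inducedVolume (n := n) hq hΦ
  obtain ⟨t, ht⟩ := hc.isCompact.elim_nhds_subcover
    (fun x => (chartAt (EuclideanSpace ℝ (Fin n)) x).source)
    fun x _ => (chartAt (EuclideanSpace ℝ (Fin n)) x).open_source.mem_nhds (mem_chart_source _ x)
  -- The first variation is additive in the field, and cutting off by a function keeps the field
  -- tangential, so a partition of unity reduces the claim to single charts.
  obtain ⟨ρ, hρ⟩ := SmoothPartitionOfUnity.exists_isSubordinate (𝓡 n) (isClosed_tsupport W)
    (fun x : t => (chartAt (EuclideanSpace ℝ (Fin n)) (x : S)).source)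
    (fun x => (chartAt (EuclideanSpace ℝ (Fin n)) (x : S)).open_source)
    (ht.2.trans (by
      intro x hx
      simp only [mem_iUnion] at hx ⊢
      obtain ⟨i, hi, hxi⟩ := hx
      exact ⟨⟨i, hi⟩, hxi⟩))
  set f : t → S → V := fun i x => ρ i x • W x with hf
  have hfs : ∀ i, ContMDiff (𝓡 n) 𝓘(ℝ, V) ∞ (f i) := fun i => (ρ i).contMDiff.smul hW
  have hsum : W = fun x => ∑ i, f i x := by
    funext x
    by_cases hx : x ∈ tsupport W
    · have h1 := ρ.sum_eq_one hx
      rw [finsum_eq_sum_of_fintype] at h1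
      simp only [hf, ← Finset.sum_smul, h1, one_smul]
    · simp [hf, image_eq_zero_of_notMem_tsupport hx]
  have h1 : ∀ x, firstVar n q Φ W x = ∑ i, firstVar n q Φ (f i) x := by
    intro x
    conv_lhs => rw [hsum]
    exact firstVar_sum fun i _ => (hfs i).mdifferentiableAt (by simp)
  have hcs : ∀ i, HasCompactSupport (f i) := fun i => hc.smul_left
  simp only [h1]
  rw [integral_finsetSum]
  · refine Finset.sum_eq_zero fun i _ => ?_
    refine integral_firstVar_tangential_chart hq hΦ h0 (hfs i) (fun x => ?_)
      (chart_mem_atlas (EuclideanSpace ℝ (Fin n)) (i : S)) (hcs i)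
      ((tsupport_smul_subset_left _ _).trans (hρ i))
    obtain ⟨v, hv⟩ := hT x
    exact ⟨ρ i x • v, by rw [hf]; simp only; rw [hv]; exact (map_smul (diff n Φ x) _ _).symm⟩
  · intro i _
    refine (continuous_firstVar hq hΦ h0 (hfs i)).integrable_of_hasCompactSupport ?_
    exact HasCompactSupport.intro (hcs i).isCompact fun x hx => firstVar_eq_zero hx

end Tangential

end OrientedGeodesics
end

noncomputable section

namespace OrientedGeodesics

open Filter Topology

/-! ## Algebra of the ambient forms -/

section Algebra

variable {n : ℕ} {κ : ℝ}

theorem form_comm (x y : Amb n) : form κ x y = form κ y x :=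
  Finset.sum_congr rfl fun _ _ => by ring

theorem form_add_left (x x' y : Amb n) : form κ (x + x') y = form κ x y + form κ x' y := by
  simp only [form, ← Finset.sum_add_distrib]
  exact Finset.sum_congr rfl fun _ _ => by simp; ring

theorem form_smul_left (c : ℝ) (x y : Amb n) : form κ (c • x) y = c * form κ x y := by
  simp only [form, Finset.mul_sum]
  exact Finset.sum_congr rfl fun _ _ => by simp; ring

theorem form_add_right (x y y' : Amb n) : form κ x (y + y') = form κ x y + form κ x y' := by
  rw [form_comm, form_add_left, form_comm y, form_comm y']

theorem form_smul_right (c : ℝ) (x y : Amb n) : form κ x (c • y) = c * form κ x y := by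
  rw [form_comm, form_smul_left, form_comm]

theorem form_neg_left (x y : Amb n) : form κ (-x) y = -form κ x y := by
  rw [← neg_one_smul ℝ x, form_smul_left]; ring

theorem form_neg_right (x y : Amb n) : form κ x (-y) = -form κ x y := by
  rw [form_comm, form_neg_left, form_comm]

theorem form_sub_left (x x' y : Amb n) : form κ (x - x') y = form κ x y - form κ x' y := by
  rw [sub_eq_add_neg, form_add_left, form_neg_left]; ring

theorem form_sub_right (x y y' : Amb n) : form κ x (y - y') = form κ x y - form κ x y' := by
  rw [sub_eq_add_neg, form_add_right, form_neg_right]; ring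

@[simp] theorem form_zero_left (y : Amb n) : form κ 0 y = 0 := by simp [form]

@[simp] theorem form_zero_right (y : Amb n) : form κ y 0 = 0 := by simp [form]

theorem sgn_mul_sgn (hκ : κ * κ = 1) (i : Fin (n + 2)) : sgn κ i * sgn κ i = 1 := by
  unfold sgn; split_ifs <;> simp [hκ]

theorem form_nondegenerate (hκ : κ * κ = 1) {x : Amb n} (h : ∀ y, form κ x y = 0) : x = 0 := by
  ext i
  have h1 := h (EuclideanSpace.single i 1)
  simp only [form, PiLp.single_apply, mul_ite, mul_one, mul_zero, Finset.sum_ite_eq',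
    Finset.mem_univ, if_true] at h1
  have h2 : sgn κ i ≠ 0 := left_ne_zero_of_mul (sgn_mul_sgn hκ i ▸ one_ne_zero)
  simpa [h2] using h1

theorem smoothBilin_form : SmoothBilin (V := Amb n) (fun _ => form κ) where
  add_left _ := form_add_left
  smul_left _ := form_smul_left
  add_right _ := form_add_right
  smul_right _ := form_smul_right
  smooth := by unfold form; fun_prop

/-- The form as a continuous bilinear map. -/
theorem isBoundedBilinearMap_form :
    IsBoundedBilinearMap ℝ (fun p : Amb n × Amb n => form κ p.1 p.2) :=
  (LinearMap.toContinuousBilinearMap (LinearMap.mk₂ ℝ (form κ (n := n)) form_add_left form_smul_left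
    form_add_right form_smul_right)).isBoundedBilinearMap

theorem wedge_add_left (x x' y : Amb n) : wedge (x + x') y = wedge x y + wedge x' y := by
  funext i j; simp [wedge]; ring

theorem wedge_add_right (x y y' : Amb n) : wedge x (y + y') = wedge x y + wedge x y' := by
  funext i j; simp [wedge]; ring

theorem wedge_smul_left (c : ℝ) (x y : Amb n) : wedge (c • x) y = c • wedge x y := by
  funext i j; simp [wedge]; ring

theorem wedge_smul_right (c : ℝ) (x y : Amb n) : wedge x (c • y) = c • wedge x y := by
  funext i j; simp [wedge]; ring

theorem wedge_neg_right (x y : Amb n) : wedge x (-y) = -wedge x y := by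
  funext i j; simp [wedge]; ring

theorem wedge_swap (x y : Amb n) : wedge x y = wedge y (-x) := by
  funext i j; simp [wedge]; ring

theorem wedge_self (x : Amb n) : wedge x x = 0 := by
  funext i j; simp [wedge]; ring

theorem isBoundedBilinearMap_wedge :
    IsBoundedBilinearMap ℝ (fun p : Amb n × Amb n => wedge p.1 p.2) :=
  (LinearMap.toContinuousBilinearMap (LinearMap.mk₂ ℝ (wedge (n := n)) wedge_add_left
    wedge_smul_left wedge_add_right wedge_smul_right)).isBoundedBilinearMap

theorem metricG_add_left (U U' V : Biv n) :
    metricG κ (U + U') V = metricG κ U V + metricG κ U' V := by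
  simp only [metricG, ← mul_add, ← Finset.sum_add_distrib]
  congr 1
  exact Finset.sum_congr rfl fun _ _ => Finset.sum_congr rfl fun _ _ => by simp; ring

theorem metricG_smul_left (c : ℝ) (U V : Biv n) :
    metricG κ (c • U) V = c * metricG κ U V := by
  simp only [metricG, mul_left_comm c, Finset.mul_sum]
  exact Finset.sum_congr rfl fun _ _ => Finset.sum_congr rfl fun _ _ => by simp; ring

theorem metricG_comm (U V : Biv n) : metricG κ U V = metricG κ V U := by
  simp only [metricG]
  congr 1
  exact Finset.sum_congr rfl fun _ _ => Finset.sum_congr rfl fun _ _ => by ring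

theorem metricG_add_right (U V V' : Biv n) :
    metricG κ U (V + V') = metricG κ U V + metricG κ U V' := by
  rw [metricG_comm, metricG_add_left, metricG_comm V, metricG_comm V']

theorem metricG_smul_right (c : ℝ) (U V : Biv n) :
    metricG κ U (c • V) = c * metricG κ U V := by
  rw [metricG_comm, metricG_smul_left, metricG_comm]

theorem smoothBilin_metricG : SmoothBilin (V := Biv n) (fun _ => metricG κ) where
  add_left _ := metricG_add_left
  smul_left _ := metricG_smul_left
  add_right _ := metricG_add_right
  smul_right _ := metricG_smul_right
  smooth := by unfold metricG; fun_prop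

theorem derivExt_add (M : Matrix (Fin (n + 2)) (Fin (n + 2)) ℝ) (U V : Biv n) :
    derivExt M (U + V) = derivExt M U + derivExt M V := by
  funext j k
  simp only [derivExt, Pi.add_apply, mul_add, Finset.sum_add_distrib]
  ring

theorem derivExt_smul (M : Matrix (Fin (n + 2)) (Fin (n + 2)) ℝ) (c : ℝ) (V : Biv n) :
    derivExt M (c • V) = c • derivExt M V := by
  funext j k
  simp only [derivExt, Pi.smul_apply, smul_eq_mul, mul_add, Finset.mul_sum]
  congr 1 <;> exact Finset.sum_congr rfl fun _ _ => by ring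

theorem contDiff_bigJ : ContDiff ℝ ∞ fun z : Biv n × Biv n => bigJ κ z.1 z.2 := by
  unfold bigJ derivExt planeJ; fun_prop

theorem ContDiff.bigJ' {X : Type*} [NormedAddCommGroup X] [NormedSpace ℝ X] {f g : X → Biv 2}
    (hf : ContDiff ℝ ∞ f) (hg : ContDiff ℝ ∞ g) :
    ContDiff ℝ ∞ fun x => OrientedGeodesics.bigJ' κ (f x) (g x) := by
  unfold OrientedGeodesics.bigJ' derivExt normalJ volForm; fun_prop

theorem ContDiff.metricG {X : Type*} [NormedAddCommGroup X] [NormedSpace ℝ X] {f g : X → Biv n}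
    (hf : ContDiff ℝ ∞ f) (hg : ContDiff ℝ ∞ g) :
    ContDiff ℝ ∞ fun x => OrientedGeodesics.metricG κ (f x) (g x) :=
  (smoothBilin_metricG (κ := κ) (n := n)).smooth.comp
    ((contDiff_const (c := (0 : Biv n))).prodMk (hf.prodMk hg))

theorem contDiff_metricG' :
    ContDiff ℝ ∞ fun z : Biv 2 × Biv 2 × Biv 2 => metricG' κ z.1 z.2.1 z.2.2 := by
  have h1 : ContDiff ℝ ∞ fun z : Biv 2 × Biv 2 × Biv 2 => bigJ κ z.1 z.2.1 :=
    contDiff_bigJ.comp (g := fun w : Biv 2 × Biv 2 => bigJ κ w.1 w.2)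
      (contDiff_fst.prodMk (contDiff_fst.comp contDiff_snd))
  have h2 := OrientedGeodesics.ContDiff.bigJ' (κ := κ) (X := Biv 2 × Biv 2 × Biv 2)
    contDiff_fst (contDiff_snd.comp contDiff_snd)
  have h3 := OrientedGeodesics.ContDiff.metricG (κ := κ) (n := 2) h1 h2
  exact contDiff_const.mul h3

theorem smoothBilin_metricG' : SmoothBilin (V := Biv 2) (metricG' κ) where
  add_left p u u' v := by
    simp only [metricG', symplectic, bigJ, derivExt_add (n := 2), metricG_add_left, mul_add]
  smul_left p c u v := by
    simp only [metricG', symplectic, bigJ, derivExt_smul (n := 2), metricG_smul_left]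
    ring
  add_right p u v v' := by
    simp only [metricG', symplectic, bigJ', derivExt_add (n := 2), metricG_add_right, mul_add]
  smul_right p c u v := by
    simp only [metricG', symplectic, bigJ', derivExt_smul (n := 2), metricG_smul_right]
    ring
  smooth := contDiff_metricG'

/-- The tangent vectors `a ∧ X + b ∧ Y` of the space of geodesics at `a ∧ b`. -/
def IsTangent (κ : ℝ) (a b : Amb n) (W : Biv n) : Prop :=
  ∃ X Y : Amb n, form κ a X = 0 ∧ form κ b X = 0 ∧ form κ a Y = 0 ∧ form κ b Y = 0 ∧
    W = wedge a X + wedge b Y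

/-- `(a, b)` represents an oriented geodesic `a ∧ b`. -/
structure IsFlag (κ : ℝ) (a b : Amb n) : Prop where
  sq : κ * κ = 1
  aa : form κ a a = κ
  ab : form κ a b = 0
  bb : form κ b b = 1

theorem IsFlag.ba {a b : Amb n} (h : IsFlag κ a b) : form κ b a = 0 := by
  rw [form_comm, h.ab]

theorem IsFlag.metricG_tangent {a b : Amb n} (h : IsFlag κ a b) {X Y X' Y' : Amb n}
    (haX : form κ a X = 0) (hbX : form κ b X = 0) (haY : form κ a Y = 0) (hbY : form κ b Y = 0)
    (haX' : form κ a X' = 0) (hbX' : form κ b X' = 0) (haY' : form κ a Y' = 0)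
    (hbY' : form κ b Y' = 0) :
    metricG κ (wedge a X + wedge b Y) (wedge a X' + wedge b Y') =
      κ * form κ X X' + form κ Y Y' := by
  simp only [metricG_add_left, metricG_add_right, metricG_wedge, h.aa, h.ab, h.ba, h.bb, haX,
    haY, hbX, hbY, haX', hbX', haY', hbY']
  ring

theorem IsFlag.bigJ_tangent {a b : Amb n} (h : IsFlag κ a b) {X Y : Amb n}
    (haX : form κ a X = 0) (hbX : form κ b X = 0) (haY : form κ a Y = 0) (hbY : form κ b Y = 0) :
    bigJ κ (wedge a b) (wedge a X + wedge b Y) = wedge a (-(κ • Y)) + wedge b X := by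
  rw [OrientedGeodesics.bigJ_tangent κ h.sq a b X Y h.aa h.ab h.ba h.bb haX hbX haY hbY,
    wedge_neg_right, wedge_smul_right]
  abel

theorem IsFlag.symplectic_tangent {a b : Amb n} (h : IsFlag κ a b) {X Y X' Y' : Amb n}
    (haX : form κ a X = 0) (hbX : form κ b X = 0) (haY : form κ a Y = 0) (hbY : form κ b Y = 0)
    (haX' : form κ a X' = 0) (hbX' : form κ b X' = 0) (haY' : form κ a Y' = 0)
    (hbY' : form κ b Y' = 0) :
    symplectic κ (wedge a b) (wedge a X + wedge b Y) (wedge a X' + wedge b Y') =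
      κ * (form κ X Y' - form κ Y X') := by
  rw [symplectic, h.bigJ_tangent haX hbX haY hbY, h.metricG_tangent _ _ haX hbX haX' hbX' haY' hbY',
    form_neg_left, form_smul_left]
  · linear_combination (-κ * form κ Y X') * h.sq
  · rw [form_neg_right, form_smul_right, haY]; ring
  · rw [form_neg_right, form_smul_right, hbY]; ring

/-- The properties of `(G, 𝕁)` and `(G', 𝕁')` which the variational arguments use. -/
structure IsGeodesicStructure (κ : ℝ) (q : Biv n → Biv n → Biv n → ℝ)
    (J : Biv n → Biv n → Biv n) : Prop where
  bilin : SmoothBilin q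
  J_smul : ∀ p (c : ℝ) V, J p (c • V) = c • J p V
  J_smooth : ContDiff ℝ ∞ fun z : Biv n × Biv n => J z.1 z.2
  tangent : ∀ a b W, IsFlag κ a b → IsTangent κ a b W → IsTangent κ a b (J (wedge a b) W)
  compat : ∀ a b U V, IsFlag κ a b → IsTangent κ a b U → IsTangent κ a b V →
    symplectic κ (wedge a b) U (J (wedge a b) V) = q (wedge a b) U V
  symm : ∀ a b U V, IsFlag κ a b → IsTangent κ a b U → IsTangent κ a b V →
    q (wedge a b) U V = q (wedge a b) V U

/-- Compatibility holds because $\mathbb J$ multiplies $G$ by $\kappa$ on tangent vectors, so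
$\Omega(U,\mathbb JV)=\kappa G(\mathbb JU,\mathbb JV)=\kappa^2G(U,V)$. -/
theorem isGeodesicStructure_metricG :
    IsGeodesicStructure (n := n) κ (fun _ => metricG κ) (bigJ κ) where
  bilin := smoothBilin_metricG
  J_smul _ := derivExt_smul _
  J_smooth := contDiff_bigJ
  tangent := by
    rintro a b W h ⟨X, Y, haX, hbX, haY, hbY, rfl⟩
    refine ⟨-(κ • Y), X, ?_, ?_, haX, hbX, h.bigJ_tangent haX hbX haY hbY⟩
    · rw [form_neg_right, form_smul_right, haY]; ring
    · rw [form_neg_right, form_smul_right, hbY]; ring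
  compat := by
    rintro a b U V h ⟨X, Y, haX, hbX, haY, hbY, rfl⟩ ⟨X', Y', haX', hbX', haY', hbY', rfl⟩
    rw [h.bigJ_tangent haX' hbX' haY' hbY', h.symplectic_tangent haX hbX haY hbY _ _ haX' hbX',
      h.metricG_tangent haX hbX haY hbY haX' hbX' haY' hbY', form_neg_right, form_smul_right]
    · linear_combination form κ Y Y' * h.sq
    · rw [form_neg_right, form_smul_right, haY']; ring
    · rw [form_neg_right, form_smul_right, hbY']; ring

  symm _ _ U V _ _ _ := metricG_comm U V

/-- By `form_normalJ` these products are determinants with a repeated row. -/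
theorem normalJ_perp (hκ : κ * κ = 1) (a b v : Amb 2) :
    form κ a (WithLp.toLp 2 ((normalJ κ (wedge a b)).mulVec v)) = 0 ∧
      form κ b (WithLp.toLp 2 ((normalJ κ (wedge a b)).mulVec v)) = 0 := by
  constructor
  · rw [form_comm, form_normalJ κ hκ, volForm_wedge]
    exact Matrix.det_zero_of_row_eq (i := 0) (j := 3) (by decide) rfl
  · rw [form_comm, form_normalJ κ hκ, volForm_wedge]
    exact Matrix.det_zero_of_row_eq (i := 1) (j := 3) (by decide) rfl

/-- Exchanging the last two rows of the determinant changes its sign. -/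
theorem normalJ_skew (hκ : κ * κ = 1) (a b v w : Amb 2) :
    form κ (WithLp.toLp 2 ((normalJ κ (wedge a b)).mulVec v)) w =
      -form κ v (WithLp.toLp 2 ((normalJ κ (wedge a b)).mulVec w)) := by
  rw [form_comm v, form_normalJ κ hκ, form_normalJ κ hκ, volForm_wedge, volForm_wedge]
  have h := Matrix.det_permute (Equiv.swap (2 : Fin 4) 3)
    (Matrix.of ![(a : Fin 4 → ℝ), (b : Fin 4 → ℝ), (w : Fin 4 → ℝ), (v : Fin 4 → ℝ)])
  rw [Equiv.Perm.sign_swap (by decide)] at h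
  have h2 : (Matrix.of ![(a : Fin 4 → ℝ), (b : Fin 4 → ℝ), (w : Fin 4 → ℝ),
      (v : Fin 4 → ℝ)]).submatrix (Equiv.swap (2 : Fin 4) 3) id =
      Matrix.of ![(a : Fin 4 → ℝ), (b : Fin 4 → ℝ), (v : Fin 4 → ℝ), (w : Fin 4 → ℝ)] := by
    ext i j
    fin_cases i <;> rfl
  rw [h2] at h
  simpa using h

/-- Compatibility is the definition of $G'$. Its symmetry comes from two sign changes: $\Omega$ is
skew and so is $J'$ with respect to the scalar product. -/
theorem isGeodesicStructure_metricG' :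
    IsGeodesicStructure (n := 2) κ (metricG' κ) (bigJ' κ) where
  bilin := smoothBilin_metricG'
  J_smul _ := derivExt_smul (n := 2) _
  J_smooth := OrientedGeodesics.ContDiff.bigJ' contDiff_fst contDiff_snd
  tangent := by
    rintro a b W h ⟨X, Y, haX, hbX, haY, hbY, rfl⟩
    have hX := normalJ_perp h.sq a b X
    have hY := normalJ_perp h.sq a b Y
    exact ⟨_, _, hX.1, hX.2, hY.1, hY.2, bigJ'_tangent κ a b X Y⟩
  compat _ _ _ _ _ _ _ := rfl
  symm := by
    rintro a b U V h ⟨X, Y, haX, hbX, haY, hbY, rfl⟩ ⟨X', Y', haX', hbX', haY', hbY', rfl⟩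
    have hX := normalJ_perp h.sq a b X
    have hY := normalJ_perp h.sq a b Y
    have hX' := normalJ_perp h.sq a b X'
    have hY' := normalJ_perp h.sq a b Y'
    rw [metricG', metricG', bigJ'_tangent, bigJ'_tangent,
      h.symplectic_tangent haX hbX haY hbY hX'.1 hX'.2 hY'.1 hY'.2,
      h.symplectic_tangent haX' hbX' haY' hbY' hX.1 hX.2 hY.1 hY.2, form_comm X, form_comm Y,
      normalJ_skew h.sq, normalJ_skew h.sq, form_comm Y', form_comm X']
    rw [form_comm _ Y', form_comm _ X']
    ring

end Algebra

end OrientedGeodesics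
end

noncomputable section

namespace OrientedGeodesics

open Filter Topology

/-! ## The frame of a hypersurface -/

section Frame

variable {n : ℕ} {κ : ℝ}

/-- The linear data of a hypersurface at a point: position `a`, normal `b`, and the differentials
`P` and `Q` of the position and of the normal. -/
structure IsFrame (κ : ℝ) (a b : Amb n) (P Q : EuclideanSpace ℝ (Fin n) →L[ℝ] Amb n) : Prop
    extends IsFlag κ a b where
  inj : Function.Injective P
  aP : ∀ v, form κ a (P v) = 0
  bP : ∀ v, form κ b (P v) = 0
  aQ : ∀ v, form κ a (Q v) = 0
  bQ : ∀ v, form κ b (Q v) = 0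
  symm : ∀ v w, form κ (Q v) (P w) = form κ (Q w) (P v)

variable {a b : Amb n} {P Q : EuclideanSpace ℝ (Fin n) →L[ℝ] Amb n}

theorem IsFlag.ne_zero (h : IsFlag κ a b) : κ ≠ 0 := left_ne_zero_of_mul (h.sq ▸ one_ne_zero)

/-- The position, the normal and the tangent space are mutually orthogonal and the first two are not
null, so the sum is direct; its dimension is $1+1+n=n+2$. -/
theorem IsFrame.decompose (h : IsFrame κ a b P Q) (Z : Amb n) :
    ∃ (r s : ℝ) (v : EuclideanSpace ℝ (Fin n)), Z = r • a + s • b + P v := by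
  set L : (ℝ × ℝ × EuclideanSpace ℝ (Fin n)) →ₗ[ℝ] Amb n :=
    (LinearMap.toSpanSingleton ℝ _ a).coprod
      ((LinearMap.toSpanSingleton ℝ _ b).coprod P.toLinearMap) with hL
  have hLa : ∀ z, L z = z.1 • a + (z.2.1 • b + P z.2.2) := fun z => by simp [hL]
  have hinj : Function.Injective L := by
    rw [injective_iff_map_eq_zero]
    rintro ⟨r, s, v⟩ hz
    rw [hLa] at hz
    simp only at hz
    have h1 := congrArg (form κ a) hz
    simp only [form_add_right, form_smul_right, h.aa, h.ab, h.aP, form_zero_right] at h1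
    have hr : r = 0 := by simpa [h.ne_zero] using h1
    have h2 := congrArg (form κ b) hz
    simp only [form_add_right, form_smul_right, h.ba, h.bb, h.bP, form_zero_right] at h2
    have hs : s = 0 := by simpa using h2
    have hv : P v = P 0 := by simpa [hr, hs] using hz
    rw [hr, hs, h.inj hv]
    rfl
  have hfr : Module.finrank ℝ (ℝ × ℝ × EuclideanSpace ℝ (Fin n)) = Module.finrank ℝ (Amb n) := by
    simp [Module.finrank_prod]
    omega
  obtain ⟨z, hz⟩ := (LinearMap.injective_iff_surjective_of_finrank_eq_finrank hfr).1 hinj Z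
  exact ⟨z.1, z.2.1, z.2.2, by rw [← hz, hLa, add_assoc]⟩

theorem IsFrame.mem_range (h : IsFrame κ a b P Q) {Z : Amb n} (ha : form κ a Z = 0)
    (hb : form κ b Z = 0) : ∃ v, Z = P v := by
  obtain ⟨r, s, v, rfl⟩ := h.decompose Z
  simp only [form_add_right, form_smul_right, h.aa, h.ab, h.aP, h.ba, h.bb, h.bP] at ha hb
  have hr : r = 0 := by simpa [h.ne_zero] using ha
  have hs : s = 0 := by simpa using hb
  exact ⟨v, by simp [hr, hs]⟩

theorem IsFrame.eq_zero (h : IsFrame κ a b P Q) {Z : Amb n} (ha : form κ a Z = 0)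
    (hb : form κ b Z = 0) (hP : ∀ v, form κ (P v) Z = 0) : Z = 0 := by
  refine form_nondegenerate h.sq fun y => ?_
  obtain ⟨r, s, v, rfl⟩ := h.decompose y
  rw [form_comm, form_add_left, form_add_left, form_smul_left, form_smul_left, ha, hb, hP]
  ring

/-- The differential of the Gauss map. -/
def gaussDiff (a b : Amb n) (P Q : EuclideanSpace ℝ (Fin n) →L[ℝ] Amb n)
    (v : EuclideanSpace ℝ (Fin n)) : Biv n := wedge a (Q v) + wedge b (-P v)

theorem IsFrame.gaussDiff_tangent (h : IsFrame κ a b P Q) (v : EuclideanSpace ℝ (Fin n)) :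
    IsTangent κ a b (gaussDiff a b P Q v) :=
  ⟨Q v, -P v, h.aQ v, h.bQ v, by rw [form_neg_right, h.aP, neg_zero],
    by rw [form_neg_right, h.bP, neg_zero], rfl⟩

theorem IsFrame.symplectic_gaussDiff (h : IsFrame κ a b P Q) (v : EuclideanSpace ℝ (Fin n))
    {X Y : Amb n} (haX : form κ a X = 0) (hbX : form κ b X = 0) (haY : form κ a Y = 0)
    (hbY : form κ b Y = 0) :
    symplectic κ (wedge a b) (gaussDiff a b P Q v) (wedge a X + wedge b Y) =
      κ * (form κ (Q v) Y + form κ (P v) X) := by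
  rw [gaussDiff, h.toIsFlag.symplectic_tangent (h.aQ v) (h.bQ v) _ _ haX hbX haY hbY,
    form_neg_left, sub_neg_eq_add]
  · rw [form_neg_right, h.aP, neg_zero]
  · rw [form_neg_right, h.bP, neg_zero]

/-- The tangent spaces of the Gauss map are isotropic. -/
theorem IsFrame.isotropic (h : IsFrame κ a b P Q) (v w : EuclideanSpace ℝ (Fin n)) :
    symplectic κ (wedge a b) (gaussDiff a b P Q v) (gaussDiff a b P Q w) = 0 := by
  nth_rewrite 2 [gaussDiff]
  rw [h.symplectic_gaussDiff v (h.aQ w) (h.bQ w) (by rw [form_neg_right, h.aP, neg_zero])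
    (by rw [form_neg_right, h.bP, neg_zero]), form_neg_right, form_comm (P v), h.symm v w]
  ring

/-- The tangent spaces of the Gauss map are maximal isotropic. -/
theorem IsFrame.mem_range_gaussDiff (h : IsFrame κ a b P Q) {W : Biv n} (hW : IsTangent κ a b W)
    (hs : ∀ v, symplectic κ (wedge a b) (gaussDiff a b P Q v) W = 0) :
    ∃ v, W = gaussDiff a b P Q v := by
  obtain ⟨X, Y, haX, hbX, haY, hbY, rfl⟩ := hW
  obtain ⟨w, rfl⟩ := h.mem_range haY hbY
  -- With $Y=Pw$, the vanishing of the pairing and the symmetry of the second fundamental form say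
  -- that $X+Qw$ is orthogonal to all $Pv$. Hence $X=-Qw$, and the field is the differential of the
  -- Gauss map at $-w$.
  refine ⟨-w, ?_⟩
  have hX : X + Q w = 0 := by
    refine h.eq_zero ?_ ?_ fun v => ?_
    · rw [form_add_right, haX, h.aQ, add_zero]
    · rw [form_add_right, hbX, h.bQ, add_zero]
    · have h1 := hs v
      rw [h.symplectic_gaussDiff v haX hbX haY hbY, mul_eq_zero, or_iff_right h.ne_zero,
        h.symm v w] at h1
      rw [form_add_right, form_comm (P v) (Q w)]
      linarith
  rw [gaussDiff, map_neg, map_neg, neg_neg, ← eq_neg_of_add_eq_zero_left hX]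

theorem IsTangent.add {U W : Biv n} (hU : IsTangent κ a b U)
    (hW : IsTangent κ a b W) : IsTangent κ a b (U + W) := by
  obtain ⟨X, Y, haX, hbX, haY, hbY, rfl⟩ := hU
  obtain ⟨X', Y', haX', hbX', haY', hbY', rfl⟩ := hW
  refine ⟨X + X', Y + Y', ?_, ?_, ?_, ?_, ?_⟩ <;>
    simp only [form_add_right, haX, haX', hbX, hbX', haY, haY', hbY, hbY', add_zero,
      wedge_add_right]
  abel

theorem IsTangent.neg {U : Biv n} (hU : IsTangent κ a b U) :
    IsTangent κ a b (-U) := by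
  obtain ⟨X, Y, haX, hbX, haY, hbY, rfl⟩ := hU
  refine ⟨-X, -Y, ?_, ?_, ?_, ?_, ?_⟩ <;>
    simp only [form_neg_right, haX, hbX, haY, hbY, neg_zero, wedge_neg_right]
  abel

theorem symplectic_sub_right (p U V V' : Biv n) :
    symplectic κ p U (V - V') = symplectic κ p U V - symplectic κ p U V' := by
  have h : metricG κ (bigJ κ p U) (V - V') =
      metricG κ (bigJ κ p U) V - metricG κ (bigJ κ p U) V' := by
    rw [sub_eq_add_neg, metricG_add_right, ← neg_one_smul ℝ V', metricG_smul_right]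
    ring
  rw [symplectic, h, symplectic, symplectic]
  ring

end Frame

/-! ### Differentials of hypersurfaces and their Gauss maps -/

section Hypersurface

variable {n : ℕ} {S : Type*} [TopologicalSpace S] [ChartedSpace (EuclideanSpace ℝ (Fin n)) S]
  {κ : ℝ} {φ N : S → Amb n}

/-- The differential as a map on the model space. -/
def dE {V : Type*} [NormedAddCommGroup V] [NormedSpace ℝ V] (F : S → V) (x : S) :
    EuclideanSpace ℝ (Fin n) →L[ℝ] V := diff n F x

theorem dE_eq_fderiv [IsManifold (𝓡 n) ∞ S]
    {e : OpenPartialHomeomorph S (EuclideanSpace ℝ (Fin n))}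
    {V : Type*} [NormedAddCommGroup V] [NormedSpace ℝ V]
    (he : e ∈ atlas (EuclideanSpace ℝ (Fin n)) S) {x : S} (hx : x ∈ e.source)
    {F : S → V} (hF : MDifferentiableAt (𝓡 n) 𝓘(ℝ, V) F x) (v : EuclideanSpace ℝ (Fin n)) :
    dE F x v = fderiv ℝ (F ∘ e.symm) (e x) (chartLin e x v) :=
  diff_eq_fderiv he hx hF v

theorem diff_bilin {V₁ V₂ V : Type*} [NormedAddCommGroup V₁] [NormedSpace ℝ V₁]
    [NormedAddCommGroup V₂] [NormedSpace ℝ V₂] [NormedAddCommGroup V] [NormedSpace ℝ V]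
    {B : V₁ × V₂ → V} (hB : IsBoundedBilinearMap ℝ B) {f : S → V₁} {g : S → V₂} {x : S}
    (hf : MDifferentiableAt (𝓡 n) 𝓘(ℝ, V₁) f x) (hg : MDifferentiableAt (𝓡 n) 𝓘(ℝ, V₂) g x)
    (v : EuclideanSpace ℝ (Fin n)) :
    dE (n := n) (fun y => B (f y, g y)) x v = B (f x, dE g x v) + B (dE f x v, g x) := by
  have h1 : HasMFDerivAt (𝓡 n) 𝓘(ℝ, V₁ × V₂) (fun y => (f y, g y)) x
      ((mfderiv (𝓡 n) 𝓘(ℝ, V₁) f x).prod (mfderiv (𝓡 n) 𝓘(ℝ, V₂) g x)) := by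
    rw [modelWithCornersSelf_prod, ← chartedSpaceSelf_prod]
    exact hf.hasMFDerivAt.prodMk hg.hasMFDerivAt
  have h2 := (hB.hasFDerivAt (f x, g x)).hasMFDerivAt.comp x h1
  have h3 := h2.mfderiv
  exact congrArg (fun L => L v) h3

theorem dE_const {V : Type*} [NormedAddCommGroup V] [NormedSpace ℝ V] {F : S → V} {c : V}
    (h : ∀ x, F x = c) (x : S) (v : EuclideanSpace ℝ (Fin n)) : dE (n := n) F x v = 0 := by
  have h1 : F = fun _ => c := funext h
  have h2 : mfderiv (𝓡 n) 𝓘(ℝ, V) (fun _ : S => c) x = 0 := mfderiv_const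
  rw [h1]
  exact congrArg (fun L => L v) h2

theorem contMDiff_bilin {V₁ V₂ V X : Type*} [NormedAddCommGroup V₁] [NormedSpace ℝ V₁]
    [NormedAddCommGroup V₂] [NormedSpace ℝ V₂] [NormedAddCommGroup V] [NormedSpace ℝ V]
    {E H : Type*} [NormedAddCommGroup E] [NormedSpace ℝ E] [TopologicalSpace H]
    {I : ModelWithCorners ℝ E H} [TopologicalSpace X] [ChartedSpace H X]
    {B : V₁ × V₂ → V} (hB : IsBoundedBilinearMap ℝ B) {f : X → V₁} {g : X → V₂} {s : Set X}
    (hf : ContMDiffOn I 𝓘(ℝ, V₁) ∞ f s) (hg : ContMDiffOn I 𝓘(ℝ, V₂) ∞ g s) :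
    ContMDiffOn I 𝓘(ℝ, V) ∞ (fun y => B (f y, g y)) s :=
  hB.contDiff.contMDiff.comp_contMDiffOn (hf.prodMk_space hg)

theorem IsHypersurface.mdiff (h : IsHypersurface κ φ N) (x : S) :
    MDifferentiableAt (𝓡 n) 𝓘(ℝ, Amb n) φ x := h.smooth.mdifferentiableAt (by simp)

theorem IsHypersurface.mdiff_normal (h : IsHypersurface κ φ N) (x : S) :
    MDifferentiableAt (𝓡 n) 𝓘(ℝ, Amb n) N x := h.smooth_normal.mdifferentiableAt (by simp)

theorem IsHypersurface.dE_gaussMap (h : IsHypersurface κ φ N) (x : S)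
    (v : EuclideanSpace ℝ (Fin n)) :
    dE (n := n) (gaussMap φ N) x v = gaussDiff (φ x) (N x) (dE φ x) (dE N x) v := by
  have h1 := diff_bilin isBoundedBilinearMap_wedge (h.mdiff x) (h.mdiff_normal x) v
  rw [gaussDiff, ← wedge_swap]
  exact h1

theorem IsHypersurface.smooth_gaussMap (h : IsHypersurface κ φ N) :
    ContMDiff (𝓡 n) 𝓘(ℝ, Biv n) ∞ (gaussMap φ N) :=
  contMDiffOn_univ.1 (contMDiff_bilin isBoundedBilinearMap_wedge h.smooth.contMDiffOn
    h.smooth_normal.contMDiffOn)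

/-- Differentiating $\langle N,d\phi(w)\rangle=0$ in a chart expresses the second fundamental form
by the second derivative of $\phi$, which is symmetric. -/
theorem IsHypersurface.symm [IsManifold (𝓡 n) ∞ S] (h : IsHypersurface κ φ N) (x : S)
    (v w : EuclideanSpace ℝ (Fin n)) :
    form κ (dE (n := n) N x v) (dE (n := n) φ x w) =
      form κ (dE (n := n) N x w) (dE (n := n) φ x v) := by
  set e := chartAt (EuclideanSpace ℝ (Fin n)) x
  have he : e ∈ atlas (EuclideanSpace ℝ (Fin n)) S := chart_mem_atlas _ x
  have hx : x ∈ e.source := mem_chart_source _ x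
  have hnhds := e.open_target.mem_nhds (e.map_source hx)
  have hf : ContDiffAt ℝ ∞ (φ ∘ e.symm) (e x) := (contDiffOn_comp_symm he h.smooth).contDiffAt hnhds
  have hN : ContDiffAt ℝ ∞ (N ∘ e.symm) (e x) :=
    (contDiffOn_comp_symm he h.smooth_normal).contDiffAt hnhds
  have hdd : DifferentiableAt ℝ (fderiv ℝ (φ ∘ e.symm)) (e x) :=
    (hf.fderiv_right (m := ∞) (by simp)).differentiableAt (by simp)
  have key : ∀ v w, form κ (fderiv ℝ (N ∘ e.symm) (e x) v) (fderiv ℝ (φ ∘ e.symm) (e x) w) =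
      -form κ (N x) (fderiv ℝ (fderiv ℝ (φ ∘ e.symm)) (e x) v w) := by
    intro v w
    have h1 : (fun y => form κ ((N ∘ e.symm) y) (fderiv ℝ (φ ∘ e.symm) y w)) =ᶠ[𝓝 (e x)]
        fun _ => 0 := by
      filter_upwards [hnhds] with y hy
      obtain ⟨u, hu⟩ := chartLin_surjective he (e.map_target hy) w
      have h2 : form κ (N (e.symm y)) (dE φ (e.symm y) u) = 0 :=
        h.normal_orthogonal (e.symm y) u
      rw [dE_eq_fderiv he (e.map_target hy) (h.mdiff _), e.right_inv hy] at h2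
      rw [← hu]
      exact h2
    have h3 := h1.fderiv_eq (𝕜 := ℝ)
    have h4 := hdd.hasFDerivAt.clm_apply (hasFDerivAt_const w (e x))
    have h5 := (isBoundedBilinearMap_form (n := n) (κ := κ)).hasFDerivAt
      ((N ∘ e.symm) (e x), fderiv ℝ (φ ∘ e.symm) (e x) w)
    have h6 := HasFDerivAt.comp (f := fun y => ((N ∘ e.symm) y, fderiv ℝ (φ ∘ e.symm) y w)) (e x) h5
      ((hN.differentiableAt (by simp)).hasFDerivAt.prodMk h4)
    have h7 := congrArg (fun L : EuclideanSpace ℝ (Fin n) →L[ℝ] ℝ => L v)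
      (h6.fderiv.symm.trans h3)
    simp [IsBoundedBilinearMap.deriv, e.left_inv hx] at h7
    linarith
  have hsymm : IsSymmSndFDerivAt ℝ (φ ∘ e.symm) (e x) := hf.isSymmSndFDerivAt two_le_smooth
  have hdf : ∀ u, dE (n := n) φ x u = fderiv ℝ (φ ∘ e.symm) (e x) (chartLin e x u) := fun u =>
    dE_eq_fderiv he hx (h.mdiff x) u
  have hdN : ∀ u, dE (n := n) N x u = fderiv ℝ (N ∘ e.symm) (e x) (chartLin e x u) := fun u =>
    dE_eq_fderiv he hx (h.mdiff_normal x) u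
  rw [hdf, hdf, hdN, hdN, key, key, hsymm.eq]

/-- The orthogonality relations not already assumed for a hypersurface are the derivatives of
$\langle\phi,\phi\rangle=\kappa$, $\langle\phi,N\rangle=0$ and $\langle N,N\rangle=1$. -/
theorem IsHypersurface.isFrame [IsManifold (𝓡 n) ∞ S] (hκ : κ * κ = 1)
    (h : IsHypersurface κ φ N) (x : S) : IsFrame κ (φ x) (N x) (dE φ x) (dE N x) where
  sq := hκ
  aa := (h.mem x).1
  ab := h.normal_tangent x
  bb := h.normal_unit x
  inj := h.immersion x
  bP := h.normal_orthogonal x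
  symm := h.symm x
  aP v := by
    have h1 := diff_bilin (isBoundedBilinearMap_form (κ := κ)) (h.mdiff x) (h.mdiff x) v
    rw [dE_const fun y => (h.mem y).1] at h1
    simp only at h1
    rw [form_comm (dE φ x v)] at h1
    linarith
  aQ v := by
    have h1 := diff_bilin (isBoundedBilinearMap_form (κ := κ)) (h.mdiff x) (h.mdiff_normal x) v
    rw [dE_const fun y => h.normal_tangent y] at h1
    simp only at h1
    rw [form_comm (dE φ x v)] at h1
    have h2 : form κ (N x) (dE φ x v) = 0 := h.normal_orthogonal x v
    linarith
  bQ v := by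
    have h1 := diff_bilin (isBoundedBilinearMap_form (κ := κ)) (h.mdiff_normal x)
      (h.mdiff_normal x) v
    rw [dE_const fun y => h.normal_unit y] at h1
    simp only at h1
    rw [form_comm (dE N x v)] at h1
    linarith

end Hypersurface

end OrientedGeodesics
end

noncomputable section

namespace OrientedGeodesics

open Filter Topology

/-! ## Gradients -/

section Gradient

variable {n : ℕ} {V : Type*} [NormedAddCommGroup V] [NormedSpace ℝ V] {q : V → V → V → ℝ}

/-- The components of the vector dual to `b` with respect to the Gram matrix of the jet `z`. -/
def gradCoord (q : V → V → V → ℝ) (z : Jet n V) (b : Fin n → ℝ) (i : Fin n) : ℝ :=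
  ((jetGram q z).det)⁻¹ * Matrix.vecMul b (jetGram q z).adjugate i

/-- The vector in the span of the jet `z` which is dual to `b`. -/
def gradVec (q : V → V → V → ℝ) (z : Jet n V) (b : Fin n → ℝ) : V :=
  ∑ i, gradCoord q z b i • z.2 i

omit [NormedAddCommGroup V] [NormedSpace ℝ V] in
theorem vecMul_gradCoord {z : Jet n V} (hz : (jetGram q z).det ≠ 0) (b : Fin n → ℝ) :
    Matrix.vecMul (gradCoord q z b) (jetGram q z) = b := by
  have h : gradCoord q z b = ((jetGram q z).det)⁻¹ • Matrix.vecMul b (jetGram q z).adjugate := rfl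
  rw [h, Matrix.smul_vecMul, Matrix.vecMul_vecMul, Matrix.adjugate_mul, Matrix.vecMul_smul,
    Matrix.vecMul_one, smul_smul, inv_mul_cancel₀ hz, one_smul]

theorem gradVec_spec (hq : SmoothBilin q) {z : Jet n V} (hz : (jetGram q z).det ≠ 0)
    (b : Fin n → ℝ) (j : Fin n) : q z.1 (gradVec q z b) (z.2 j) = b j := by
  rw [gradVec, hq.sum_left]
  simp only [hq.smul_left]
  exact congrFun (vecMul_gradCoord hz b) j

/-- The dual vector is determined by its pairings with the span of the frame, hence is independent
of the basis; in components, `A` carries the new coordinates to the old ones. This allows the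
gradient to be computed in any chart. -/
theorem gradVec_jetAct (hq : SmoothBilin q) {A : Matrix (Fin n) (Fin n) ℝ} (hA : A.det ≠ 0)
    {z : Jet n V} (hz : (jetGram q z).det ≠ 0) (b : Jet n ℝ) :
    gradVec q (jetAct A z) (jetAct A b).2 = gradVec q z b.2 := by
  have hz' : (jetGram q (jetAct A z)).det ≠ 0 := by
    rw [det_jetGram_jetAct hq]; positivity
  set c' := gradCoord q (jetAct A z) (jetAct A b).2 with hc'
  set c := gradCoord q z b.2 with hc
  have h1 : gradVec q (jetAct A z) (jetAct A b).2 = ∑ k, Matrix.mulVec A c' k • z.2 k := by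
    simp only [gradVec, jetAct_snd, Finset.smul_sum, Matrix.mulVec, dotProduct, Finset.sum_smul,
      smul_smul]
    rw [Finset.sum_comm]
    exact Finset.sum_congr rfl fun k _ => Finset.sum_congr rfl fun i _ => by rw [mul_comm]
  have h2 : Matrix.mulVec A c' = c := by
    have h3 : Matrix.vecMul c' (jetGram q (jetAct A z)) = (jetAct A b).2 :=
      vecMul_gradCoord hz' _
    have h4 : Matrix.vecMul c (jetGram q z) = b.2 := vecMul_gradCoord hz _
    have h5 : (jetAct A b).2 = Matrix.vecMul b.2 A := by
      funext i
      rw [jetAct_snd]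
      simp [Matrix.vecMul, dotProduct, mul_comm]
    rw [jetGram_jetAct hq, ← Matrix.vecMul_vecMul, ← Matrix.vecMul_vecMul, Matrix.vecMul_transpose,
      h5, ← h4] at h3
    have hinj : ∀ M : Matrix (Fin n) (Fin n) ℝ, M.det ≠ 0 → ∀ v w : Fin n → ℝ,
        Matrix.vecMul v M = Matrix.vecMul w M → v = w := by
      intro M hM v w hvw
      have h6 : Matrix.vecMul (v - w) M = 0 := by rw [Matrix.sub_vecMul, hvw, sub_self]
      by_contra hne
      exact hM (Matrix.exists_vecMul_eq_zero_iff.1 ⟨v - w, sub_ne_zero.2 hne, h6⟩)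
    exact hinj _ hz _ _ (hinj _ hA _ _ h3)
  rw [h1, h2]
  rfl

theorem contDiffAt_gradVec (hq : SmoothBilin q) {z : Jet n V} (hz : (jetGram q z).det ≠ 0)
    (b : Fin n → ℝ) :
    ContDiffAt ℝ ∞ (fun p : Jet n V × (Fin n → ℝ) => gradVec q p.1 p.2) (z, b) := by
  unfold gradVec gradCoord
  simp only [Matrix.vecMul, dotProduct]
  have h1 : ∀ j i, ContDiffAt ℝ ∞ (fun p : Jet n V × (Fin n → ℝ) =>
      (jetGram q p.1).adjugate j i) (z, b) := fun j i =>
    ContDiff.contDiffAt ((contDiff_adjugate (contDiff_jetGram hq) j i).comp contDiff_fst)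
  have h2 : ContDiffAt ℝ ∞ (fun p : Jet n V × (Fin n → ℝ) =>
      ((jetGram q p.1).det)⁻¹) (z, b) :=
    (ContDiff.contDiffAt ((contDiff_det_jetGram hq).comp contDiff_fst)).inv hz
  refine ContDiffAt.sum fun i _ => ContDiffAt.smul (h2.mul (ContDiffAt.sum fun j _ =>
    ContDiffAt.mul ?_ (h1 j i))) ?_ <;> fun_prop

theorem ContDiffAt.gradVec (hq : SmoothBilin q) {X : Type*} [NormedAddCommGroup X]
    [NormedSpace ℝ X] {f : X → Jet n V} {b : X → Fin n → ℝ} {x : X} (hf : ContDiffAt ℝ ∞ f x)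
    (hb : ContDiffAt ℝ ∞ b x) (hz : (jetGram q (f x)).det ≠ 0) :
    ContDiffAt ℝ ∞ (fun y => gradVec q (f y) (b y)) x :=
  ContDiffAt.comp (f := fun y => (f y, b y))
    (g := fun p : Jet n V × (Fin n → ℝ) => OrientedGeodesics.gradVec q p.1 p.2) x
    (contDiffAt_gradVec hq hz _) (hf.prodMk hb)

end Gradient

/-! ### The Hamiltonian field along the Gauss map -/

section Hamiltonian

variable {n : ℕ} {S : Type*} [TopologicalSpace S] [ChartedSpace (EuclideanSpace ℝ (Fin n)) S]
  [IsManifold (𝓡 n) ∞ S] {κ : ℝ} {φ N : S → Amb n}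
  {q : Biv n → Biv n → Biv n → ℝ} {J : Biv n → Biv n → Biv n}

-- A null vector of the Gram matrix gives the coordinates of a tangent vector orthogonal to every
-- tangent vector.
omit [IsManifold (𝓡 n) ∞ S] in
theorem detNeZero_of_nondegenerate {V : Type*} [NormedAddCommGroup V] [NormedSpace ℝ V]
    {q : V → V → V → ℝ} (hq : SmoothBilin q) {F : S → V} (h : NondegenerateInduced n q F) :
    DetNeZero n q F := by
  intro x h0
  obtain ⟨c, hc, hc0⟩ := Matrix.exists_vecMul_eq_zero_iff.2 h0
  apply hc
  have h1 := h x (WithLp.toLp 2 c : EuclideanSpace ℝ (Fin n)) fun w => by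
    have hw : diff n F x w = ∑ k, (show EuclideanSpace ℝ (Fin n) from w) k •
      (jet (n := n) F x).2 k := diff_eq_sum F x (show EuclideanSpace ℝ (Fin n) from w)
    have hv : diff n F x (WithLp.toLp 2 c : EuclideanSpace ℝ (Fin n)) =
      ∑ k, c k • (jet (n := n) F x).2 k :=
        diff_eq_sum F x (WithLp.toLp 2 c : EuclideanSpace ℝ (Fin n))
    rw [hw, hq.sum_right]
    refine Finset.sum_eq_zero fun j _ => ?_
    rw [hq.smul_right]
    refine mul_eq_zero_of_right _ ?_
    have h2 := congrFun hc0 j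
    simp only [Matrix.vecMul, dotProduct, jetGram, Pi.zero_apply] at h2
    rw [← h2]
    refine (congrArg (fun z => q (F x) z _) hv).trans ?_
    rw [hq.sum_left]
    simp only [hq.smul_left]
    rfl
  exact congrArg WithLp.ofLp h1

/-- The vector field `J∇u` along `F`. -/
def hamField (q : Biv n → Biv n → Biv n → ℝ) (J : Biv n → Biv n → Biv n) (F : S → Biv n)
    (u : S → ℝ) (x : S) : Biv n :=
  J (F x) (gradVec q (jet (n := n) F x) (jet (n := n) u x).2)

theorem IsGeodesicStructure.contDiffAt_J (hG : IsGeodesicStructure κ q J) {X : Type*}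
    [NormedAddCommGroup X] [NormedSpace ℝ X] {f g : X → Biv n} {x : X}
    (hf : ContDiffAt ℝ ∞ f x) (hg : ContDiffAt ℝ ∞ g x) :
    ContDiffAt ℝ ∞ (fun y => J (f y) (g y)) x :=
  ContDiffAt.comp (f := fun y => (f y, g y)) (g := fun z : Biv n × Biv n => J z.1 z.2) x
    hG.J_smooth.contDiffAt (hf.prodMk hg)

theorem contMDiff_hamField (hG : IsGeodesicStructure κ q J) {F : S → Biv n}
    (hF : ContMDiff (𝓡 n) 𝓘(ℝ, Biv n) ∞ F) (h0 : DetNeZero n q F) {u : S → ℝ}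
    (hu : ContMDiff (𝓡 n) 𝓘(ℝ, ℝ) ∞ u) :
    ContMDiff (𝓡 n) 𝓘(ℝ, Biv n) ∞ (hamField q J F u) := by
  intro x
  set e := chartAt (EuclideanSpace ℝ (Fin n)) x
  have he : e ∈ atlas (EuclideanSpace ℝ (Fin n)) S := chart_mem_atlas _ x
  have hx : x ∈ e.source := mem_chart_source _ x
  have hnhds := e.open_target.mem_nhds (e.map_source hx)
  refine contMDiffAt_of_chart he hx (G := fun y =>
    J (F (e.symm y)) (gradVec q (jetIn e F y) (jetIn e u y).2)) ?_ ?_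
  · exact hG.contDiffAt_J ((contDiffOn_comp_symm he hF).contDiffAt hnhds)
      (OrientedGeodesics.ContDiffAt.gradVec hG.bilin ((contDiffOn_jetIn he hF).contDiffAt hnhds)
        ((contDiffOn_jetIn he hu).contDiffAt hnhds).snd
        (h0.jetIn_ne_zero hG.bilin hF he (e.map_source hx)))
  · filter_upwards [e.open_source.mem_nhds hx] with z hz
    rw [hamField, jet_eq_jetAct he hz (hF.mdifferentiableAt (by simp)),
      jet_eq_jetAct he hz (hu.mdifferentiableAt (by simp)),
      gradVec_jetAct hG.bilin (det_chartMat_ne_zero he hz)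
        (h0.jetIn_ne_zero hG.bilin hF he (e.map_source hz)), e.left_inv hz]

-- Identifies the field built from jets, whose smoothness is easy to check, with `J` applied to the
-- gradient in the sense of `IsHamiltonianVariation`.
omit [IsManifold (𝓡 n) ∞ S] in
theorem exists_gradient (hG : IsGeodesicStructure κ q J) {F : S → Biv n}
    (h0 : DetNeZero n q F) (u : S → ℝ) (x : S) :
    ∃ g : EuclideanSpace ℝ (Fin n), (∀ v, q (F x) (dE (n := n) F x g) (dE (n := n) F x v) = dE (n := n) u x v) ∧
      hamField q J F u x = J (F x) (dE (n := n) F x g) := by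
  set c := gradCoord q (jet (n := n) F x) (jet (n := n) u x).2 with hc
  have h1 : dE (n := n) F x (WithLp.toLp 2 c) = gradVec q (jet (n := n) F x) (jet (n := n) u x).2 :=
    diff_eq_sum F x (WithLp.toLp 2 c)
  refine ⟨WithLp.toLp 2 c, fun v => ?_, by rw [h1]; rfl⟩
  have hv : dE (n := n) F x v = ∑ k, v k • (jet (n := n) F x).2 k := diff_eq_sum F x v
  have hu : dE (n := n) u x v = ∑ k, v k • (jet (n := n) u x).2 k := diff_eq_sum u x v
  rw [h1, hv, hu, hG.bilin.sum_right]
  refine Finset.sum_congr rfl fun k _ => ?_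
  rw [hG.bilin.smul_right]
  exact congrArg _ (gradVec_spec hG.bilin (h0 x) _ k)

omit [IsManifold (𝓡 n) ∞ S] in
theorem hamField_eq_zero (hG : IsGeodesicStructure κ q J) {F : S → Biv n}
    {u : S → ℝ} {x : S} (hx : x ∉ tsupport u) : hamField q J F u x = 0 := by
  have h : u =ᶠ[𝓝 x] fun _ => 0 := notMem_tsupport_iff_eventuallyEq.1 hx
  rw [hamField, jet_congr h, jet_zero]
  have h1 : gradVec q (jet (n := n) F x) (0 : Jet n ℝ).2 = 0 := by
    simp [gradVec, gradCoord]
  rw [h1]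
  have := hG.J_smul (F x) 0 0
  simpa using this

/-- The gradient is tangent to the space of geodesics since it lies in the image of the differential
of the Gauss map, and `J` preserves these tangent spaces. -/
theorem hamField_tangent (hG : IsGeodesicStructure κ q J) (hκ : κ * κ = 1)
    (h : IsHypersurface κ φ N)
    (h0 : DetNeZero n q (gaussMap φ N)) (u : S → ℝ) (x : S) :
    IsTangent κ (φ x) (N x) (hamField q J (gaussMap φ N) u x) := by
  obtain ⟨g, -, hg⟩ := exists_gradient hG h0 u x
  have hf := h.isFrame hκ x
  rw [hg, h.dE_gaussMap]
  exact hG.tangent _ _ _ hf.toIsFlag (hf.gaussDiff_tangent g)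

/-- `J∇u` is characterised modulo tangential fields by `Ω(dΦ(v), J∇u) = du(v)`. -/
theorem symplectic_of_gradient (hG : IsGeodesicStructure κ q J) (hκ : κ * κ = 1)
    (h : IsHypersurface κ φ N) {u : S → ℝ} {x : S} {g : EuclideanSpace ℝ (Fin n)}
    (hg : ∀ v, q (gaussMap φ N x) (dE (n := n) (gaussMap φ N) x g) (dE (n := n) (gaussMap φ N) x v) = dE (n := n) u x v)
    (v : EuclideanSpace ℝ (Fin n)) :
    symplectic κ (gaussMap φ N x) (dE (n := n) (gaussMap φ N) x v)
      (J (gaussMap φ N x) (dE (n := n) (gaussMap φ N) x g)) = dE (n := n) u x v := by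
  have hf := h.isFrame hκ x
  have hv := hf.gaussDiff_tangent v
  have hg' := hf.gaussDiff_tangent g
  rw [← h.dE_gaussMap] at hv hg'
  rw [← hg v]
  have h1 := hG.compat _ _ _ _ hf.toIsFlag hv hg'
  have h2 := hG.symm _ _ _ _ hf.toIsFlag hv hg'
  exact h1.trans h2

theorem symplectic_hamField (hG : IsGeodesicStructure κ q J) (hκ : κ * κ = 1)
    (h : IsHypersurface κ φ N) (h0 : DetNeZero n q (gaussMap φ N)) (u : S → ℝ) (x : S)
    (v : EuclideanSpace ℝ (Fin n)) :
    symplectic κ (gaussMap φ N x) (dE (n := n) (gaussMap φ N) x v) (hamField q J (gaussMap φ N) u x) =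
      dE (n := n) u x v := by
  obtain ⟨g, hg, hW⟩ := exists_gradient hG h0 u x
  rw [hW]
  exact symplectic_of_gradient hG hκ h hg v

/-- Non-degeneracy is the only part that has to be assumed; isotropy is automatic for Gauss maps. -/
theorem isLagrangian_gaussMap (hκ : κ * κ = 1) (hpos : ∀ x, φ x ∈ spaceForm κ n)
    (h : IsHypersurface κ φ N) (hnd : NondegenerateInduced n q (gaussMap φ N)) :
    IsLagrangian κ q (gaussMap φ N) where
  smooth := h.smooth_gaussMap
  mem x := ⟨φ x, N x, hpos x, h.normal_tangent x, h.normal_unit x, rfl⟩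
  isotropic x v w := by
    have h1 : ∀ v w : EuclideanSpace ℝ (Fin n), symplectic κ (gaussMap φ N x)
        (dE (n := n) (gaussMap φ N) x v) (dE (n := n) (gaussMap φ N) x w) = 0 := fun v w => by
      rw [h.dE_gaussMap, h.dE_gaussMap]
      exact (h.isFrame hκ x).isotropic v w
    exact h1 v w
  nondegenerate := hnd

end Hamiltonian

end OrientedGeodesics
end

noncomputable section

namespace OrientedGeodesics

open Filter Topology

/-! ## Variations through oriented geodesics -/

/-- The tube lemma on the compact set, where the variation takes place; off it nothing moves, so the
property holds at all times. It supplies the time interval of every variation constructed below. -/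
theorem exists_uniform_of_compact {S : Type*} [TopologicalSpace S] {P : ℝ → S → Prop} {K : Set S}
    (hK : IsCompact K) (h1 : ∀ x ∈ K, ∀ᶠ z : ℝ × S in 𝓝 (0, x), P z.1 z.2)
    (h2 : ∀ t, ∀ x ∉ K, P t x) : ∃ δ > 0, ∀ t ∈ Ioo (-δ) δ, ∀ x, P t x := by
  have h3 : ∀ᶠ t in 𝓝 (0 : ℝ), ∀ x ∈ K, P t x :=
    hK.eventually_forall_of_forall_eventually h1
  obtain ⟨δ, hδ, h4⟩ := Metric.eventually_nhds_iff.1 h3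
  refine ⟨δ, hδ, fun t ht x => ?_⟩
  by_cases hx : x ∈ K
  · exact h4 (by rwa [Real.dist_eq, sub_zero, abs_lt]) x hx
  · exact h2 t x hx

section Normalization

variable {n : ℕ} {κ : ℝ}

/-- The pairs which span an oriented geodesic after normalization. -/
def regularPairs (κ : ℝ) (n : ℕ) : Set (Amb n × Amb n) :=
  {z | 0 < κ * form κ z.1 z.1 ∧ 0 < κ * metricG κ (wedge z.1 z.2) (wedge z.1 z.2) ∧
    (κ = -1 → 0 < z.1 (Fin.last (n + 1)))}

/-- The oriented geodesic spanned by a pair of vectors. -/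
def normWedge (κ : ℝ) {n : ℕ} (z : Amb n × Amb n) : Biv n :=
  (Real.sqrt (κ * metricG κ (wedge z.1 z.2) (wedge z.1 z.2)))⁻¹ • wedge z.1 z.2

theorem contDiff_wedge : ContDiff ℝ ∞ fun z : Amb n × Amb n => wedge z.1 z.2 :=
  isBoundedBilinearMap_wedge.contDiff

theorem contDiff_metricG_wedge :
    ContDiff ℝ ∞ fun z : Amb n × Amb n => κ * metricG κ (wedge z.1 z.2) (wedge z.1 z.2) :=
  contDiff_const.mul (OrientedGeodesics.ContDiff.metricG contDiff_wedge contDiff_wedge)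

theorem isOpen_regularPairs : IsOpen (regularPairs κ n) := by
  refine IsOpen.inter ?_ (IsOpen.inter ?_ ?_)
  · exact isOpen_lt continuous_const (continuous_const.mul
      (isBoundedBilinearMap_form.continuous.comp (continuous_fst.prodMk continuous_fst)))
  · exact isOpen_lt continuous_const contDiff_metricG_wedge.continuous
  · by_cases h : κ = -1
    · simp only [h, forall_const]
      exact isOpen_lt continuous_const (by fun_prop)
    · have : {z : Amb n × Amb n | κ = -1 → 0 < z.1 (Fin.last (n + 1))} = univ := by simp [h]
      exact (congrArg IsOpen this).mpr isOpen_univ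

theorem contDiffAt_normWedge {z : Amb n × Amb n} (hz : z ∈ regularPairs κ n) :
    ContDiffAt ℝ ∞ (normWedge κ) z := by
  refine ContDiffAt.smul (ContDiffAt.inv (ContDiffAt.sqrt contDiff_metricG_wedge.contDiffAt
    hz.2.1.ne') (Real.sqrt_pos.2 hz.2.1).ne') contDiff_wedge.contDiffAt

/-- Gram–Schmidt. For $\kappa=-1$ the two sign conditions say that $x$ is timelike and that the
plane spanned by $x,y$ is Lorentzian. -/
theorem normWedge_mem (hκ : κ * κ = 1) {z : Amb n × Amb n} (hz : z ∈ regularPairs κ n) :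
    normWedge κ z ∈ geodesics κ n := by
  obtain ⟨x, y⟩ := z
  obtain ⟨h1, h2, h3⟩ := hz
  simp only at h1 h2 h3
  set r := Real.sqrt (κ * form κ x x) with hr
  set s := Real.sqrt (κ * metricG κ (wedge x y) (wedge x y)) with hs
  have hr0 : 0 < r := Real.sqrt_pos.2 h1
  have hs0 : 0 < s := Real.sqrt_pos.2 h2
  have hr2 : r ^ 2 = κ * form κ x x := Real.sq_sqrt h1.le
  have hs2 : s ^ 2 = κ * (form κ x x * form κ y y - form κ x y * form κ x y) := by
    rw [hs, Real.sq_sqrt h2.le, metricG_wedge]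
  have hx0 : form κ x x ≠ 0 := fun h => by simp [h] at h1
  -- Normalize `x`, remove from `y` its component along `x`, and scale so that the second vector is
  -- a unit vector; the factors combine to the overall factor $1/s$ of the bivector.
  refine ⟨r⁻¹ • x, (r / s) • (y - (form κ x y / form κ x x) • x), ⟨?_, fun h => ?_⟩, ?_, ?_, ?_⟩
  · rw [form_smul_left, form_smul_right]
    field_simp
    rw [hr2]
    linear_combination (-form κ x x) * hκ
  · have := h3 h
    simp only [PiLp.smul_apply, smul_eq_mul]
    positivity
  · rw [form_smul_left, form_smul_right, form_sub_right, form_smul_right]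
    field_simp
    ring
  · simp only [form_smul_left, form_smul_right, form_sub_right, form_sub_left]
    rw [form_comm y x]
    field_simp
    rw [hr2, hs2]
    ring
  · rw [normWedge, wedge_smul_left, wedge_smul_right, sub_eq_add_neg, wedge_add_right,
      wedge_neg_right, wedge_smul_right, wedge_self, smul_zero, neg_zero, add_zero, smul_smul]
    congr 1
    simp only
    rw [← hs]
    field_simp

/-- The contraction of a bivector with a vector. -/
def contract (κ : ℝ) {n : ℕ} (a : Amb n) (W : Biv n) : Amb n :=
  WithLp.toLp 2 fun j => ∑ i, sgn κ i * a i * W i j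

theorem contract_wedge (a x y : Amb n) :
    contract κ a (wedge x y) = form κ a x • y - form κ a y • x := by
  ext j
  simp only [contract, wedge, form, PiLp.sub_apply, PiLp.smul_apply, smul_eq_mul, Finset.sum_mul,
    ← Finset.sum_sub_distrib]
  exact Finset.sum_congr rfl fun i _ => by ring

theorem contract_add (a : Amb n) (U W : Biv n) :
    contract κ a (U + W) = contract κ a U + contract κ a W := by
  ext j
  simp [contract, mul_add, Finset.sum_add_distrib]

theorem contract_zero (a : Amb n) : contract κ a (0 : Biv n) = 0 := by
  ext j
  simp [contract]

theorem contDiff_contract : ContDiff ℝ ∞ fun z : Amb n × Biv n => contract κ z.1 z.2 := by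
  unfold contract
  fun_prop

variable {a b : Amb n}

/-- `IsTangent` only asserts that components exist. Contracting with the two vectors of the flag
recovers them by a formula that is smooth in the base point. -/
theorem IsTangent.contract_spec (h : IsFlag κ a b) {W : Biv n} (hW : IsTangent κ a b W) :
    form κ a (κ • contract κ a W) = 0 ∧ form κ b (κ • contract κ a W) = 0 ∧
      form κ a (contract κ b W) = 0 ∧ form κ b (contract κ b W) = 0 ∧
      W = wedge a (κ • contract κ a W) + wedge b (contract κ b W) := by
  obtain ⟨X, Y, haX, hbX, haY, hbY, rfl⟩ := hW
  have h1 : κ • contract κ a (wedge a X + wedge b Y) = X := by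
    rw [contract_add, contract_wedge, contract_wedge, h.aa, h.ab, haX, haY]
    simp [smul_smul, h.sq]
  have h2 : contract κ b (wedge a X + wedge b Y) = Y := by
    rw [contract_add, contract_wedge, contract_wedge, h.bb, h.ba, hbX, hbY]
    simp
  rw [h1, h2]
  exact ⟨haX, hbX, haY, hbY, rfl⟩

theorem IsFlag.hasDerivAt_normWedge (h : IsFlag κ a b) {X Y : Amb n} (haX : form κ a X = 0)
    (hbX : form κ b X = 0) (haY : form κ a Y = 0) (hbY : form κ b Y = 0) :
    HasDerivAt (fun t : ℝ => normWedge κ (a - t • Y, b + t • X)) (wedge a X + wedge b Y) 0 := by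
  have h1 : ∀ t : ℝ, wedge (a - t • Y) (b + t • X) =
      wedge a b + t • (wedge a X + wedge b Y) - t ^ 2 • wedge Y X := fun t => by
    funext i j
    simp only [wedge, PiLp.sub_apply, PiLp.add_apply, PiLp.smul_apply, Pi.add_apply, Pi.sub_apply,
      Pi.smul_apply, smul_eq_mul]
    ring
  have h2 : ∀ t : ℝ, κ * metricG κ (wedge (a - t • Y) (b + t • X)) (wedge (a - t • Y) (b + t • X)) =
      κ * ((κ + t ^ 2 * form κ Y Y) * (1 + t ^ 2 * form κ X X) - (t ^ 2 * form κ Y X) ^ 2) :=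
    fun t => by
    rw [metricG_wedge]
    simp only [form_sub_left, form_sub_right, form_add_left, form_add_right, form_smul_left,
      form_smul_right, form_comm Y a, form_comm Y b, form_comm X b, h.aa, h.bb, h.ab, haX, hbX,
      haY, hbY]
    ring
  unfold normWedge
  simp only [h2]
  simp only [h1]
  -- The quantity under the root depends on $t$ only through $t^2$, so the normalizing factor is
  -- stationary at $t=0$ and does not affect the velocity.
  have h3 : HasDerivAt (fun t : ℝ => κ * ((κ + t ^ 2 * form κ Y Y) * (1 + t ^ 2 * form κ X X) -
      (t ^ 2 * form κ Y X) ^ 2)) 0 0 := by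
    have hp : HasDerivAt (fun t : ℝ => t ^ 2) 0 0 := by simpa using hasDerivAt_pow 2 (0 : ℝ)
    have := ((((hp.mul_const (form κ Y Y)).const_add κ).mul
      ((hp.mul_const (form κ X X)).const_add 1)).sub
      ((hp.mul_const (form κ Y X)).pow 2)).const_mul κ
    simpa using this
  have h4 := (h3.sqrt (by simp [h.sq])).inv (by simp [h.sq])
  have h5 : HasDerivAt (fun t : ℝ => wedge a b + t • (wedge a X + wedge b Y) - t ^ 2 • wedge Y X)
      (wedge a X + wedge b Y) 0 := by
    have hp : HasDerivAt (fun t : ℝ => t ^ 2) 0 0 := by simpa using hasDerivAt_pow 2 (0 : ℝ)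
    exact ((((hasDerivAt_id (0 : ℝ)).smul_const (wedge a X + wedge b Y)).const_add
      (wedge a b)).sub (hp.smul_const (wedge Y X))).congr_deriv (by simp)
  exact (h4.smul h5).congr_deriv (by simp [h.sq])

end Normalization

/-! ### Realizing prescribed velocities by variations of the Gauss map -/

section Variation

variable {n : ℕ} {S : Type*} [TopologicalSpace S] [ChartedSpace (EuclideanSpace ℝ (Fin n)) S]
  [IsManifold (𝓡 n) ∞ S] {κ : ℝ} {φ N : S → Amb n}

/-- Every compactly supported tangential field along the Gauss map is the velocity of a variation
through oriented geodesics. -/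
theorem exists_variation_gaussMap (hκ : κ * κ = 1) (h : IsHypersurface κ φ N) {W : S → Biv n}
    (hW : ContMDiff (𝓡 n) 𝓘(ℝ, Biv n) ∞ W) (hT : ∀ x, IsTangent κ (φ x) (N x) (W x))
    {K : Set S} (hK : IsCompact K) (hWK : ∀ x ∉ K, W x = 0) :
    ∃ (δ : ℝ) (F : ℝ → S → Biv n), 0 < δ ∧ SmoothFamily n δ F ∧
      (∀ t ∈ Ioo (-δ) δ, ∀ x, F t x ∈ geodesics κ n) ∧ F 0 = gaussMap φ N ∧
      ∀ x, HasDerivAt (fun t => F t x) (W x) 0 := by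
  set X : S → Amb n := fun x => κ • contract κ (φ x) (W x) with hX
  set Y : S → Amb n := fun x => contract κ (N x) (W x) with hY
  have hXs : ContMDiff (𝓡 n) 𝓘(ℝ, Amb n) ∞ X :=
    (contDiff_contract.const_smul κ).contMDiff.comp (h.smooth.prodMk_space hW)
  have hYs : ContMDiff (𝓡 n) 𝓘(ℝ, Amb n) ∞ Y :=
    contDiff_contract.contMDiff.comp (h.smooth_normal.prodMk_space hW)
  -- The first-order term of $(\phi-tY)\wedge(N+tX)$ is $\phi\wedge X+N\wedge Y=W$, because
  -- $-Y\wedge N=N\wedge Y$.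
  set T : ℝ × S → Amb n × Amb n := fun z => (φ z.2 - z.1 • Y z.2, N z.2 + z.1 • X z.2) with hTdef
  have hTs : ContMDiff (𝓘(ℝ, ℝ).prod (𝓡 n)) 𝓘(ℝ, Amb n × Amb n) ∞ T :=
    ((h.smooth.comp contMDiff_snd).sub (contMDiff_fst.smul (hYs.comp contMDiff_snd))).prodMk_space
      ((h.smooth_normal.comp contMDiff_snd).add (contMDiff_fst.smul (hXs.comp contMDiff_snd)))
  have hflag : ∀ x, IsFlag κ (φ x) (N x) := fun x => (h.isFrame hκ x).toIsFlag
  have hreg : ∀ x, (φ x, N x) ∈ regularPairs κ n := fun x => by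
    refine ⟨?_, ?_, (h.mem x).2⟩
    · simp [(hflag x).aa, hκ]
    · simp [metricG_wedge, (hflag x).aa, (hflag x).ab, (hflag x).bb, hκ]
  have hT0 : ∀ x, T (0, x) = (φ x, N x) := fun x => by simp [hTdef]
  obtain ⟨δ, hδ, hgood⟩ := exists_uniform_of_compact (P := fun t x => T (t, x) ∈ regularPairs κ n)
    hK (fun x _ => (hTs.continuous.tendsto (0, x)).eventually
      (isOpen_regularPairs.mem_nhds (by rw [hT0]; exact hreg x)))
    (fun t x hx => by
      have : T (t, x) = (φ x, N x) := by
        simp [hTdef, hX, hY, hWK x hx, contract_zero]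
      rw [this]
      exact hreg x)
  refine ⟨δ, fun t x => normWedge κ (T (t, x)), hδ, fun z hz => ?_, fun t ht x =>
    normWedge_mem hκ (hgood t ht x), ?_, fun x => ?_⟩
  · exact ((contDiffAt_normWedge (hgood z.1 hz.1 z.2)).contMDiffAt.comp z
      hTs.contMDiffAt).contMDiffWithinAt
  · funext x
    simp [hT0, normWedge, metricG_wedge, (hflag x).aa, (hflag x).ab, (hflag x).bb, hκ, gaussMap]
  · obtain ⟨h1, h2, h3, h4, h5⟩ := (hT x).contract_spec (hflag x)
    have h6 := (hflag x).hasDerivAt_normWedge h1 h2 h3 h4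
    rw [← h5] at h6
    exact h6

/-- The Hamiltonian variations of the Gauss map with a given Hamiltonian exist. -/
theorem exists_hamiltonianVariation {q : Biv n → Biv n → Biv n → ℝ} {J : Biv n → Biv n → Biv n}
    (hG : IsGeodesicStructure κ q J) (hκ : κ * κ = 1) (h : IsHypersurface κ φ N)
    (h0 : DetNeZero n q (gaussMap φ N)) {u : S → ℝ} (hu : ContMDiff (𝓡 n) 𝓘(ℝ, ℝ) ∞ u)
    (hc : HasCompactSupport u) :
    ∃ (δ : ℝ) (F : ℝ → S → Biv n), IsHamiltonianVariation κ q J (gaussMap φ N) u δ F ∧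
      ∀ x, HasDerivAt (fun t => F t x) (hamField q J (gaussMap φ N) u x) 0 := by
  obtain ⟨δ, F, hδ, hF, hmem, hF0, hd⟩ := exists_variation_gaussMap hκ h
    (contMDiff_hamField hG h.smooth_gaussMap h0 hu) (hamField_tangent hG hκ h h0 u) hc
    fun x hx => hamField_eq_zero hG hx
  refine ⟨δ, F, ⟨hδ, hF, hmem, hF0, hu, hc, fun x => ?_⟩, hd⟩
  obtain ⟨g, hg, hgW⟩ := exists_gradient hG h0 u x
  refine ⟨g, hg, ?_⟩
  have := hd x
  rw [hgW] at this
  exact this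

end Variation

end OrientedGeodesics
end

noncomputable section

namespace OrientedGeodesics

open Filter Topology

/-! ## Variations of hypersurfaces and of their Gauss maps -/

section GaussVariation

variable {n : ℕ} {S : Type*} [TopologicalSpace S] [ChartedSpace (EuclideanSpace ℝ (Fin n)) S]
  [IsManifold (𝓡 n) ∞ S] {κ : ℝ} {φ N : S → Amb n} {C : Set S} {δ : ℝ} {φt Nt : ℝ → S → Amb n}

theorem IsHypersurface.detNeZero (hκ : κ * κ = 1) (h : IsHypersurface κ φ N) :
    DetNeZero n (fun _ => form κ) φ := by
  refine detNeZero_of_nondegenerate smoothBilin_form fun x v hv => ?_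
  have hf := h.isFrame hκ x
  have h1 : dE (n := n) φ x v = 0 := hf.eq_zero (hf.aP v) (hf.bP v) fun w => by
    rw [form_comm]
    exact hv w
  exact hf.inj (h1.trans (map_zero _).symm)

omit [IsManifold (𝓡 n) ∞ S] in
theorem IsVariation.smoothFamily (h : IsVariation κ φ N C δ φt Nt) : SmoothFamily n δ φt := h.smooth

omit [IsManifold (𝓡 n) ∞ S] in
theorem IsVariation.smoothFamily_normal (h : IsVariation κ φ N C δ φt Nt) :
    SmoothFamily n δ Nt := h.smooth_normal

omit [IsManifold (𝓡 n) ∞ S] in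
theorem IsVariation.smoothFamily_gaussMap (h : IsVariation κ φ N C δ φt Nt) :
    SmoothFamily n δ fun t => gaussMap (φt t) (Nt t) :=
  contMDiff_bilin isBoundedBilinearMap_wedge h.smooth h.smooth_normal

omit [IsManifold (𝓡 n) ∞ S] in
theorem IsVariation.hypersurface_zero (h : IsVariation κ φ N C δ φt Nt) : IsHypersurface κ φ N := by
  have := h.hypersurface 0 (zero_mem_Ioo h.pos)
  rwa [h.initial, h.initial_normal] at this

omit [IsManifold (𝓡 n) ∞ S] in
theorem IsVariation.eventually (h : IsVariation κ φ N C δ φt Nt) :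
    ∀ᶠ t in 𝓝 (0 : ℝ), IsHypersurface κ (φt t) (Nt t) := by
  filter_upwards [isOpen_Ioo.mem_nhds (zero_mem_Ioo h.pos)] with t ht
  exact h.hypersurface t ht

theorem hasDerivAt_form {f g : ℝ → Amb n} {f' g' : Amb n} {t : ℝ} (hf : HasDerivAt f f' t)
    (hg : HasDerivAt g g' t) :
    HasDerivAt (fun s => form κ (f s) (g s)) (form κ (f t) g' + form κ f' (g t)) t :=
  (isBoundedBilinearMap_form.hasFDerivAt (f t, g t)).comp_hasDerivAt
    (f := fun s => (f s, g s)) t (hf.prodMk hg)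

theorem hasDerivAt_wedge {f g : ℝ → Amb n} {f' g' : Amb n} {t : ℝ} (hf : HasDerivAt f f' t)
    (hg : HasDerivAt g g' t) :
    HasDerivAt (fun s => wedge (f s) (g s)) (wedge (f t) g' + wedge f' (g t)) t :=
  (isBoundedBilinearMap_wedge.hasFDerivAt (f t, g t)).comp_hasDerivAt
    (f := fun s => (f s, g s)) t (hf.prodMk hg)

/-- The infinitesimal constraints of a variation of a hypersurface with its normal field. -/
theorem IsVariation.velocity_spec (h : IsVariation κ φ N C δ φt Nt) (x : S) :
    form κ (φ x) (velocity φt x) = 0 ∧ form κ (N x) (velocity Nt x) = 0 ∧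
      form κ (φ x) (velocity Nt x) = -form κ (velocity φt x) (N x) ∧
      ∀ v : EuclideanSpace ℝ (Fin n), form κ (velocity Nt x) (dE φ x v) =
        -form κ (N x) (dE (velocity φt) x v) := by
  have h1 := h.smoothFamily.hasDerivAt_velocity h.pos x
  have h2 := h.smoothFamily_normal.hasDerivAt_velocity h.pos x
  have key : ∀ {g : ℝ → ℝ} {g' c : ℝ}, HasDerivAt g g' 0 → (∀ᶠ t in 𝓝 (0 : ℝ), g t = c) →
      g' = 0 := fun hg hc =>
    hg.unique ((hasDerivAt_const (0 : ℝ) _).congr_of_eventuallyEq hc)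
  have e1 := key (hasDerivAt_form (κ := κ) h1 h1) (h.eventually.mono fun t ht => (ht.mem x).1)
  have e2 := key (hasDerivAt_form (κ := κ) h2 h2) (h.eventually.mono fun t ht => ht.normal_unit x)
  have e3 := key (hasDerivAt_form (κ := κ) h1 h2)
    (h.eventually.mono fun t ht => ht.normal_tangent x)
  rw [h.initial] at e1 e3
  rw [h.initial_normal] at e2 e3
  rw [form_comm (velocity φt x)] at e1
  rw [form_comm (velocity Nt x)] at e2
  refine ⟨by linarith, by linarith, by linarith, fun v => ?_⟩
  have h3 := h.smoothFamily.hasDerivAt_diff h.pos x v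
  have e4 := key (hasDerivAt_form (κ := κ) h2 h3)
    (h.eventually.mono fun t ht => ht.normal_orthogonal x v)
  rw [h.initial, h.initial_normal] at e4
  exact eq_neg_of_add_eq_zero_right e4

theorem IsVariation.velocity_gaussMap (h : IsVariation κ φ N C δ φt Nt) (x : S) :
    velocity (fun t => gaussMap (φt t) (Nt t)) x =
      wedge (φ x) (velocity Nt x) + wedge (velocity φt x) (N x) := by
  have h1 := h.smoothFamily.hasDerivAt_velocity h.pos x
  have h2 := h.smoothFamily_normal.hasDerivAt_velocity h.pos x
  have h3 := hasDerivAt_wedge h1 h2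
  rw [h.initial, h.initial_normal] at h3
  exact h3.deriv

/-- The normal component of the velocity of a variation. -/
def normalSpeed (κ : ℝ) (φt : ℝ → S → Amb n) (N : S → Amb n) (x : S) : ℝ :=
  form κ (velocity φt x) (N x)

theorem IsVariation.contMDiff_normalSpeed (h : IsVariation κ φ N C δ φt Nt) :
    ContMDiff (𝓡 n) 𝓘(ℝ, ℝ) ∞ (normalSpeed κ φt N) :=
  contMDiffOn_univ.1 (contMDiff_bilin isBoundedBilinearMap_form
    (h.smoothFamily.contMDiff_velocity h.pos).contMDiffOn
      h.hypersurface_zero.smooth_normal.contMDiffOn)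

/-- The velocity of the Gauss maps of a variation is tangential to the space of geodesics and is
determined, modulo fields tangential to the Gauss map, by the normal speed. -/
theorem IsVariation.gauss_velocity (hκ : κ * κ = 1) (h : IsVariation κ φ N C δ φt Nt) (x : S) :
    IsTangent κ (φ x) (N x) (velocity (fun t => gaussMap (φt t) (Nt t)) x) ∧
      ∀ v : EuclideanSpace ℝ (Fin n),
        symplectic κ (gaussMap φ N x) (dE (n := n) (gaussMap φ N) x v)
          (velocity (fun t => gaussMap (φt t) (Nt t)) x) =
        -κ * dE (n := n) (normalSpeed κ φt N) x v := by
  have hyp := h.hypersurface_zero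
  have hf := hyp.isFrame hκ x
  obtain ⟨e1, e2, e3, e4⟩ := h.velocity_spec x
  set p := velocity φt x with hp
  set m := velocity Nt x with hm
  set u := normalSpeed κ φt N x with hu
  have hu' : form κ p (N x) = u := rfl
  -- Multiples of $\phi$ in the first factor and of $N$ in the second do not change the wedge
  -- products. They are chosen to make the two components orthogonal to $\phi$ and $N$, as a tangent
  -- vector requires.
  have hW : velocity (fun t => gaussMap (φt t) (Nt t)) x =
      wedge (φ x) (m + (κ * u) • φ x) + wedge (N x) (-p + u • N x) := by
    rw [h.velocity_gaussMap, wedge_add_right, wedge_add_right, wedge_smul_right, wedge_self,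
      wedge_smul_right, wedge_self, ← hp, ← hm, wedge_swap p]
    simp
  have t1 : form κ (φ x) (m + (κ * u) • φ x) = 0 := by
    rw [form_add_right, form_smul_right, e3, hf.aa, hu']
    linear_combination u * hκ
  have t2 : form κ (N x) (m + (κ * u) • φ x) = 0 := by
    rw [form_add_right, form_smul_right, e2, hf.ba]
    ring
  have t3 : form κ (φ x) (-p + u • N x) = 0 := by
    rw [form_add_right, form_smul_right, form_neg_right, e1, hf.ab]
    ring
  have t4 : form κ (N x) (-p + u • N x) = 0 := by
    rw [form_add_right, form_smul_right, form_neg_right, form_comm, hu', hf.bb]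
    ring
  refine ⟨⟨_, _, t1, t2, t3, t4, hW⟩, fun v => ?_⟩
  have h5 : dE (n := n) (normalSpeed κ φt N) x v =
      form κ p (dE (n := n) N x v) + form κ (dE (n := n) (velocity φt) x v) (N x) :=
    diff_bilin (isBoundedBilinearMap_form (κ := κ))
      ((h.smoothFamily.contMDiff_velocity h.pos).mdifferentiableAt (by simp)) (hyp.mdiff_normal x) v
  have h6 := e4 v
  rw [form_comm (N x)] at h6
  rw [hyp.dE_gaussMap, gaussMap, hW, hf.symplectic_gaussDiff v t1 t2 t3 t4, h5, form_add_right,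
    form_add_right, form_smul_right, form_smul_right, form_neg_right, form_comm _ (N x), hf.bQ,
    form_comm _ (φ x), hf.aP, form_comm _ m, h6, form_comm p]
  ring

/-- Only $\phi_t$ is assumed to be fixed outside $C$. The velocity of the normal vanishes there as
well, since the differentiated constraints determine it from the velocity of $\phi_t$ and its
differential. -/
theorem IsVariation.velocity_eq_zero [T2Space S] (hκ : κ * κ = 1)
    (h : IsVariation κ φ N C δ φt Nt) (hC : IsCompact C) {x : S} (hx : x ∉ C) :
    velocity φt x = 0 ∧ velocity Nt x = 0 := by
  have h0 : ∀ y ∉ C, velocity φt y = 0 := fun y hy => by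
    have : (fun t => φt t y) =ᶠ[𝓝 0] fun _ => φ y := by
      filter_upwards [isOpen_Ioo.mem_nhds (zero_mem_Ioo h.pos)] with t ht
      exact h.fixed t ht y hy
    rw [velocity, this.deriv_eq, deriv_const]
  have h1 : velocity φt =ᶠ[𝓝 x] fun _ => 0 := by
    filter_upwards [hC.isClosed.isOpen_compl.mem_nhds hx] with y hy
    exact h0 y hy
  refine ⟨h0 x hx, ?_⟩
  obtain ⟨e1, e2, e3, e4⟩ := h.velocity_spec x
  refine (h.hypersurface_zero.isFrame hκ x).eq_zero ?_ e2 fun v => ?_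
  · rw [e3, h0 x hx, form_zero_left, neg_zero]
  · have h2 : dE (n := n) (velocity φt) x v = 0 := by
      have h3 : mfderiv (𝓡 n) 𝓘(ℝ, Amb n) (fun _ : S => (0 : Amb n)) x = 0 := mfderiv_const
      have h4 := h1.mfderiv_eq (I := 𝓡 n) (I' := 𝓘(ℝ, Amb n))
      exact congrArg (fun L => L v) (h4.trans h3)
    rw [form_comm, e4, h2, form_zero_right, neg_zero]

theorem IsVariation.gauss_velocity_eq_zero [T2Space S] (hκ : κ * κ = 1)
    (h : IsVariation κ φ N C δ φt Nt) (hC : IsCompact C) {x : S} (hx : x ∉ C) :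
    velocity (fun t => gaussMap (φt t) (Nt t)) x = 0 := by
  rw [h.velocity_gaussMap, (h.velocity_eq_zero hκ hC hx).1, (h.velocity_eq_zero hκ hC hx).2]
  funext i j
  simp [wedge]

end GaussVariation

end OrientedGeodesics
end

noncomputable section

namespace OrientedGeodesics

open Filter Topology

/-! ## Normal variations of hypersurfaces -/

section NormalVec

variable {n : ℕ} {κ : ℝ}

/-- The component of `b` orthogonal to the position and to the tangent vectors of a jet. -/
def normalVec (κ : ℝ) (b : Amb n) (z : Jet n (Amb n)) : Amb n :=
  b - (κ * form κ b z.1) • z.1 - gradVec (fun _ => form κ) z fun j => form κ b (z.2 j)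

/-- The normalization of `normalVec`. -/
def unitNormal (κ : ℝ) (b : Amb n) (z : Jet n (Amb n)) : Amb n :=
  (Real.sqrt (form κ (normalVec κ b z) (normalVec κ b z)))⁻¹ • normalVec κ b z

/-- The vectors and jets to which `unitNormal` applies. -/
def RegularJet (κ : ℝ) (b : Amb n) (z : Jet n (Amb n)) : Prop :=
  (jetGram (fun _ => form κ) z).det ≠ 0 ∧ 0 < form κ (normalVec κ b z) (normalVec κ b z)

/-- The projection onto the complement of the tangent space does not depend on the frame, because
`gradVec` does not. -/
theorem normalVec_jetAct {A : Matrix (Fin n) (Fin n) ℝ} (hA : A.det ≠ 0) (b : Amb n)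
    {z : Jet n (Amb n)} (hz : (jetGram (fun _ => form κ) z).det ≠ 0) :
    normalVec κ b (jetAct A z) = normalVec κ b z := by
  have h1 : (fun j => form κ b ((jetAct A z).2 j)) =
      (jetAct A ((0 : ℝ), fun j => form κ b (z.2 j))).2 := by
    funext j
    rw [jetAct_snd, jetAct_snd, smoothBilin_form.sum_right (p := (0 : Amb n))]
    simp only [form_smul_right, smul_eq_mul]
  rw [normalVec, h1, gradVec_jetAct smoothBilin_form hA hz, jetAct_fst, normalVec]

theorem regularJet_jetAct {A : Matrix (Fin n) (Fin n) ℝ} (hA : A.det ≠ 0) {b : Amb n}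
    {z : Jet n (Amb n)} (hz : RegularJet κ b z) : RegularJet κ b (jetAct A z) := by
  refine ⟨?_, ?_⟩
  · rw [det_jetGram_jetAct smoothBilin_form]
    exact mul_ne_zero (pow_ne_zero _ hA) hz.1
  · rw [normalVec_jetAct hA b hz.1]
    exact hz.2

theorem contDiffAt_normalVec {b : Amb n} {z : Jet n (Amb n)}
    (hz : (jetGram (fun _ => form κ) z).det ≠ 0) :
    ContDiffAt ℝ ∞ (fun p : Amb n × Jet n (Amb n) => normalVec κ p.1 p.2) (b, z) := by
  have hf : ContDiff ℝ ∞ fun p : Amb n × Amb n => form κ p.1 p.2 :=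
    isBoundedBilinearMap_form.contDiff
  have h1 : ContDiff ℝ ∞ fun p : Amb n × Jet n (Amb n) => form κ p.1 p.2.1 :=
    hf.comp (contDiff_fst.prodMk (contDiff_fst.comp contDiff_snd))
  have h2 : ContDiff ℝ ∞ fun p : Amb n × Jet n (Amb n) => fun j => form κ p.1 (p.2.2 j) :=
    contDiff_pi.2 fun j => hf.comp (contDiff_fst.prodMk
      ((contDiff_apply ℝ (Amb n) j).comp (contDiff_snd.comp contDiff_snd)))
  refine ContDiffAt.sub (ContDiffAt.sub contDiffAt_fst
    (ContDiffAt.smul (contDiffAt_const.mul h1.contDiffAt) ?_)) ?_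
  · exact ((contDiff_fst.comp contDiff_snd).contDiffAt)
  · exact OrientedGeodesics.ContDiffAt.gradVec smoothBilin_form contDiffAt_snd h2.contDiffAt hz

theorem contDiffAt_unitNormal {b : Amb n} {z : Jet n (Amb n)} (hz : RegularJet κ b z) :
    ContDiffAt ℝ ∞ (fun p : Amb n × Jet n (Amb n) => unitNormal κ p.1 p.2) (b, z) := by
  have h1 := contDiffAt_normalVec (b := b) hz.1
  have h2 : ContDiffAt ℝ ∞ (fun p : Amb n × Jet n (Amb n) =>
      form κ (normalVec κ p.1 p.2) (normalVec κ p.1 p.2)) (b, z) :=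
    ContDiffAt.comp (f := fun p : Amb n × Jet n (Amb n) => (normalVec κ p.1 p.2, normalVec κ p.1 p.2))
      (g := fun p : Amb n × Amb n => form κ p.1 p.2) (b, z)
      isBoundedBilinearMap_form.contDiff.contDiffAt (h1.prodMk h1)
  exact ((h2.sqrt hz.2.ne').inv (Real.sqrt_pos.2 hz.2).ne').smul h1

theorem ContDiffAt.unitNormal {X : Type*} [NormedAddCommGroup X] [NormedSpace ℝ X]
    {f : X → Amb n × Jet n (Amb n)} {x : X} (hf : ContDiffAt ℝ ∞ f x)
    (h : RegularJet κ (f x).1 (f x).2) :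
    ContDiffAt ℝ ∞ (fun y => OrientedGeodesics.unitNormal κ (f y).1 (f y).2) x :=
  ContDiffAt.comp (f := f)
    (g := fun p : Amb n × Jet n (Amb n) => OrientedGeodesics.unitNormal κ p.1 p.2) x
    (contDiffAt_unitNormal h) hf

theorem eventually_regularJet {b : Amb n} {z : Jet n (Amb n)} (hz : RegularJet κ b z) :
    ∀ᶠ p : Amb n × Jet n (Amb n) in 𝓝 (b, z), RegularJet κ p.1 p.2 := by
  have h1 := (contDiffAt_normalVec (b := b) hz.1).continuousAt
  have h2 : ContinuousAt (fun p : Amb n × Jet n (Amb n) =>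
      form κ (normalVec κ p.1 p.2) (normalVec κ p.1 p.2)) (b, z) :=
    ContinuousAt.comp (f := fun p : Amb n × Jet n (Amb n) =>
      (normalVec κ p.1 p.2, normalVec κ p.1 p.2)) (g := fun p : Amb n × Amb n => form κ p.1 p.2)
      isBoundedBilinearMap_form.continuous.continuousAt (h1.prodMk h1)
  have h3 : Continuous fun p : Amb n × Jet n (Amb n) => (jetGram (fun _ => form κ) p.2).det :=
    (contDiff_det_jetGram smoothBilin_form).continuous.comp continuous_snd
  exact (h3.continuousAt.eventually_ne hz.1).and (h2.eventually (lt_mem_nhds hz.2))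

variable {b : Amb n} {z : Jet n (Amb n)}

/-- Subtracting `gradVec` removes the pairings with the frame, and subtracting $\kappa\langle
b,z\rangle z$ removes the component along the position, because $\langle z,z\rangle=\kappa$ and
$\kappa^2=1$. -/
theorem normalVec_orthogonal (hκ : κ * κ = 1) (h0 : form κ z.1 z.1 = κ)
    (h1 : ∀ j, form κ z.1 (z.2 j) = 0) (hz : (jetGram (fun _ => form κ) z).det ≠ 0) :
    form κ z.1 (normalVec κ b z) = 0 ∧ ∀ j, form κ (normalVec κ b z) (z.2 j) = 0 := by
  refine ⟨?_, fun j => ?_⟩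
  · have h2 : form κ z.1 (gradVec (fun _ => form κ) z fun j => form κ b (z.2 j)) = 0 := by
      rw [gradVec, smoothBilin_form.sum_right (p := (0 : Amb n))]
      simp [form_smul_right, h1]
    rw [normalVec, form_sub_right, form_sub_right, form_smul_right, h0, h2, form_comm z.1]
    linear_combination (-form κ b z.1) * hκ
  · rw [normalVec, form_sub_left, form_sub_left, form_smul_left, h1,
      gradVec_spec (q := fun _ : Amb n => form κ) smoothBilin_form hz]
    ring

theorem normalVec_eq (h0 : form κ z.1 b = 0) (h1 : ∀ j, form κ b (z.2 j) = 0) :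
    normalVec κ b z = b := by
  rw [normalVec, form_comm, h0]
  have h2 : (fun _ : Fin n => (0 : ℝ)) = 0 := rfl
  simp [h1, gradVec, gradCoord, h2]

theorem unitNormal_eq (h0 : form κ z.1 b = 0) (h1 : ∀ j, form κ b (z.2 j) = 0)
    (hb : form κ b b = 1) : unitNormal κ b z = b := by
  simp [unitNormal, normalVec_eq h0 h1, hb]

end NormalVec

/-! ### Construction of the normal variation with prescribed speed -/

section NormalVariation

variable {n : ℕ} {S : Type*} [TopologicalSpace S] [ChartedSpace (EuclideanSpace ℝ (Fin n)) S]
  [IsManifold (𝓡 n) ∞ S] {κ : ℝ} {φ N : S → Amb n}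

/-- The normal variation with speed `w`. -/
def normalPush (κ : ℝ) (φ N : S → Amb n) (w : S → ℝ) (t : ℝ) (x : S) : Amb n :=
  (Real.sqrt (1 + κ * (t * w x) ^ 2))⁻¹ • (φ x + (t * w x) • N x)

/-- The unit normal of the normal variation. -/
def normalPushNormal (κ : ℝ) (φ N : S → Amb n) (w : S → ℝ) (t : ℝ) (x : S) : Amb n :=
  unitNormal κ (N x) (jet (n := n) (normalPush κ φ N w t) x)

omit [TopologicalSpace S] [ChartedSpace (EuclideanSpace ℝ (Fin n)) S] [IsManifold (𝓡 n) ∞ S] in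
theorem normalPush_zero (w : S → ℝ) : normalPush κ φ N w 0 = φ := by
  funext x
  simp [normalPush]

omit [ChartedSpace (EuclideanSpace ℝ (Fin n)) S] [IsManifold (𝓡 n) ∞ S] in
theorem normalPush_eventuallyEq {w : S → ℝ} {x : S} (hx : x ∉ tsupport w) (t : ℝ) :
    normalPush κ φ N w t =ᶠ[𝓝 x] φ := by
  filter_upwards [notMem_tsupport_iff_eventuallyEq.1 hx] with y hy
  simp [normalPush, hy]

omit [IsManifold (𝓡 n) ∞ S] in
theorem IsHypersurface.unitNormal_eq (h : IsHypersurface κ φ N) (x : S) :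
    unitNormal κ (N x) (jet (n := n) φ x) = N x :=
  OrientedGeodesics.unitNormal_eq (h.normal_tangent x) (fun _ => h.normal_orthogonal x _)
    (h.normal_unit x)

theorem IsHypersurface.regularJet (hκ : κ * κ = 1) (h : IsHypersurface κ φ N) (x : S) :
    RegularJet κ (N x) (jet (n := n) φ x) := by
  refine ⟨h.detNeZero hκ x, ?_⟩
  rw [normalVec_eq (h.normal_tangent x) fun _ => h.normal_orthogonal x _, h.normal_unit]
  exact one_pos

-- Here $\langle\phi+rN,\phi+rN\rangle=\kappa+r^2=\kappa(1+\kappa r^2)$, which explains the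
-- normalizing factor.
omit [IsManifold (𝓡 n) ∞ S] in
theorem form_normalPush (h : IsHypersurface κ φ N) {w : S → ℝ} {t : ℝ} {x : S}
    (hs : 0 < 1 + κ * (t * w x) ^ 2) (hκ : κ * κ = 1) :
    form κ (normalPush κ φ N w t x) (normalPush κ φ N w t x) = κ := by
  have h1 := Real.sq_sqrt hs.le
  have h2 := (Real.sqrt_pos.2 hs).ne'
  rw [normalPush]
  generalize t * w x = r at *
  simp only [ form_smul_left, form_smul_right, form_add_left, form_add_right,
    (h.mem x).1, h.normal_tangent x, h.normal_unit x, form_comm (N x) (φ x)]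
  field_simp
  rw [h1]
  linear_combination (-r ^ 2) * hκ

omit [TopologicalSpace S] [ChartedSpace (EuclideanSpace ℝ (Fin n)) S] [IsManifold (𝓡 n) ∞ S] in
theorem hasDerivAt_normalPush (w : S → ℝ) (x : S) :
    HasDerivAt (fun t => normalPush κ φ N w t x) (w x • N x) 0 := by
  have h1 : HasDerivAt (fun t : ℝ => t * w x) (w x) 0 := by
    simpa using (hasDerivAt_id (0 : ℝ)).mul_const (w x)
  have h2 : HasDerivAt (fun t : ℝ => 1 + κ * (t * w x) ^ 2) 0 0 :=
    (((h1.pow 2).const_mul κ).const_add 1).congr_deriv (by simp)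
  have h3 := (h2.sqrt (by simp)).inv (by simp)
  exact (h3.smul ((h1.smul_const (N x)).const_add (φ x))).congr_deriv (by simp)

/-- Move along the normal and rescale back to the space form; then project the old normal onto the
new normal line and normalize it. The explicit projection makes the new normals smooth in time and
keeps the initial one equal to $N$. The time interval is shrunk twice by compactness. -/
theorem exists_normalVariation (hκ : κ * κ = 1) (h : IsHypersurface κ φ N) {w : S → ℝ}
    (hw : ContMDiff (𝓡 n) 𝓘(ℝ, ℝ) ∞ w) (hc : HasCompactSupport w) :
    ∃ (δ : ℝ) (φt Nt : ℝ → S → Amb n), IsVariation κ φ N (tsupport w) δ φt Nt ∧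
      ∀ x, velocity φt x = w x • N x := by
  set φt := normalPush κ φ N w with hφt
  have hr : ContMDiff (𝓘(ℝ, ℝ).prod (𝓡 n)) 𝓘(ℝ, ℝ) ∞ fun z : ℝ × S => z.1 * w z.2 :=
    contMDiff_fst.mul (hw.comp contMDiff_snd)
  set T : ℝ × S → ℝ × Amb n := fun z => (z.1 * w z.2, φ z.2 + (z.1 * w z.2) • N z.2) with hT
  have hTs : ContMDiff (𝓘(ℝ, ℝ).prod (𝓡 n)) 𝓘(ℝ, ℝ × Amb n) ∞ T :=
    hr.prodMk_space ((h.smooth.comp contMDiff_snd).add (hr.smul (h.smooth_normal.comp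
      contMDiff_snd)))
  have hT0 : ∀ t x, t * w x = 0 → T (t, x) = (0, φ x) := fun t x h0 => by simp [hT, h0]
  -- The first radius: the square root is defined and, in the hyperbolic case, the point stays on
  -- the upper sheet.
  set O : Set (ℝ × Amb n) := {p | 0 < 1 + κ * p.1 ^ 2 ∧ (κ = -1 → 0 < p.2 (Fin.last (n + 1)))}
    with hO
  have hOo : IsOpen O := by
    refine IsOpen.inter (isOpen_lt (f := fun _ : ℝ × Amb n => (0 : ℝ))
      (g := fun p : ℝ × Amb n => 1 + κ * p.1 ^ 2) continuous_const (by fun_prop)) ?_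
    by_cases hκ1 : κ = -1
    · simp only [hκ1, forall_const]
      exact isOpen_lt continuous_const (by fun_prop)
    · have : {p : ℝ × Amb n | κ = -1 → 0 < p.2 (Fin.last (n + 1))} = univ := by simp [hκ1]
      exact (congrArg IsOpen this).mpr isOpen_univ
  have hO0 : ∀ x, (0, φ x) ∈ O := fun x => ⟨by simp, (h.mem x).2⟩
  obtain ⟨δ₁, hδ₁, hg₁⟩ := exists_uniform_of_compact (P := fun t x => T (t, x) ∈ O) hc.isCompact
    (fun x _ => (hTs.continuous.tendsto (0, x)).eventually
      (hOo.mem_nhds (by rw [hT0 0 x (zero_mul _)]; exact hO0 x)))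
    (fun t x hx => by rw [hT0 t x (by rw [image_eq_zero_of_notMem_tsupport hx, mul_zero])]; exact hO0 x)
  have hφs : SmoothFamily n δ₁ φt := fun z hz => by
    have h1 : ContDiffAt ℝ ∞ (fun p : ℝ × Amb n => (Real.sqrt (1 + κ * p.1 ^ 2))⁻¹ • p.2) (T z) := by
      have h2 := (hg₁ z.1 hz.1 z.2).1
      have h3 : ContDiffAt ℝ ∞ (fun p : ℝ × Amb n => 1 + κ * p.1 ^ 2) (T z) := by fun_prop
      exact ((h3.sqrt h2.ne').inv (Real.sqrt_pos.2 h2).ne').smul contDiffAt_snd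
    exact (h1.contMDiffAt.comp z hTs.contMDiffAt).contMDiffWithinAt
  have hφ0 : φt 0 = φ := normalPush_zero w
  have hjet : ∀ x ∉ tsupport w, ∀ t, jet (n := n) (φt t) x = jet (n := n) φ x := fun x hx t =>
    jet_congr (normalPush_eventuallyEq hx t)
  have hjetC : ∀ t ∈ Ioo (-δ₁) δ₁, ∀ x₀ : S, ContDiffAt ℝ ∞
      (fun z : ℝ × EuclideanSpace ℝ (Fin n) =>
        (N ((chartAt (EuclideanSpace ℝ (Fin n)) x₀).symm z.2),
          jetIn (chartAt (EuclideanSpace ℝ (Fin n)) x₀) (φt z.1) z.2))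
      (t, chartAt (EuclideanSpace ℝ (Fin n)) x₀ x₀) := fun t ht x₀ => by
    set e := chartAt (EuclideanSpace ℝ (Fin n)) x₀
    have he : e ∈ atlas (EuclideanSpace ℝ (Fin n)) S := chart_mem_atlas _ x₀
    have hx : e x₀ ∈ e.target := mem_chart_target _ x₀
    refine ContDiffAt.prodMk ?_ ((hφs.contDiffOn_jetIn he).contDiffAt
      ((isOpen_Ioo.prod e.open_target).mem_nhds ⟨ht, hx⟩))
    exact ContDiffAt.comp (g := N ∘ e.symm) (t, e x₀)
      ((contDiffOn_comp_symm he h.smooth_normal).contDiffAt (e.open_target.mem_nhds hx))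
      contDiffAt_snd
  have hjetA : ∀ x₀ : S, ∀ x ∈ (chartAt (EuclideanSpace ℝ (Fin n)) x₀).source,
      ∀ t ∈ Ioo (-δ₁) δ₁, ∃ A : Matrix (Fin n) (Fin n) ℝ, A.det ≠ 0 ∧
        jet (n := n) (φt t) x = jetAct A (jetIn (chartAt (EuclideanSpace ℝ (Fin n)) x₀) (φt t)
          (chartAt (EuclideanSpace ℝ (Fin n)) x₀ x)) := fun x₀ x hx t ht =>
    ⟨_, det_chartMat_ne_zero (chart_mem_atlas _ x₀) hx,
      jet_eq_jetAct (chart_mem_atlas _ x₀) hx ((hφs.contMDiff ht).mdifferentiableAt (by simp))⟩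
  have hmap : ∀ (t : ℝ) (x₀ : S), Tendsto (fun z : ℝ × S =>
      (z.1, chartAt (EuclideanSpace ℝ (Fin n)) x₀ z.2)) (𝓝 (t, x₀))
      (𝓝 (t, chartAt (EuclideanSpace ℝ (Fin n)) x₀ x₀)) := fun t x₀ => by
    refine (continuousAt_fst.prodMk (ContinuousAt.comp (g := chartAt _ x₀) ?_ continuousAt_snd))
    exact (chartAt _ x₀).continuousAt (mem_chart_source _ x₀)
  have hnear : ∀ t ∈ Ioo (-δ₁) δ₁, ∀ x₀ : S, ∀ᶠ z : ℝ × S in 𝓝 (t, x₀), z.1 ∈ Ioo (-δ₁) δ₁ ∧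
      z.2 ∈ (chartAt (EuclideanSpace ℝ (Fin n)) x₀).source := fun t ht x₀ =>
    (isOpen_Ioo.prod (chartAt (EuclideanSpace ℝ (Fin n)) x₀).open_source).mem_nhds
      ⟨ht, mem_chart_source _ x₀⟩
  -- The second radius: the first fundamental form stays non-degenerate and the projection of $N$
  -- keeps positive square.
  obtain ⟨δ₂, hδ₂, hg₂⟩ := exists_uniform_of_compact
    (P := fun t x => t ∈ Ioo (-δ₁) δ₁ → RegularJet κ (N x) (jet (n := n) (φt t) x)) hc.isCompact
    (fun x₀ _ => by
      have h0 := zero_mem_Ioo hδ₁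
      have h1 : RegularJet κ (N x₀) (jetIn (chartAt (EuclideanSpace ℝ (Fin n)) x₀) (φt 0)
          (chartAt (EuclideanSpace ℝ (Fin n)) x₀ x₀)) := by
        rw [← jet_eq_jetIn_chartAt ((hφs.contMDiff h0).mdifferentiableAt (by simp)), hφ0]
        exact h.regularJet hκ x₀
      have h2 : ContinuousAt _ _ := (hjetC 0 h0 x₀).continuousAt
      have h3 := (hmap 0 x₀).eventually (h2.eventually (eventually_regularJet (by
        simpa only [(chartAt _ x₀).left_inv (mem_chart_source _ x₀)] using h1)))
      filter_upwards [h3, hnear 0 h0 x₀] with z hz hz' ht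
      obtain ⟨A, hA, hAj⟩ := hjetA x₀ z.2 hz'.2 z.1 hz'.1
      rw [(chartAt _ x₀).left_inv hz'.2] at hz
      rw [hAj]
      exact regularJet_jetAct hA hz)
    (fun t x hx _ => by rw [hjet x hx]; exact h.regularJet hκ x)
  set δ := min δ₁ δ₂ with hδ
  have hδ0 : 0 < δ := lt_min hδ₁ hδ₂
  have hsub₁ : Ioo (-δ) δ ⊆ Ioo (-δ₁) δ₁ :=
    Ioo_subset_Ioo (neg_le_neg (min_le_left _ _)) (min_le_left _ _)
  have hsub₂ : Ioo (-δ) δ ⊆ Ioo (-δ₂) δ₂ :=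
    Ioo_subset_Ioo (neg_le_neg (min_le_right _ _)) (min_le_right _ _)
  have hreg : ∀ t ∈ Ioo (-δ) δ, ∀ x, RegularJet κ (N x) (jet (n := n) (φt t) x) :=
    fun t ht x => hg₂ t (hsub₂ ht) x (hsub₁ ht)
  have hφs' : SmoothFamily n δ φt := hφs.mono (prod_mono hsub₁ Subset.rfl)
  -- Smoothness is checked in one fixed chart, although `jet` uses a chart moving with the point;
  -- `normalVec_jetAct` shows that the normal is the same in both.
  have hNs : SmoothFamily n δ (normalPushNormal κ φ N w) := fun z hz => by
    obtain ⟨t, x₀⟩ := z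
    have ht := hsub₁ hz.1
    refine ContMDiffAt.contMDiffWithinAt ?_
    refine contMDiffAt_family_of_chart (f := normalPushNormal κ φ N w)
      (chart_mem_atlas (EuclideanSpace ℝ (Fin n)) x₀)
      (mem_chart_source (EuclideanSpace ℝ (Fin n)) x₀)
      (G := fun z : ℝ × EuclideanSpace ℝ (Fin n) => unitNormal κ
        (N ((chartAt (EuclideanSpace ℝ (Fin n)) x₀).symm z.2))
        (jetIn (chartAt (EuclideanSpace ℝ (Fin n)) x₀) (φt z.1) z.2)) ?_ ?_
    · have h1 := hreg t hz.1 x₀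
      rw [jet_eq_jetIn_chartAt ((hφs.contMDiff ht).mdifferentiableAt (by simp))] at h1
      have h2 := OrientedGeodesics.ContDiffAt.unitNormal (hjetC t ht x₀) (by
        simpa only [(chartAt _ x₀).left_inv (mem_chart_source _ x₀)] using h1)
      exact h2
    · have hev : ∀ᶠ z : ℝ × S in 𝓝 (t, x₀), z.1 ∈ Ioo (-δ) δ :=
        continuousAt_fst.eventually (isOpen_Ioo.mem_nhds hz.1)
      filter_upwards [hnear t ht x₀, hev] with z hz' hzδ
      obtain ⟨A, hA, hAj⟩ := hjetA x₀ z.2 hz'.2 z.1 hz'.1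
      have h1 := hreg z.1 hzδ z.2
      have h2 : (jetGram (fun _ => form κ) (jetIn (chartAt (EuclideanSpace ℝ (Fin n)) x₀) (φt z.1)
          (chartAt (EuclideanSpace ℝ (Fin n)) x₀ z.2))).det ≠ 0 := fun h0 => by
        have h3 := h1.1
        rw [hAj, det_jetGram_jetAct smoothBilin_form, h0, mul_zero] at h3
        exact h3 rfl
      rw [normalPushNormal, ← hφt, hAj, (chartAt _ x₀).left_inv hz'.2, unitNormal, unitNormal,
        normalVec_jetAct hA _ h2]
  have hflat : ∀ t ∈ Ioo (-δ) δ, ∀ x, form κ (φt t x) (φt t x) = κ := fun t ht x =>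
    form_normalPush h (hg₁ t (hsub₁ ht) x).1 hκ
  have hperp : ∀ t ∈ Ioo (-δ) δ, ∀ x (v : EuclideanSpace ℝ (Fin n)),
      form κ (φt t x) (dE (n := n) (φt t) x v) = 0 := fun t ht x v => by
    have hm := (hφs'.contMDiff ht).mdifferentiableAt (x := x) (by simp)
    have h1 := diff_bilin (isBoundedBilinearMap_form (κ := κ)) hm hm v
    rw [dE_const fun y => hflat t ht y] at h1
    simp only at h1
    rw [form_comm (dE (n := n) (φt t) x v)] at h1
    linarith
  have horth : ∀ t ∈ Ioo (-δ) δ, ∀ x,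
      form κ (φt t x) (normalVec κ (N x) (jet (n := n) (φt t) x)) = 0 ∧
        ∀ j, form κ (normalVec κ (N x) (jet (n := n) (φt t) x)) ((jet (n := n) (φt t) x).2 j) = 0 :=
    fun t ht x => normalVec_orthogonal hκ (hflat t ht x) (fun j => hperp t ht x _) (hreg t ht x).1
  refine ⟨δ, φt, normalPushNormal κ φ N w, ⟨hδ0, hφs', hNs, fun t ht => ?_, hφ0, ?_, ?_⟩,
    fun x => (hasDerivAt_normalPush w x).deriv⟩
  · refine ⟨hφs'.contMDiff ht, hNs.contMDiff ht, fun x => ⟨hflat t ht x, fun hκ1 => ?_⟩, fun x => ?_,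
      fun x => ?_, fun x => ?_, fun x v => ?_⟩
    · have h1 := (hg₁ t (hsub₁ ht) x)
      have h2 := h1.2 hκ1
      have h3 := Real.sqrt_pos.2 h1.1
      simp only [hT] at h2 h3
      change 0 < (normalPush κ φ N w t x) (Fin.last (n + 1))
      rw [normalPush, PiLp.smul_apply, smul_eq_mul]
      exact mul_pos (inv_pos.2 h3) h2
    -- A kernel vector of the differential would be a null vector of the first fundamental form,
    -- whose determinant is non-zero.
    · refine (injective_iff_map_eq_zero _).2 fun v hv => ?_
      by_contra hne
      refine (hreg t ht x).1 (Matrix.exists_vecMul_eq_zero_iff.1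
        ⟨WithLp.ofLp (show EuclideanSpace ℝ (Fin n) from v), fun h0 => hne ?_, ?_⟩)
      · exact WithLp.ofLp_injective 2 h0
      · funext j
        have h1 : ∑ k, (show EuclideanSpace ℝ (Fin n) from v) k • (jet (n := n) (φt t) x).2 k = 0 :=
          (diff_eq_sum (φt t) x v).symm.trans hv
        have h2 := congrArg (fun z => form κ z ((jet (n := n) (φt t) x).2 j)) h1
        simp only [form_zero_left] at h2
        rw [smoothBilin_form.sum_left (p := (0 : Amb n))] at h2
        simp only [form_smul_left] at h2
        exact h2
    · have h1 := (hreg t ht x).2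
      have h2 := Real.sq_sqrt h1.le
      have h3 := (Real.sqrt_pos.2 h1).ne'
      rw [normalPushNormal, ← hφt, unitNormal, form_smul_left, form_smul_right]
      field_simp
      rw [h2]
    · rw [normalPushNormal, ← hφt, unitNormal, form_smul_right, (horth t ht x).1, mul_zero]
    · have h1 : diff n (φt t) x v = ∑ k, (show EuclideanSpace ℝ (Fin n) from v) k •
        (jet (n := n) (φt t) x).2 k := diff_eq_sum (φt t) x (show EuclideanSpace ℝ (Fin n) from v)
      rw [normalPushNormal, ← hφt, unitNormal, form_smul_left, h1,
        smoothBilin_form.sum_right (p := (0 : Amb n))]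
      simp [form_smul_right, (horth t ht x).2]
  · funext x
    rw [normalPushNormal, ← hφt, hφ0, h.unitNormal_eq]
  · intro t _ x hx
    exact (normalPush_eventuallyEq hx t).eq_of_nhds

end NormalVariation

end OrientedGeodesics
end

noncomputable section

namespace OrientedGeodesics

open Filter Topology

/-! ## Hamiltonian minimality of Gauss maps -/

section Comparison

variable {n : ℕ} {S : Type*} [TopologicalSpace S] [ChartedSpace (EuclideanSpace ℝ (Fin n)) S]
  {V : Type*} [NormedAddCommGroup V] [NormedSpace ℝ V]
  [IsManifold (𝓡 n) ∞ S] [MeasurableSpace S] [BorelSpace S] [SecondCountableTopology S] [T2Space S]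
  {q : V → V → V → ℝ} {Φ W : S → V}

omit [SecondCountableTopology S] in
theorem integrable_firstVar (hq : SmoothBilin q) (hΦ : ContMDiff (𝓡 n) 𝓘(ℝ, V) ∞ Φ)
    (h0 : DetNeZero n q Φ) (hW : ContMDiff (𝓡 n) 𝓘(ℝ, V) ∞ W) (hc : HasCompactSupport W) :
    Integrable (firstVar n q Φ W) (inducedVolume n q Φ) := by
  have hlf := isLocallyFiniteMeasure_inducedVolume (n := n) hq hΦ
  exact (continuous_firstVar hq hΦ h0 hW).integrable_of_hasCompactSupport
    (HasCompactSupport.intro hc fun x hx => firstVar_eq_zero hx)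

/-- The first variation of the volume does not change if a tangential field is added to the
velocity. -/
theorem integral_firstVar_congr (hq : SmoothBilin q) (hΦ : ContMDiff (𝓡 n) 𝓘(ℝ, V) ∞ Φ)
    (h0 : DetNeZero n q Φ) {W' : S → V} (hW : ContMDiff (𝓡 n) 𝓘(ℝ, V) ∞ W)
    (hW' : ContMDiff (𝓡 n) 𝓘(ℝ, V) ∞ W') (hc : HasCompactSupport W) (hc' : HasCompactSupport W')
    (hT : ∀ x, ∃ v : EuclideanSpace ℝ (Fin n), W x - W' x = diff n Φ x v) :
    ∫ x, firstVar n q Φ W x ∂inducedVolume n q Φ =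
      ∫ x, firstVar n q Φ W' x ∂inducedVolume n q Φ := by
  have hs : ContMDiff (𝓡 n) 𝓘(ℝ, V) ∞ fun x => W x - W' x := hW.sub hW'
  have hcs : HasCompactSupport fun x => W x - W' x := hc.sub hc'
  have h1 := integral_firstVar_tangential hq hΦ h0 hs hT hcs
  have h2 : ∀ x, firstVar n q Φ W x =
      firstVar n q Φ (fun y => W y - W' y) x + firstVar n q Φ W' x := fun x => by
    have h3 : jet (n := n) (fun y => (W y - W' y) + W' y) x =
        jet (n := n) (fun y => W y - W' y) x + jet (n := n) W' x :=
      jet_add (hs.mdifferentiableAt (by simp)) (hW'.mdifferentiableAt (by simp))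
    simp only [sub_add_cancel] at h3
    rw [firstVar, h3, map_add, add_div]
    rfl
  simp only [h2]
  rw [integral_add (integrable_firstVar hq hΦ h0 hs hcs) (integrable_firstVar hq hΦ h0 hW' hc'), h1,
    zero_add]

omit [IsManifold (𝓡 n) ∞ S] [BorelSpace S] [SecondCountableTopology S] [T2Space S] in
theorem setIntegral_firstVar {C : Set S} (hC : tsupport W ⊆ C) :
    ∫ x in C, firstVar n q Φ W x ∂inducedVolume n q Φ =
      ∫ x, firstVar n q Φ W x ∂inducedVolume n q Φ :=
  setIntegral_eq_integral_of_forall_compl_eq_zero fun _ hx =>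
    firstVar_eq_zero fun h => hx (hC h)

end Comparison

/-! ### Equivalence of the two variational problems -/

section Equivalence

variable {n : ℕ} {S : Type*} [TopologicalSpace S] [ChartedSpace (EuclideanSpace ℝ (Fin n)) S]
  [IsManifold (𝓡 n) ∞ S] [MeasurableSpace S] [BorelSpace S] [SecondCountableTopology S] [T2Space S]
  {κ : ℝ} {φ N : S → Amb n} {q : Biv n → Biv n → Biv n → ℝ} {J : Biv n → Biv n → Biv n}

/-- Two tangential fields along the Gauss map with the same symplectic pairing give the same first
variation of the volume. -/
theorem integral_firstVar_eq_of_symplectic (hq : SmoothBilin q) (hκ : κ * κ = 1)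
    (h : IsHypersurface κ φ N) (h0 : DetNeZero n q (gaussMap φ N)) {W W' : S → Biv n}
    (hW : ContMDiff (𝓡 n) 𝓘(ℝ, Biv n) ∞ W) (hW' : ContMDiff (𝓡 n) 𝓘(ℝ, Biv n) ∞ W')
    (hc : HasCompactSupport W) (hc' : HasCompactSupport W')
    (hT : ∀ x, IsTangent κ (φ x) (N x) (W x)) (hT' : ∀ x, IsTangent κ (φ x) (N x) (W' x))
    (hs : ∀ x (v : EuclideanSpace ℝ (Fin n)),
      symplectic κ (gaussMap φ N x) (dE (n := n) (gaussMap φ N) x v) (W x) =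
        symplectic κ (gaussMap φ N x) (dE (n := n) (gaussMap φ N) x v) (W' x)) :
    ∫ x, firstVar n q (gaussMap φ N) W x ∂inducedVolume n q (gaussMap φ N) =
      ∫ x, firstVar n q (gaussMap φ N) W' x ∂inducedVolume n q (gaussMap φ N) := by
  refine integral_firstVar_congr hq h.smooth_gaussMap h0 hW hW' hc hc' fun x => ?_
  have h1 : IsTangent κ (φ x) (N x) (W x - W' x) := by
    rw [sub_eq_add_neg]
    exact (hT x).add (hT' x).neg
  obtain ⟨v, hv⟩ := (h.isFrame hκ x).mem_range_gaussDiff h1 fun v => by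
    have h2 := hs x v
    rw [h.dE_gaussMap] at h2
    rw [symplectic_sub_right]
    exact sub_eq_zero.2 h2
  exact ⟨v, hv.trans (h.dE_gaussMap x v).symm⟩

/-- The pointwise identity for `f` makes the functional at each small time equal to $c$ times the
volume of the Gauss map at that time, to which `hasDerivAt_volume` applies. The velocity of the
Gauss maps vanishes off $C$, so the integral may be taken over all of `S`. -/
theorem IsVariation.hasDerivAt_functional {f : (S → Amb n) → (S → Amb n) → S → ℝ} {c : ℝ}
    (hq : SmoothBilin q) (hκ : κ * κ = 1)
    (hf : ∀ ψ ν, IsHypersurface κ ψ ν → ∀ x, f ψ ν x * jetDensity (fun _ => form κ)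
      (jet (n := n) ψ x) = c * jetDensity q (jet (n := n) (gaussMap ψ ν) x))
    (h0 : DetNeZero n q (gaussMap φ N)) {C : Set S} (hC : IsCompact C) {δ : ℝ}
    {φt Nt : ℝ → S → Amb n} (h : IsVariation κ φ N C δ φt Nt) :
    HasDerivAt
      (fun t => ∫ x in C, f (φt t) (Nt t) x ∂(inducedVolume n (fun _ => form κ) (φt t)))
      (c * ∫ x, firstVar n q (gaussMap φ N) (velocity fun t => gaussMap (φt t) (Nt t)) x
        ∂inducedVolume n q (gaussMap φ N)) 0 := by
  have hF := h.smoothFamily_gaussMap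
  have h00 : gaussMap (φt 0) (Nt 0) = gaussMap φ N := by rw [h.initial, h.initial_normal]
  have h1 := hasDerivAt_volume (n := n) hq h.pos hF (by simp only [h00]; exact h0) hC
  simp only [h00] at h1
  rw [setIntegral_firstVar] at h1
  · refine (h1.const_mul c).congr_of_eventuallyEq ?_
    filter_upwards [h.eventually] with t ht
    have hd := ht.detNeZero hκ
    rw [measureReal_inducedVolume (n := n) (smoothBilin_form (κ := κ)) hq ht.smooth
      ht.smooth_gaussMap hd hC.measurableSet, ← integral_const_mul]
    refine integral_congr_ae (ae_of_all _ fun x => ?_)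
    have h3 := hf _ _ ht x
    have h4 := (jetDensity_pos (hd x)).ne'
    simp only [densityRatio]
    field_simp
    linarith
  · refine closure_minimal (fun x hx => ?_) hC.isClosed
    by_contra hxC
    exact hx (h.gauss_velocity_eq_zero hκ hC hxC)

/-- **The correspondence of the variational problems**: if the integrand `f` is a multiple of the
density of the volume of the Gauss map, then the Gauss map is Hamiltonian minimal if and only if
the hypersurface is a critical point of the functional with integrand `f`. -/
theorem isHamiltonianMinimal_iff_isCriticalPoint {f : (S → Amb n) → (S → Amb n) → S → ℝ} {c : ℝ}
    (hc0 : c ≠ 0) (hG : IsGeodesicStructure κ q J) (hκ : κ * κ = 1)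
    (hf : ∀ ψ ν, IsHypersurface κ ψ ν → ∀ x, f ψ ν x * jetDensity (fun _ => form κ)
      (jet (n := n) ψ x) = c * jetDensity q (jet (n := n) (gaussMap ψ ν) x))
    (h : IsHypersurface κ φ N) (hnd : NondegenerateInduced n q (gaussMap φ N)) :
    IsHamiltonianMinimal κ q J (gaussMap φ N) ↔ IsCriticalPoint κ f φ N := by
  have h0 := detNeZero_of_nondegenerate hG.bilin hnd
  have hsg := h.smooth_gaussMap
  constructor
  · rintro ⟨-, hmin⟩ C δ φt Nt hC hv
    have hd := hv.hasDerivAt_functional hG.bilin hκ hf h0 hC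
    set W := velocity fun t => gaussMap (φt t) (Nt t) with hW
    have hWC : ∀ x ∉ C, W x = 0 := fun x hx => hv.gauss_velocity_eq_zero hκ hC hx
    -- The Hamiltonian for which $\mathcal J\nabla u$ has the same symplectic pairing with the Gauss
    -- map as the velocity `W`, by `IsVariation.gauss_velocity`.
    set u : S → ℝ := fun x => -κ * normalSpeed κ φt N x with hu
    have hus : ContMDiff (𝓡 n) 𝓘(ℝ, ℝ) ∞ u := contMDiff_const.mul hv.contMDiff_normalSpeed
    have huc : HasCompactSupport u := HasCompactSupport.intro hC fun x hx => by
      simp only [hu, normalSpeed, (hv.velocity_eq_zero hκ hC hx).1, form_zero_left, mul_zero]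
    obtain ⟨ε, F, hF, hFd⟩ := exists_hamiltonianVariation hG hκ h h0 hus huc
    have hmin' := hmin u ε F hF (tsupport u) huc subset_rfl
    have hvel : velocity F = hamField q J (gaussMap φ N) u := funext fun x => (hFd x).deriv
    have h1 := hasDerivAt_volume (n := n) hG.bilin hF.pos (F := F) hF.smooth
      (by rw [hF.initial]; exact h0) huc.isCompact
    have hsupp : tsupport (hamField q J (gaussMap φ N) u) ⊆ tsupport u :=
      closure_minimal (fun x hx => by
        by_contra hxu
        exact hx (hamField_eq_zero hG hxu)) (isClosed_tsupport u)
    rw [hF.initial, hvel, setIntegral_firstVar hsupp] at h1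
    have hzero := hmin'.unique h1
    have heq := integral_firstVar_eq_of_symplectic (W := W) hG.bilin hκ h h0
      (hv.smoothFamily_gaussMap.contMDiff_velocity hv.pos) (contMDiff_hamField hG hsg h0 hus)
      (HasCompactSupport.intro hC hWC)
      (HasCompactSupport.intro huc.isCompact fun x hx => hamField_eq_zero hG hx)
      (fun x => (hv.gauss_velocity hκ x).1) (hamField_tangent hG hκ h h0 u) fun x v => by
        rw [(hv.gauss_velocity hκ x).2 v, symplectic_hamField hG hκ h h0 u x v, hu]
        have h2 : mfderiv (𝓡 n) 𝓘(ℝ, ℝ) (fun x => -κ * normalSpeed κ φt N x) x =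
            (-κ) • mfderiv (𝓡 n) 𝓘(ℝ, ℝ) (normalSpeed κ φt N) x :=
          const_smul_mfderiv (hv.contMDiff_normalSpeed.mdifferentiableAt (by simp)) (-κ)
        exact (congrArg (fun L => L v) h2).symm
    rw [heq, ← hzero, mul_zero] at hd
    exact hd
  · intro hcrit
    refine ⟨isLagrangian_gaussMap hκ h.mem h hnd, fun u δ F hF C hC hCu => ?_⟩
    have h1 := hasDerivAt_volume (n := n) hG.bilin hF.pos (F := F) hF.smooth
      (by rw [hF.initial]; exact h0) hC
    rw [hF.initial] at h1
    have hFd : ∀ x, ∃ g : EuclideanSpace ℝ (Fin n), (∀ v : EuclideanSpace ℝ (Fin n),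
        q (gaussMap φ N x) (dE (n := n) (gaussMap φ N) x g) (dE (n := n) (gaussMap φ N) x v) =
          dE (n := n) u x v) ∧
        velocity F x = J (gaussMap φ N x) (dE (n := n) (gaussMap φ N) x g) := fun x => by
      obtain ⟨g, hg, hd⟩ := hF.velocity x
      exact ⟨g, hg, hd.deriv⟩
    have hF0 : ∀ x ∉ tsupport u, velocity F x = 0 := fun x hx => by
      obtain ⟨g, hg, hd⟩ := hFd x
      have h2 : u =ᶠ[𝓝 x] fun _ => 0 := notMem_tsupport_iff_eventuallyEq.1 hx
      have h3 : ∀ v, dE (n := n) u x v = 0 := fun v => by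
        have h4 := h2.mfderiv_eq (I := 𝓡 n) (I' := 𝓘(ℝ, ℝ))
        have h5 : mfderiv (𝓡 n) 𝓘(ℝ, ℝ) (fun _ : S => (0 : ℝ)) x = 0 := mfderiv_const
        exact congrArg (fun L => L v) (h4.trans h5)
      -- Where $u$ is locally zero its gradient pairs to zero with everything, so non-degeneracy
      -- makes it vanish and the velocity with it.
      have h6 : g = 0 := hnd x g fun w => (hg w).trans (h3 w)
      have h7 := hG.J_smul (gaussMap φ N x) 0 0
      simp only [zero_smul] at h7
      rw [hd, h6, map_zero, h7]
    have hsupp : tsupport (velocity F) ⊆ tsupport u :=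
      closure_minimal (fun x hx => by
        by_contra hxu
        exact hx (hF0 x hxu)) (isClosed_tsupport u)
    rw [setIntegral_firstVar (hsupp.trans hCu)] at h1
    -- The inverse choice: a normal variation of speed $-\kappa u$ has pairing $\kappa^2du=du$, the
    -- same as the Hamiltonian variation.
    set w : S → ℝ := fun x => -κ * u x with hw
    have hws : ContMDiff (𝓡 n) 𝓘(ℝ, ℝ) ∞ w := contMDiff_const.mul hF.smooth_u
    have hwc : HasCompactSupport w := hF.compact_u.mul_left
    obtain ⟨ε, φt, Nt, hv, hvel⟩ := exists_normalVariation hκ h hws hwc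
    have hd := hv.hasDerivAt_functional hG.bilin hκ hf h0 hwc.isCompact
    have hzero := (hcrit _ ε φt Nt hwc.isCompact hv).unique hd
    have hspeed : normalSpeed κ φt N = w := funext fun x => by
      rw [normalSpeed, hvel, form_smul_left, h.normal_unit, mul_one]
    have heq := integral_firstVar_eq_of_symplectic (W := velocity F)
      (W' := velocity fun t => gaussMap (φt t) (Nt t)) hG.bilin hκ h h0
      (SmoothFamily.contMDiff_velocity (F := F) hF.pos hF.smooth)
      (hv.smoothFamily_gaussMap.contMDiff_velocity hv.pos)
      (HasCompactSupport.intro hF.compact_u.isCompact hF0)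
      (HasCompactSupport.intro hwc.isCompact fun x hx =>
        hv.gauss_velocity_eq_zero hκ hwc.isCompact hx)
      (fun x => by
        obtain ⟨g, -, hd⟩ := hFd x
        rw [hd, h.dE_gaussMap]
        exact hG.tangent _ _ _ (h.isFrame hκ x).toIsFlag ((h.isFrame hκ x).gaussDiff_tangent g))
      (fun x => (hv.gauss_velocity hκ x).1) fun x v => by
        obtain ⟨g, hg, hd⟩ := hFd x
        rw [hd, symplectic_of_gradient hG hκ h hg v, (hv.gauss_velocity hκ x).2 v, hspeed]
        have h2 : mfderiv (𝓡 n) 𝓘(ℝ, ℝ) (fun x => -κ * u x) x =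
            (-κ) • mfderiv (𝓡 n) 𝓘(ℝ, ℝ) u x :=
          const_smul_mfderiv (hF.smooth_u.mdifferentiableAt (by simp)) (-κ)
        have h3 : dE (n := n) w x v = -κ * dE (n := n) u x v := congrArg (fun L => L v) h2
        rw [h3]
        linear_combination (-dE (n := n) u x v) * hκ
    rw [heq, (mul_eq_zero.1 hzero.symm).resolve_left hc0] at h1
    exact h1

end Equivalence

end OrientedGeodesics
end

noncomputable section

namespace OrientedGeodesics

open Filter Topology

/-! ## Linear algebra of the fundamental forms -/

section Diagonalization

variable {n : ℕ}

theorem exists_orthogonal_diagonalization {h : Matrix (Fin n) (Fin n) ℝ} (hh : h.IsSymm) :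
    ∃ (U : Matrix (Fin n) (Fin n) ℝ) (d : Fin n → ℝ), U.transpose * U = 1 ∧
      U.transpose * h * U = Matrix.diagonal d := by
  have hH : h.IsHermitian := by
    rw [Matrix.IsHermitian, Matrix.conjTranspose_eq_transpose_of_trivial]
    exact hh
  refine ⟨hH.eigenvectorUnitary, hH.eigenvalues, ?_, ?_⟩
  · have := Unitary.coe_star_mul_self hH.eigenvectorUnitary
    rwa [Matrix.star_eq_conjTranspose, Matrix.conjTranspose_eq_transpose_of_trivial] at this
  · have := hH.conjStarAlgAut_star_eigenvectorUnitary
    rw [Unitary.conjStarAlgAut_star_apply, Matrix.star_eq_conjTranspose,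
      Matrix.conjTranspose_eq_transpose_of_trivial] at this
    exact this

/-- Simultaneous diagonalization of a positive definite and a symmetric form. -/
theorem exists_simultaneous_diagonalization {g h : Matrix (Fin n) (Fin n) ℝ} (hg : g.PosDef)
    (hh : h.IsSymm) : ∃ (C : Matrix (Fin n) (Fin n) ℝ) (d : Fin n → ℝ),
      C.transpose * g * C = 1 ∧ C.transpose * h * C = Matrix.diagonal d := by
  have hgs : g.IsSymm := by
    have := hg.isHermitian
    rwa [Matrix.IsHermitian, Matrix.conjTranspose_eq_transpose_of_trivial] at this
  obtain ⟨U, a, hU, hUg⟩ := exists_orthogonal_diagonalization hgs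
  have ha : ∀ i, 0 < a i := by
    intro i
    have h1 : (U.transpose * g * U).PosDef := by
      have hU' : IsUnit U := (Matrix.isUnit_iff_isUnit_det _).2 (Matrix.isUnit_det_of_left_inverse hU)
      have h2 := hg.conjTranspose_mul_mul_same (B := U) (Matrix.mulVec_injective_of_isUnit hU')
      rwa [Matrix.conjTranspose_eq_transpose_of_trivial] at h2
    rw [hUg] at h1
    simpa using h1.diag_pos (i := i)
  -- Rescaling the orthonormal eigenbasis of `g` turns `g` into the identity; an orthogonal
  -- diagonalization of the transformed `h` then preserves this.
  set E := U * Matrix.diagonal fun i => (Real.sqrt (a i))⁻¹ with hE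
  have hEg : E.transpose * g * E = 1 := by
    have h1 : E.transpose * g * E = Matrix.diagonal (fun i => (Real.sqrt (a i))⁻¹) *
        (U.transpose * g * U) * Matrix.diagonal fun i => (Real.sqrt (a i))⁻¹ := by
      simp only [hE, Matrix.transpose_mul, Matrix.diagonal_transpose, Matrix.mul_assoc]
    rw [h1, hUg, Matrix.diagonal_mul_diagonal, Matrix.diagonal_mul_diagonal,
      ← Matrix.diagonal_one]
    congr 1
    funext i
    have h2 := Real.mul_self_sqrt (ha i).le
    have h3 := (Real.sqrt_pos.2 (ha i)).ne'
    field_simp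
    rw [sq, h2]
  have hEh : (E.transpose * h * E).IsSymm := by
    clear_value E
    rw [Matrix.IsSymm, Matrix.transpose_mul, Matrix.transpose_mul, Matrix.transpose_transpose, hh,
      Matrix.mul_assoc]
  obtain ⟨V, d, hV, hVd⟩ := exists_orthogonal_diagonalization hEh
  refine ⟨E * V, d, ?_, ?_⟩
  · calc (E * V).transpose * g * (E * V) = V.transpose * (E.transpose * g * E) * V := by
          simp only [Matrix.transpose_mul, Matrix.mul_assoc]
      _ = 1 := by rw [hEg, Matrix.mul_one, hV]
  · rw [← hVd]
    simp only [Matrix.transpose_mul, Matrix.mul_assoc]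

/-- The roots of the characteristic polynomial of `g⁻¹h` and its determinants in terms of the
eigenvalues. -/
theorem exists_principal {g h : Matrix (Fin n) (Fin n) ℝ} (hg : g.PosDef) (hh : h.IsSymm) :
    ∃ d : Fin n → ℝ, (g⁻¹ * h).charpoly.roots = Finset.univ.val.map d ∧
      (∀ κ : ℝ, (1 + κ • ((g⁻¹ * h) * (g⁻¹ * h))).det = ∏ i, (1 + κ * d i ^ 2)) ∧
      (g⁻¹ * h).det = ∏ i, d i ∧ (g⁻¹ * h).trace = ∑ i, d i := by
  obtain ⟨C, d, hC, hCd⟩ := exists_simultaneous_diagonalization hg hh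
  have h1 : C * (C.transpose * g) = 1 := mul_eq_one_comm.1 hC
  have hinv : g⁻¹ = C * C.transpose := Matrix.inv_eq_left_inv (by rw [Matrix.mul_assoc, h1])
  have hA : g⁻¹ * h = C * (C.transpose * h) := by rw [hinv, Matrix.mul_assoc]
  refine ⟨d, ?_, fun κ => ?_, ?_, ?_⟩
  -- With $g^{-1}=CC^{T}$ the shape operator is $C\,(C^{T}h)$, and exchanging the two factors gives
  -- the diagonal matrix $C^{T}hC$ without changing the characteristic polynomial. The determinants
  -- and the trace below use the same exchange.
  · rw [hA, Matrix.charpoly_mul_comm, hCd, Matrix.charpoly_diagonal, Polynomial.roots_prod]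
    · simp
    · simp [Finset.prod_ne_zero_iff, Polynomial.X_sub_C_ne_zero]
  · have h2 : κ • ((g⁻¹ * h) * (g⁻¹ * h)) =
        C * (κ • (C.transpose * h * C) * (C.transpose * h)) := by
      rw [hA]
      simp only [Matrix.mul_assoc, Matrix.smul_mul, Matrix.mul_smul]
    rw [h2, Matrix.det_one_add_mul_comm, Matrix.mul_assoc, hCd, Matrix.smul_mul,
      Matrix.diagonal_mul_diagonal, ← Matrix.diagonal_one, ← Matrix.diagonal_smul,
      Matrix.diagonal_add, Matrix.det_diagonal]
    exact Finset.prod_congr rfl fun i _ => by simp [sq]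
  · rw [hA, Matrix.det_mul_comm, hCd, Matrix.det_diagonal]
  · rw [hA, Matrix.trace_mul_comm, hCd, Matrix.trace_diagonal]

end Diagonalization

/-! ### Fundamental forms of hypersurfaces and the density of the Einstein metric -/

section FirstForm

variable {n : ℕ} {κ : ℝ}

theorem form_eq_sum_add (x y : Amb n) :
    form κ x y = ∑ i : Fin (n + 1), x i.castSucc * y i.castSucc +
      κ * x (Fin.last (n + 1)) * y (Fin.last (n + 1)) := by
  rw [form, Fin.sum_univ_castSucc]
  simp [sgn, Fin.castSucc_ne_last]

/-- The form is positive definite on the tangent spaces of the space forms. -/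
theorem form_pos_of_tangent (hκ : κ = 1 ∨ κ = -1) {a X : Amb n} (ha : form κ a a = κ)
    (haX : form κ a X = 0) (hX : X ≠ 0) : 0 < form κ X X := by
  have hs : 0 ≤ ∑ i : Fin (n + 1), X i.castSucc * X i.castSucc :=
    Finset.sum_nonneg fun i _ => mul_self_nonneg _
  have hX0 : ∑ i : Fin (n + 1), X i.castSucc * X i.castSucc = 0 →
      X (Fin.last (n + 1)) = 0 → False := fun h1 h2 => by
    rw [Finset.sum_eq_zero_iff_of_nonneg fun i _ => mul_self_nonneg _] at h1
    refine hX (PiLp.ext fun i => ?_)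
    induction i using Fin.lastCases with
    | last => exact h2
    | cast i => exact mul_self_eq_zero.1 (h1 i (Finset.mem_univ _))
  rw [form_eq_sum_add] at *
  rcases hκ with rfl | rfl
  · by_contra hle
    have h3 := mul_self_nonneg (X (Fin.last (n + 1)))
    exact hX0 (by nlinarith) (mul_self_eq_zero.1 (by nlinarith))
  -- For the hyperboloid, Cauchy–Schwarz on the spatial parts together with $\langle a,X\rangle=0$
  -- and $\langle a,a\rangle=-1$ gives $t^2\le A\,\langle X,X\rangle$, where $t$ is the last
  -- coordinate of $X$ and $A$ the square of the spatial part of $a$. If $\langle X,X\rangle\le0$,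
  -- then $t=0$ and the spatial part of $X$ vanishes too.
  · have hCS := Finset.sum_mul_sq_le_sq_mul_sq Finset.univ (fun i : Fin (n + 1) => a i.castSucc)
      fun i => X i.castSucc
    simp only [sq] at hCS
    set p := ∑ i : Fin (n + 1), a i.castSucc * X i.castSucc
    set A := ∑ i : Fin (n + 1), a i.castSucc * a i.castSucc with hA
    set B := ∑ i : Fin (n + 1), X i.castSucc * X i.castSucc
    set t := X (Fin.last (n + 1))
    set r := a (Fin.last (n + 1))
    have hA0 : 0 ≤ A := Finset.sum_nonneg fun i _ => mul_self_nonneg _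
    have hp : p = r * t := by linarith
    have hr : r * r = 1 + A := by linarith
    rw [hp] at hCS
    have h4 : t * t ≤ A * (B - t * t) := by nlinarith
    by_contra hle
    have h5 : B - t * t ≤ 0 := by linarith
    have h6 : t * t ≤ 0 := h4.trans (mul_nonpos_of_nonneg_of_nonpos hA0 h5)
    have h7 : t * t = 0 := le_antisymm h6 (mul_self_nonneg _)
    exact hX0 (by linarith) (mul_self_eq_zero.1 h7)

variable {S : Type*} [TopologicalSpace S] [ChartedSpace (EuclideanSpace ℝ (Fin n)) S]
  {φ N : S → Amb n}

theorem IsHypersurface.form_diff_pos [IsManifold (𝓡 n) ∞ S] (hκ : κ = 1 ∨ κ = -1)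
    (h : IsHypersurface κ φ N) (x : S)
    {v : EuclideanSpace ℝ (Fin n)} (hv : v ≠ 0) :
    0 < form κ (dE (n := n) φ x v) (dE (n := n) φ x v) := by
  have hf := h.isFrame (by rcases hκ with rfl | rfl <;> norm_num) x
  refine form_pos_of_tangent hκ (h.mem x).1 (hf.aP v) fun h0 => hv (hf.inj ?_)
  rw [h0, map_zero]

theorem IsHypersurface.posDef_firstForm [IsManifold (𝓡 n) ∞ S] (hκ : κ = 1 ∨ κ = -1)
    (h : IsHypersurface κ φ N) (x : S) : (firstForm κ φ x).PosDef := by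
  refine Matrix.PosDef.of_dotProduct_mulVec_pos ?_ fun c hc => ?_
  · ext i j
    simp [firstForm, form_comm]
  · have h1 : dE (n := n) φ x (WithLp.toLp 2 c) = ∑ k, c k • (jet (n := n) φ x).2 k :=
      diff_eq_sum φ x (WithLp.toLp 2 c)
    have h2 := h.form_diff_pos hκ x (v := WithLp.toLp 2 c)
      fun h0 => hc (congrArg WithLp.ofLp h0)
    rw [h1, smoothBilin_form.sum_left (p := (0 : Amb n))] at h2
    simp only [form_smul_left, smoothBilin_form.sum_right (p := (0 : Amb n)), form_smul_right] at h2
    simp only [dotProduct, Matrix.mulVec, star_trivial, firstForm]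
    refine h2.trans_eq (Finset.sum_congr rfl fun i _ => ?_)
    rw [Finset.mul_sum]
    refine Finset.sum_congr rfl fun j _ => ?_
    simp only [jet]
    ring

theorem IsHypersurface.isSymm_secondForm [IsManifold (𝓡 n) ∞ S] (h : IsHypersurface κ φ N) (x : S) :
    (secondForm κ φ N x).IsSymm := by
  ext i j
  simp only [secondForm, Matrix.transpose_apply, neg_inj]
  exact h.symm x _ _

/-- The Weingarten equation `dN = -dφ ∘ A`. -/
theorem IsHypersurface.weingarten [IsManifold (𝓡 n) ∞ S] (hκ : κ * κ = 1)
    (h : IsHypersurface κ φ N) (x : S) (i : Fin n) :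
    (jet (n := n) N x).2 i = -∑ k, shapeOperator κ φ N x k i • (jet (n := n) φ x).2 k := by
  have hf := h.isFrame hκ x
  have hdet : (firstForm κ φ x).det ≠ 0 := h.detNeZero hκ x
  have hP : ∀ (a : Amb n), (∀ j, form κ ((jet (n := n) φ x).2 j) a = 0) →
      ∀ v, form κ (dE (n := n) φ x v) a = 0 := fun a ha v => by
    have h1 : dE (n := n) φ x v = ∑ k, v k • (jet (n := n) φ x).2 k := diff_eq_sum φ x v
    rw [h1, smoothBilin_form.sum_left (p := (0 : Amb n))]
    simp [form_smul_left, ha]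
  have ha : ∀ k, form κ (φ x) ((jet (n := n) φ x).2 k) = 0 := fun k => hf.aP _
  have hb : ∀ k, form κ (N x) ((jet (n := n) φ x).2 k) = 0 := fun k => hf.bP _
  have ha' : form κ (φ x) ((jet (n := n) N x).2 i) = 0 := hf.aQ _
  have hb' : form κ (N x) ((jet (n := n) N x).2 i) = 0 := hf.bQ _
  rw [eq_neg_iff_add_eq_zero]
  refine hf.eq_zero ?_ ?_ (hP _ fun j => ?_)
  · rw [form_add_right, ha', smoothBilin_form.sum_right (p := (0 : Amb n))]
    simp [form_smul_right, ha]
  · rw [form_add_right, hb', smoothBilin_form.sum_right (p := (0 : Amb n))]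
    simp [form_smul_right, hb]
  · have h1 : firstForm κ φ x * shapeOperator κ φ N x = secondForm κ φ N x := by
      rw [shapeOperator, Matrix.mul_nonsing_inv_cancel_left _ _ (isUnit_iff_ne_zero.2 hdet)]
    have h2 := congrFun (congrFun h1 j) i
    have h3 : secondForm κ φ N x j i = -form κ ((jet (n := n) N x).2 i) ((jet (n := n) φ x).2 j) := by
      rw [← h.isSymm_secondForm x]
      rfl
    rw [h3, Matrix.mul_apply] at h2
    rw [form_add_right, smoothBilin_form.sum_right (p := (0 : Amb n)), form_comm]
    simp only [form_smul_right]
    have h4 : ∑ k, shapeOperator κ φ N x k i *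
        form κ ((jet (n := n) φ x).2 j) ((jet (n := n) φ x).2 k) =
        ∑ k, firstForm κ φ x j k * shapeOperator κ φ N x k i :=
      Finset.sum_congr rfl fun k _ => mul_comm _ _
    rw [h4, h2, add_neg_cancel]

theorem IsHypersurface.jet_gaussMap (h : IsHypersurface κ φ N) (x : S) (i : Fin n) :
    (jet (n := n) (gaussMap φ N) x).2 i =
      wedge (φ x) ((jet (n := n) N x).2 i) + wedge (N x) (-(jet (n := n) φ x).2 i) :=
  h.dE_gaussMap x _

/-- The metric induced by `G` on the Gauss map is `g(1 + κA²)`. -/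
theorem IsHypersurface.jetGram_metricG [IsManifold (𝓡 n) ∞ S] (hκ : κ * κ = 1)
    (h : IsHypersurface κ φ N) (x : S) :
    jetGram (fun _ => metricG κ) (jet (n := n) (gaussMap φ N) x) = firstForm κ φ x *
      (1 + κ • (shapeOperator κ φ N x * shapeOperator κ φ N x)) := by
  have hf := h.isFrame hκ x
  have hdet : (firstForm κ φ x).det ≠ 0 := h.detNeZero hκ x
  set A := shapeOperator κ φ N x with hA
  have h1 : firstForm κ φ x * A = secondForm κ φ N x := by
    rw [hA, shapeOperator, Matrix.mul_nonsing_inv_cancel_left _ _ (isUnit_iff_ne_zero.2 hdet)]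
  have h2 : firstForm κ φ x * (1 + κ • (A * A)) = firstForm κ φ x + κ • (secondForm κ φ N x * A) := by
    rw [Matrix.mul_add, Matrix.mul_one, Matrix.mul_smul, ← Matrix.mul_assoc, h1]
  rw [h2]
  ext i j
  have ha : ∀ k, form κ (φ x) (-(jet (n := n) φ x).2 k) = 0 := fun k => by
    rw [form_neg_right]
    exact neg_eq_zero.2 (hf.aP _)
  have hb : ∀ k, form κ (N x) (-(jet (n := n) φ x).2 k) = 0 := fun k => by
    rw [form_neg_right]
    exact neg_eq_zero.2 (hf.bP _)
  have ha' : ∀ k, form κ (φ x) ((jet (n := n) N x).2 k) = 0 := fun k => hf.aQ _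
  have hb' : ∀ k, form κ (N x) ((jet (n := n) N x).2 k) = 0 := fun k => hf.bQ _
  simp only [jetGram]
  rw [h.jet_gaussMap, h.jet_gaussMap, hf.toIsFlag.metricG_tangent (ha' i) (hb' i) (ha i) (hb i)
    (ha' j) (hb' j) (ha j) (hb j), form_neg_left, form_neg_right, neg_neg, Matrix.add_apply,
    Matrix.smul_apply, Matrix.mul_apply, h.weingarten hκ x j, form_neg_right,
    smoothBilin_form.sum_right (p := (0 : Amb n)), add_comm, ← Finset.sum_neg_distrib]
  simp only [form_smul_right, smul_eq_mul]
  congr 2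
  refine Finset.sum_congr rfl fun k _ => ?_
  simp only [secondForm, jet]
  ring

/-- The Gram matrix is $g(1+\kappa A^2)$, and the eigenvalues of $A$ evaluate the second
determinant. -/
theorem IsHypersurface.density_metricG [IsManifold (𝓡 n) ∞ S] (hκ : κ = 1 ∨ κ = -1)
    (h : IsHypersurface κ φ N) (x : S) :
    Real.sqrt ((principalCurvatures κ φ N x).map fun k => |1 + κ * k ^ 2|).prod *
      jetDensity (fun _ => form κ) (jet (n := n) φ x) =
    jetDensity (fun _ => metricG κ) (jet (n := n) (gaussMap φ N) x) := by
  have hκ2 : κ * κ = 1 := by rcases hκ with rfl | rfl <;> norm_num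
  obtain ⟨d, hd, hdet, -⟩ := exists_principal (h.posDef_firstForm hκ x) (h.isSymm_secondForm x)
  have h1 : ((principalCurvatures κ φ N x).map fun k => |1 + κ * k ^ 2|).prod =
      |(1 + κ • (shapeOperator κ φ N x * shapeOperator κ φ N x)).det| := by
    rw [principalCurvatures, shapeOperator, hd, hdet κ, Multiset.map_map, Finset.abs_prod]
    rfl
  rw [h1, jetDensity, jetDensity, h.jetGram_metricG hκ2, Matrix.det_mul, abs_mul,
    Real.sqrt_mul (abs_nonneg _), mul_comm]
  rfl

/-- On the sphere $G$ is definite along the Gauss map: the square of $d\Phi(v)$ is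
$|dN(v)|^2+|d\phi(v)|^2$. -/
theorem IsHypersurface.nondegenerate_sphere [IsManifold (𝓡 n) ∞ S] (h : IsHypersurface 1 φ N) :
    NondegenerateInduced n (fun _ => metricG 1) (gaussMap φ N) := by
  intro x v hv
  have hf := h.isFrame (by norm_num) x
  suffices key : ∀ v : EuclideanSpace ℝ (Fin n), metricG 1 (dE (n := n) (gaussMap φ N) x v)
    (dE (n := n) (gaussMap φ N) x v) = 0 → v = 0 from key v (hv v)
  intro v h2
  by_contra hne
  have h1 := h.form_diff_pos (Or.inl rfl) x hne
  have ha : form 1 (φ x) (-dE (n := n) φ x v) = 0 := by rw [form_neg_right, hf.aP, neg_zero]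
  have hb : form 1 (N x) (-dE (n := n) φ x v) = 0 := by rw [form_neg_right, hf.bP, neg_zero]
  rw [h.dE_gaussMap, gaussDiff, hf.toIsFlag.metricG_tangent (hf.aQ v) (hf.bQ v) ha hb (hf.aQ v)
    (hf.bQ v) ha hb, form_neg_left, form_neg_right, neg_neg, one_mul] at h2
  have h3 : 0 ≤ form 1 (dE (n := n) N x v) (dE (n := n) N x v) := by
    rw [form_eq_sum_add]
    have := Finset.sum_nonneg fun (i : Fin (n + 1)) (_ : i ∈ Finset.univ) =>
      mul_self_nonneg (dE (n := n) N x v i.castSucc)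
    nlinarith [mul_self_nonneg (dE (n := n) N x v (Fin.last (n + 1)))]
  linarith

end FirstForm

end OrientedGeodesics
end

noncomputable section

namespace OrientedGeodesics

open Filter Topology

/-! ## The density of the conformally flat metric -/

section Neutral

variable {κ : ℝ}

theorem volForm_wedge_swap (hκ : κ * κ = 1) (a b v w : Amb 2) :
    volForm (wedge a b) v w = -volForm (wedge a b) w v := by
  rw [← form_normalJ κ hκ, ← form_normalJ κ hκ, normalJ_skew hκ, form_comm v]

theorem volForm_wedge_self (hκ : κ * κ = 1) (a b v : Amb 2) : volForm (wedge a b) v v = 0 := by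
  have := volForm_wedge_swap hκ a b v v
  linarith

theorem volForm_wedge_neg_sum (hκ : κ * κ = 1) (a b v : Amb 2) (c : Fin 2 → ℝ)
    (P : Fin 2 → Amb 2) : volForm (wedge a b) v ((-∑ k, c k • P k : Amb 2)) =
      -∑ k, c k * volForm (wedge a b) v (P k) := by
  simp only [← form_normalJ κ hκ, form_neg_right, Fin.sum_univ_two, form_add_right, form_smul_right]

/-- The square of the oriented area is the Gram determinant. -/
theorem IsFlag.volForm_sq {a b : Amb 2} (h : IsFlag κ a b) {P : Fin 2 → Amb 2}
    (ha : ∀ i, form κ a (P i) = 0) (hb : ∀ i, form κ b (P i) = 0) :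
    volForm (wedge a b) (P 0) (P 1) ^ 2 =
      form κ (P 0) (P 0) * form κ (P 1) (P 1) - form κ (P 0) (P 1) ^ 2 := by
  have hκ0 : κ ≠ 0 := left_ne_zero_of_mul (h.sq ▸ one_ne_zero)
  rw [volForm_wedge]
  set M : Matrix (Fin 4) (Fin 4) ℝ :=
    Matrix.of ![(a : Fin 4 → ℝ), (b : Fin 4 → ℝ), (P 0 : Fin 4 → ℝ), (P 1 : Fin 4 → ℝ)] with hM
  -- Multiplying by the diagonal matrix of the ambient form turns the rows into their Gram matrix,
  -- which is block diagonal with first block $\operatorname{diag}(\kappa,1)$. The diagonal matrix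
  -- also has determinant $\kappa$, so this factor cancels from both sides.
  have h1 : M * Matrix.diagonal (fun k : Fin 4 => sgn κ (n := 2) k) * M.transpose =
      Matrix.of ![![κ, 0, 0, 0], ![0, 1, 0, 0],
        ![0, 0, form κ (P 0) (P 0), form κ (P 0) (P 1)],
        ![0, 0, form κ (P 0) (P 1), form κ (P 1) (P 1)]] := by
    have h2 : ∀ (u v : Fin 4 → Amb 2) (i j : Fin 4),
        (Matrix.of (fun i => (u i : Fin 4 → ℝ)) * Matrix.diagonal (fun k : Fin 4 => sgn κ (n := 2) k) *
          (Matrix.of fun i => (v i : Fin 4 → ℝ)).transpose) i j = form κ (u i) (v j) := by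
      intro u v i j
      rw [Matrix.mul_apply]
      simp only [Matrix.mul_diagonal, Matrix.of_apply, Matrix.transpose_apply, form]
      exact Finset.sum_congr rfl fun k _ => by ring
    have h3 : M = Matrix.of fun i => ((![a, b, P 0, P 1] : Fin 4 → Amb 2) i : Fin 4 → ℝ) := by
      ext i j
      fin_cases i <;> rfl
    ext i j
    rw [h3, h2]
    fin_cases i <;> fin_cases j <;>
      simp [h.aa, h.ab, h.ba, h.bb, ha, hb, form_comm (P 0) a, form_comm (P 1) a,
        form_comm (P 0) b, form_comm (P 1) b, form_comm (P 1) (P 0)]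
  have h4 := congrArg Matrix.det h1
  rw [Matrix.det_mul, Matrix.det_mul, Matrix.det_transpose, Matrix.det_diagonal] at h4
  have h5 : ∏ k : Fin 4, sgn κ (n := 2) k = κ := by
    simp [Fin.prod_univ_four, sgn, Fin.ext_iff]
  rw [h5] at h4
  have h6 : (Matrix.of ![![κ, 0, 0, 0], ![0, 1, 0, 0],
        ![0, 0, form κ (P 0) (P 0), form κ (P 0) (P 1)],
        ![0, 0, form κ (P 0) (P 1), form κ (P 1) (P 1)]]).det =
      κ * (form κ (P 0) (P 0) * form κ (P 1) (P 1) - form κ (P 0) (P 1) ^ 2) := by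
    rw [Matrix.det_succ_row_zero]
    simp [Fin.sum_univ_succ, Matrix.det_fin_three, Fin.succAbove, Matrix.submatrix]
    left
    ring
  rw [h6] at h4
  refine mul_left_cancel₀ hκ0 ?_
  linear_combination h4

variable {S : Type*} [TopologicalSpace S] [ChartedSpace (EuclideanSpace ℝ (Fin 2)) S]
  [IsManifold (𝓡 2) ∞ S] {φ N : S → Amb 2}

/-- The components of $d\Phi$ are $dN$ and $-d\phi$, and the Weingarten equation expresses $dN$
through $d\phi$. So $G'$ becomes a combination of oriented areas of pairs of tangent vectors, with
entries of the shape operator as coefficients. -/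
theorem IsHypersurface.jetGram_metricG' (hκ : κ * κ = 1) (h : IsHypersurface κ φ N) (x : S)
    (i j : Fin 2) :
    jetGram (metricG' κ) (jet (n := 2) (gaussMap φ N) x) i j =
      κ * (∑ k, shapeOperator κ φ N x k i *
          volForm (wedge (φ x) (N x)) ((jet (n := 2) φ x).2 j) ((jet (n := 2) φ x).2 k) +
        ∑ k, shapeOperator κ φ N x k j *
          volForm (wedge (φ x) (N x)) ((jet (n := 2) φ x).2 i) ((jet (n := 2) φ x).2 k)) := by
  have hf := h.isFrame hκ x
  have ha : ∀ k, form κ (φ x) (-(jet (n := 2) φ x).2 k) = 0 := fun k => by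
    rw [form_neg_right]
    exact neg_eq_zero.2 (hf.aP _)
  have hb : ∀ k, form κ (N x) (-(jet (n := 2) φ x).2 k) = 0 := fun k => by
    rw [form_neg_right]
    exact neg_eq_zero.2 (hf.bP _)
  have ha' : ∀ k, form κ (φ x) ((jet (n := 2) N x).2 k) = 0 := fun k => hf.aQ _
  have hb' : ∀ k, form κ (N x) ((jet (n := 2) N x).2 k) = 0 := fun k => hf.bQ _
  have hJ := fun v : Amb 2 => normalJ_perp hκ (φ x) (N x) v
  have h1 : ∀ u v : Amb 2,
      form κ u (WithLp.toLp 2 ((normalJ κ (wedge (φ x) (N x))).mulVec v) : Amb 2) =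
        -volForm (wedge (φ x) (N x)) u v := fun u v => by
    rw [form_comm, form_normalJ κ hκ, volForm_wedge_swap hκ]
  have h2 : metricG' κ (wedge (φ x) (N x))
      (wedge (φ x) ((jet (n := 2) N x).2 i) + wedge (N x) (-(jet (n := 2) φ x).2 i))
      (wedge (φ x) ((jet (n := 2) N x).2 j) + wedge (N x) (-(jet (n := 2) φ x).2 j)) =
      κ * (-volForm (wedge (φ x) (N x)) ((jet (n := 2) N x).2 i) (-(jet (n := 2) φ x).2 j : Amb 2) +
        volForm (wedge (φ x) (N x)) (-(jet (n := 2) φ x).2 i : Amb 2) ((jet (n := 2) N x).2 j)) := by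
    rw [metricG', bigJ'_tangent, hf.toIsFlag.symplectic_tangent (ha' i) (hb' i) (ha i) (hb i)
      (hJ _).1 (hJ _).2 (hJ _).1 (hJ _).2, h1, h1]
    ring
  have h3 : jetGram (metricG' κ) (jet (n := 2) (gaussMap φ N) x) i j = metricG' κ (wedge (φ x) (N x))
      (wedge (φ x) ((jet (n := 2) N x).2 i) + wedge (N x) (-(jet (n := 2) φ x).2 i))
      (wedge (φ x) ((jet (n := 2) N x).2 j) + wedge (N x) (-(jet (n := 2) φ x).2 j)) := by
    simp only [jetGram]
    rw [h.jet_gaussMap, h.jet_gaussMap]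
    rfl
  rw [h3, h2, h.weingarten hκ x i, h.weingarten hκ x j]
  have h4 : ∀ u v : Amb 2, volForm (wedge (φ x) (N x)) u (-v : Amb 2) =
      -volForm (wedge (φ x) (N x)) u v := fun u v => by
    rw [← form_normalJ κ hκ, ← form_normalJ κ hκ, form_neg_right]
  rw [h4, neg_neg, volForm_wedge_swap hκ _ _ _ ((jet (n := 2) φ x).2 j),
    volForm_wedge_neg_sum hκ, volForm_wedge_swap hκ _ _ (-(jet (n := 2) φ x).2 i : Amb 2), h4,
    neg_neg, volForm_wedge_swap hκ _ _ _ ((jet (n := 2) φ x).2 i), volForm_wedge_neg_sum hκ,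
    neg_neg, neg_neg]

/-- On a surface the only independent oriented area is that of the coordinate frame, whose square is
$\det g$. The factor $(\operatorname{tr}A)^2-4\det A=(k_1-k_2)^2$ explains why umbilics are the
degenerate points. -/
theorem IsHypersurface.det_jetGram_metricG' (hκ : κ * κ = 1) (h : IsHypersurface κ φ N) (x : S) :
    (jetGram (metricG' κ) (jet (n := 2) (gaussMap φ N) x)).det = -((firstForm κ φ x).det *
      ((shapeOperator κ φ N x).trace ^ 2 - 4 * (shapeOperator κ φ N x).det)) := by
  have hf := h.isFrame hκ x
  have h1 := hf.toIsFlag.volForm_sq (P := (jet (n := 2) φ x).2) (fun i => hf.aP _) fun i => hf.bP _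
  have h2 : (firstForm κ φ x).det = volForm (wedge (φ x) (N x)) ((jet (n := 2) φ x).2 0)
      ((jet (n := 2) φ x).2 1) ^ 2 := by
    rw [h1, Matrix.det_fin_two]
    simp only [firstForm, jet]
    rw [form_comm (diff 2 φ x (tangentBasis x 1)) (diff 2 φ x (tangentBasis x 0))]
    ring
  rw [Matrix.det_fin_two, h2, Matrix.trace_fin_two, Matrix.det_fin_two]
  simp only [h.jetGram_metricG' hκ, Fin.sum_univ_two, volForm_wedge_self hκ]
  rw [volForm_wedge_swap hκ _ _ ((jet (n := 2) φ x).2 1) ((jet (n := 2) φ x).2 0)]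
  generalize volForm (wedge (φ x) (N x)) ((jet (n := 2) φ x).2 0) ((jet (n := 2) φ x).2 1) = ρ
  linear_combination (-(4 * shapeOperator κ φ N x 1 0 * shapeOperator κ φ N x 0 1 +
    (shapeOperator κ φ N x 1 1 - shapeOperator κ φ N x 0 0) ^ 2) * ρ ^ 2) * hκ

/-- Both sides reduce to $|k_1-k_2|/2$ times the area density; this is the origin of the constant
$1/2$. -/
theorem IsHypersurface.density_metricG' (hκ : κ = 1 ∨ κ = -1) (h : IsHypersurface κ φ N) (x : S) :
    Real.sqrt (meanCurvature κ φ N x ^ 2 - (shapeOperator κ φ N x).det) *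
      jetDensity (fun _ => form κ) (jet (n := 2) φ x) =
    (1 / 2) * jetDensity (metricG' κ) (jet (n := 2) (gaussMap φ N) x) := by
  have hκ2 : κ * κ = 1 := by rcases hκ with rfl | rfl <;> norm_num
  obtain ⟨d, hd, -, hdet, htr⟩ :=
    exists_principal (h.posDef_firstForm hκ x) (h.isSymm_secondForm x)
  have h1 : meanCurvature κ φ N x = (d 0 + d 1) / 2 := by
    rw [meanCurvature, principalCurvatures, shapeOperator, hd]
    simp [Fin.univ_val_map]
  have h2 : (shapeOperator κ φ N x).det = d 0 * d 1 := by
    rw [shapeOperator, hdet, Fin.prod_univ_two]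
  have h3 : (shapeOperator κ φ N x).trace = d 0 + d 1 := by
    rw [shapeOperator, htr, Fin.sum_univ_two]
  have h4 : jetDensity (metricG' κ) (jet (n := 2) (gaussMap φ N) x) =
      |d 0 - d 1| * jetDensity (fun _ => form κ) (jet (n := 2) φ x) := by
    rw [jetDensity, h.det_jetGram_metricG' hκ2, h3, h2, abs_neg, abs_mul,
      show (d 0 + d 1) ^ 2 - 4 * (d 0 * d 1) = (d 0 - d 1) ^ 2 by ring, abs_sq,
      Real.sqrt_mul (abs_nonneg _), Real.sqrt_sq_eq_abs, mul_comm]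
    rfl
  rw [h1, h2, h4, show ((d 0 + d 1) / 2) ^ 2 - d 0 * d 1 = ((d 0 - d 1) / 2) ^ 2 by ring,
    Real.sqrt_sq_eq_abs, abs_div, abs_two]
  ring

end Neutral

end OrientedGeodesics
end

noncomputable section

namespace OrientedGeodesics

open Filter Topology

/-! ## The Gauss equation -/

section Patch

variable {V : Type*} [NormedAddCommGroup V] [NormedSpace ℝ V]
  {U : Set (EuclideanSpace ℝ (Fin 2))} {y : EuclideanSpace ℝ (Fin 2)}

/-- The partial derivative of a vector-valued function. -/
def pdv (k : Fin 2) (F : EuclideanSpace ℝ (Fin 2) → V) (y : EuclideanSpace ℝ (Fin 2)) : V :=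
  fderiv ℝ F y (EuclideanSpace.single k 1)

theorem contDiffOn_pdv (hU : IsOpen U) {F : EuclideanSpace ℝ (Fin 2) → V}
    (hF : ContDiffOn ℝ ∞ F U) (k : Fin 2) : ContDiffOn ℝ ∞ (pdv k F) U :=
  (hF.fderiv_of_isOpen (m := ∞) hU (by simp)).clm_apply contDiffOn_const

theorem pdv_comm (hU : IsOpen U) {F : EuclideanSpace ℝ (Fin 2) → V} (hF : ContDiffOn ℝ ∞ F U)
    (hy : y ∈ U) (i j : Fin 2) : pdv i (pdv j F) y = pdv j (pdv i F) y := by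
  have hFy : ContDiffAt ℝ ∞ F y := hF.contDiffAt (hU.mem_nhds hy)
  have hd : DifferentiableAt ℝ (fderiv ℝ F) y :=
    (hFy.fderiv_right (m := ∞) (by simp)).differentiableAt (by simp)
  have h1 : ∀ i j : Fin 2, pdv i (pdv j F) y =
      fderiv ℝ (fderiv ℝ F) y (EuclideanSpace.single i 1) (EuclideanSpace.single j 1) := by
    intro i j
    have h2 := (hd.hasFDerivAt.clm_apply
      (hasFDerivAt_const (EuclideanSpace.single j (1 : ℝ) : EuclideanSpace ℝ (Fin 2)) y)).fderiv
    change fderiv ℝ (fun z => fderiv ℝ F z (EuclideanSpace.single j 1)) y _ = _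
    rw [h2]
    simp
  have hsymm : IsSymmSndFDerivAt ℝ F y := hFy.isSymmSndFDerivAt two_le_smooth
  rw [h1, h1, hsymm.eq]

theorem pd_congr {f g : EuclideanSpace ℝ (Fin 2) → ℝ} (h : f =ᶠ[𝓝 y] g) (k : Fin 2) :
    pd k f y = pd k g y := by
  rw [pd, pd, h.fderiv_eq]

theorem pd_mul {f g : EuclideanSpace ℝ (Fin 2) → ℝ} (hf : DifferentiableAt ℝ f y)
    (hg : DifferentiableAt ℝ g y) (k : Fin 2) :
    pd k (fun z => f z * g z) y = pd k f y * g y + f y * pd k g y := by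
  rw [pd, fderiv_fun_mul hf hg]
  simp [pd]
  ring

theorem pd_add {f g : EuclideanSpace ℝ (Fin 2) → ℝ} (hf : DifferentiableAt ℝ f y)
    (hg : DifferentiableAt ℝ g y) (k : Fin 2) :
    pd k (fun z => f z + g z) y = pd k f y + pd k g y := by
  rw [pd, fderiv_fun_add hf hg]
  rfl

variable {κ : ℝ} {f ν : EuclideanSpace ℝ (Fin 2) → Amb 2}

theorem pd_form {F G : EuclideanSpace ℝ (Fin 2) → Amb 2} (hF : DifferentiableAt ℝ F y)
    (hG : DifferentiableAt ℝ G y) (k : Fin 2) :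
    pd k (fun z => form κ (F z) (G z)) y = form κ (pdv k F y) (G y) + form κ (F y) (pdv k G y) := by
  have h1 := (isBoundedBilinearMap_form (n := 2) (κ := κ)).hasFDerivAt (F y, G y)
  have h2 := HasFDerivAt.comp (f := fun z => (F z, G z)) y h1 (hF.hasFDerivAt.prodMk hG.hasFDerivAt)
  have h3 : pd k (fun z => form κ (F z) (G z)) y = _ :=
    congrArg (fun L : EuclideanSpace ℝ (Fin 2) →L[ℝ] ℝ => L (EuclideanSpace.single k 1)) h2.fderiv
  rw [h3]
  simp [IsBoundedBilinearMap.deriv, pdv]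
  ring

/-- The first fundamental form of a patch. -/
def patchMetric (κ : ℝ) (f : EuclideanSpace ℝ (Fin 2) → Amb 2) (y : EuclideanSpace ℝ (Fin 2)) :
    Matrix (Fin 2) (Fin 2) ℝ := fun i j => form κ (pdv i f y) (pdv j f y)

/-- In an induced metric the three derivatives of $g$ combine to
$2\langle\partial_i\partial_jf,\partial_mf\rangle$, by the product rule and the symmetry of second
derivatives. -/
theorem christoffel_patch (hU : IsOpen U) (hf : ContDiffOn ℝ ∞ f U) (hy : y ∈ U) (l i j : Fin 2) :
    christoffel (patchMetric κ f) l i j y =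
      ∑ m, (patchMetric κ f y)⁻¹ l m * form κ (pdv i (pdv j f) y) (pdv m f y) := by
  have hd : ∀ k, DifferentiableAt ℝ (pdv k f) y := fun k =>
    ((contDiffOn_pdv hU hf k).contDiffAt (hU.mem_nhds hy)).differentiableAt (by simp)
  have h1 : ∀ k a b, pd k (fun z => patchMetric κ f z a b) y =
      form κ (pdv k (pdv a f) y) (pdv b f y) + form κ (pdv a f y) (pdv k (pdv b f) y) :=
    fun k a b => pd_form (hd a) (hd b) k
  rw [christoffel, Finset.mul_sum]
  refine Finset.sum_congr rfl fun m _ => ?_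
  rw [h1, h1, h1, pdv_comm hU hf hy j i, pdv_comm hU hf hy m i, pdv_comm hU hf hy m j,
    form_comm (pdv j f y), form_comm (pdv i f y) (pdv j (pdv m f) y)]
  ring

theorem patchMetric_symm (i j : Fin 2) : patchMetric κ f y i j = patchMetric κ f y j i :=
  form_comm _ _

/-- The Christoffel symbols are the coefficients of the tangential part of $\partial_i\partial_jf$.
In this form no inverse metric appears, so it is convenient to differentiate. -/
theorem christoffel_mul_metric (hU : IsOpen U) (hf : ContDiffOn ℝ ∞ f U) (hy : y ∈ U)
    (hdet : (patchMetric κ f y).det ≠ 0) (i j m : Fin 2) :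
    ∑ l, christoffel (patchMetric κ f) l i j y * patchMetric κ f y l m =
      form κ (pdv i (pdv j f) y) (pdv m f y) := by
  simp only [christoffel_patch hU hf hy]
  have h1 := Matrix.mul_nonsing_inv (patchMetric κ f y) (isUnit_iff_ne_zero.2 hdet)
  have h2 : ∀ k, ∑ l, patchMetric κ f y l m * (patchMetric κ f y)⁻¹ l k =
      (1 : Matrix (Fin 2) (Fin 2) ℝ) m k := fun k => by
    rw [← h1, Matrix.mul_apply]
    exact Finset.sum_congr rfl fun l _ => by rw [patchMetric_symm]
  simp only [Finset.sum_mul]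
  rw [Finset.sum_comm]
  have h3 : ∀ k, ∑ l, (patchMetric κ f y)⁻¹ l k * form κ (pdv i (pdv j f) y) (pdv k f y) *
      patchMetric κ f y l m =
      (1 : Matrix (Fin 2) (Fin 2) ℝ) m k * form κ (pdv i (pdv j f) y) (pdv k f y) := fun k => by
    rw [← h2, Finset.sum_mul]
    exact Finset.sum_congr rfl fun l _ => by ring
  simp only [h3, Matrix.one_apply]
  simp

/-- Near the point, `christoffel_patch` and the adjugate formula for the inverse exhibit the symbols
as a smooth expression in the derivatives of `f`. -/
theorem differentiableAt_christoffel (hU : IsOpen U) (hf : ContDiffOn ℝ ∞ f U) (hy : y ∈ U)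
    (hdet : (patchMetric κ f y).det ≠ 0) (l i j : Fin 2) :
    DifferentiableAt ℝ (christoffel (patchMetric κ f) l i j) y := by
  have h1 : christoffel (patchMetric κ f) l i j =ᶠ[𝓝 y] fun z =>
      ∑ m, (((patchMetric κ f z).det)⁻¹ * (patchMetric κ f z).adjugate l m) *
        form κ (pdv i (pdv j f) z) (pdv m f z) := by
    filter_upwards [hU.mem_nhds hy] with z hz
    rw [christoffel_patch hU hf hz]
    refine Finset.sum_congr rfl fun m _ => ?_
    rw [Matrix.inv_def, Ring.inverse_eq_inv', Matrix.smul_apply, smul_eq_mul]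
  have hd : ∀ k, ContDiffAt ℝ ∞ (pdv k f) y := fun k =>
    (contDiffOn_pdv hU hf k).contDiffAt (hU.mem_nhds hy)
  have hdd : ContDiffAt ℝ ∞ (pdv i (pdv j f)) y :=
    (contDiffOn_pdv hU (contDiffOn_pdv hU hf j) i).contDiffAt (hU.mem_nhds hy)
  have hform : ∀ {F G : EuclideanSpace ℝ (Fin 2) → Amb 2}, ContDiffAt ℝ ∞ F y →
      ContDiffAt ℝ ∞ G y → ContDiffAt ℝ ∞ (fun z => form κ (F z) (G z)) y := fun {F G} hF hG =>
    ContDiffAt.comp (f := fun z => (F z, G z)) (g := fun p : Amb 2 × Amb 2 => form κ p.1 p.2) y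
      isBoundedBilinearMap_form.contDiff.contDiffAt (hF.prodMk hG)
  have hg : ∀ a b, ContDiffAt ℝ ∞ (fun z => patchMetric κ f z a b) y := fun a b =>
    hform (hd a) (hd b)
  have hdetc : ContDiffAt ℝ ∞ (fun z => (patchMetric κ f z).det) y := by
    simp only [Matrix.det_fin_two]
    exact ((hg 0 0).mul (hg 1 1)).sub ((hg 0 1).mul (hg 1 0))
  have hadj : ∀ m, ContDiffAt ℝ ∞ (fun z => (patchMetric κ f z).adjugate l m) y := fun m => by
    simp only [Matrix.adjugate_fin_two]
    fin_cases l <;> fin_cases m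
    · exact hg 1 1
    · exact (hg 0 1).neg
    · exact (hg 1 0).neg
    · exact hg 0 0
  refine DifferentiableAt.congr_of_eventuallyEq (ContDiffAt.differentiableAt (n := ∞) ?_ (by simp)) h1
  exact ContDiffAt.sum fun m _ => ((hdetc.inv hdet).mul (hadj m)).mul (hform hdd (hd m))

/-- The derivative of `christoffel_mul_metric`: it provides derivatives of Christoffel symbols
contracted with the metric, without differentiating the inverse metric. -/
theorem pd_christoffel (hU : IsOpen U) (hf : ContDiffOn ℝ ∞ f U) (hy : y ∈ U)
    (hdet : ∀ z ∈ U, (patchMetric κ f z).det ≠ 0) (p i j m : Fin 2) :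
    ∑ l, (pd p (christoffel (patchMetric κ f) l i j) y * patchMetric κ f y l m +
      christoffel (patchMetric κ f) l i j y * (form κ (pdv p (pdv l f) y) (pdv m f y) +
        form κ (pdv l f y) (pdv p (pdv m f) y))) =
      form κ (pdv p (pdv i (pdv j f)) y) (pdv m f y) +
        form κ (pdv i (pdv j f) y) (pdv p (pdv m f) y) := by
  have hd : ∀ k, DifferentiableAt ℝ (pdv k f) y := fun k =>
    ((contDiffOn_pdv hU hf k).contDiffAt (hU.mem_nhds hy)).differentiableAt (by simp)
  have hdd : DifferentiableAt ℝ (pdv i (pdv j f)) y :=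
    ((contDiffOn_pdv hU (contDiffOn_pdv hU hf j) i).contDiffAt (hU.mem_nhds hy)).differentiableAt
      (by simp)
  have h1 : ∀ k a b, pd k (fun z => patchMetric κ f z a b) y =
      form κ (pdv k (pdv a f) y) (pdv b f y) + form κ (pdv a f y) (pdv k (pdv b f) y) :=
    fun k a b => pd_form (hd a) (hd b) k
  have hg : ∀ a b, DifferentiableAt ℝ (fun z => patchMetric κ f z a b) y := fun a b =>
    ((isBoundedBilinearMap_form (n := 2) (κ := κ)).differentiableAt (pdv a f y, pdv b f y)).comp
      (f := fun z => (pdv a f z, pdv b f z)) y ((hd a).prodMk (hd b))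
  have hc : ∀ l, DifferentiableAt ℝ (christoffel (patchMetric κ f) l i j) y := fun l =>
    differentiableAt_christoffel hU hf hy (hdet y hy) l i j
  have h2 : (fun z => christoffel (patchMetric κ f) 0 i j z * patchMetric κ f z 0 m +
      christoffel (patchMetric κ f) 1 i j z * patchMetric κ f z 1 m) =ᶠ[𝓝 y]
      fun z => form κ (pdv i (pdv j f) z) (pdv m f z) := by
    filter_upwards [hU.mem_nhds hy] with z hz
    rw [← christoffel_mul_metric hU hf hz (hdet z hz), Fin.sum_univ_two]
  have h3 := pd_congr h2 p
  rw [pd_form hdd (hd m), pd_add ((hc 0).fun_mul (hg 0 m)) ((hc 1).fun_mul (hg 1 m)),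
    pd_mul (hc 0) (hg 0 m), pd_mul (hc 1) (hg 1 m), h1, h1] at h3
  rw [Fin.sum_univ_two, ← h3]

/-- The curvature of a patch in terms of the second derivatives modulo tangential vectors. -/
theorem riemann_patch (hU : IsOpen U) (hf : ContDiffOn ℝ ∞ f U) (hy : y ∈ U)
    (hdet : ∀ z ∈ U, (patchMetric κ f z).det ≠ 0) :
    ∑ l, riemann (patchMetric κ f) l 1 0 1 y * patchMetric κ f y l 0 =
      form κ (pdv 1 (pdv 1 f) y - ∑ l, christoffel (patchMetric κ f) l 1 1 y • pdv l f y)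
        (pdv 0 (pdv 0 f) y) -
      form κ (pdv 0 (pdv 1 f) y - ∑ l, christoffel (patchMetric κ f) l 0 1 y • pdv l f y)
        (pdv 0 (pdv 1 f) y) := by
  -- The two derivatives of Christoffel symbols in the curvature tensor. They involve the same third
  -- derivative of `f`, which cancels once the partial derivatives are commuted; the quadratic terms
  -- are handled by the relations `r`.
  have e1 := pd_christoffel hU hf hy hdet 0 1 1 0
  have e2 := pd_christoffel hU hf hy hdet 1 0 1 0
  have r := fun i j => christoffel_mul_metric hU hf hy (hdet y hy) i j 0
  have r00 := r 0 0
  have r01 := r 0 1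
  have r10 := r 1 0
  have r11 := r 1 1
  have hc : pdv 0 (pdv 1 (pdv 1 f)) y = pdv 1 (pdv 0 (pdv 1 f)) y :=
    pdv_comm hU (contDiffOn_pdv hU hf 1) hy 0 1
  rw [hc] at e1
  have hc' := pdv_comm hU hf hy 1 0
  simp only [riemann, Fin.sum_univ_two, hc', form_sub_left, form_add_left, form_smul_left] at e1 e2 r00 r01 r10 r11 ⊢
  linear_combination e1 - e2 + christoffel (patchMetric κ f) 0 1 1 y * r00 +
    christoffel (patchMetric κ f) 1 1 1 y * r01 - christoffel (patchMetric κ f) 0 0 1 y * r10 -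
    christoffel (patchMetric κ f) 1 0 1 y * r11

end Patch

end OrientedGeodesics
end

noncomputable section

namespace OrientedGeodesics

open Filter Topology

/-! ### The Gauss equation for surfaces in the space forms -/

section GaussEquation

variable {κ : ℝ} {S : Type*} [TopologicalSpace S] [ChartedSpace (EuclideanSpace ℝ (Fin 2)) S]
  [IsManifold (𝓡 2) ∞ S] {φ N : S → Amb 2}

/-- The Gauss equation. -/
theorem IsHypersurface.gaussCurvature_eq (hκ : κ * κ = 1) (h : IsHypersurface κ φ N) (x : S) :
    gaussCurvature κ φ x = κ + (shapeOperator κ φ N x).det := by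
  set e := chartAt (EuclideanSpace ℝ (Fin 2)) x with he'
  have he : e ∈ atlas (EuclideanSpace ℝ (Fin 2)) S := chart_mem_atlas _ x
  have hx : x ∈ e.source := mem_chart_source _ x
  have hy : e x ∈ e.target := e.map_source hx
  set f : EuclideanSpace ℝ (Fin 2) → Amb 2 := φ ∘ e.symm with hf'
  set ν : EuclideanSpace ℝ (Fin 2) → Amb 2 := N ∘ e.symm with hν'
  have hU := e.open_target
  have hf : ContDiffOn ℝ ∞ f e.target := contDiffOn_comp_symm he h.smooth
  have hν : ContDiffOn ℝ ∞ ν e.target := contDiffOn_comp_symm he h.smooth_normal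
  have hgram : gram 2 (fun _ => form κ) φ e = patchMetric κ f := rfl
  have hdet : ∀ z ∈ e.target, (patchMetric κ f z).det ≠ 0 := fun z hz =>
    (h.detNeZero hκ).jetIn_ne_zero smoothBilin_form h.smooth he hz
  have hj : ∀ i, pdv i f (e x) = (jet (n := 2) φ x).2 i := fun i => by
    rw [jet_eq_jetIn_chartAt (h.mdiff x)]
    rfl
  have hjN : ∀ i, pdv i ν (e x) = (jet (n := 2) N x).2 i := fun i => by
    rw [jet_eq_jetIn_chartAt (h.mdiff_normal x)]
    rfl
  have hfx : f (e x) = φ x := by simp [hf', e.left_inv hx]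
  have hνx : ν (e x) = N x := by simp [hν', e.left_inv hx]
  have hfirst : ∀ i j, patchMetric κ f (e x) i j = firstForm κ φ x i j := fun i j => by
    simp only [patchMetric, hj]
    rfl
  have horth : ∀ z ∈ e.target, ∀ j, form κ (f z) (pdv j f z) = 0 ∧ form κ (ν z) (pdv j f z) = 0 :=
    fun z hz j => by
      obtain ⟨u, hu⟩ := chartLin_surjective he (e.map_target hz) (EuclideanSpace.single j 1)
      have hfr := h.isFrame hκ (e.symm z)
      have h1 := hfr.aP u
      have h2 := hfr.bP u
      rw [dE_eq_fderiv he (e.map_target hz) (h.mdiff _), e.right_inv hz, hu] at h1 h2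
      exact ⟨h1, h2⟩
  have hdf : DifferentiableAt ℝ f (e x) := (hf.contDiffAt (hU.mem_nhds hy)).differentiableAt (by simp)
  have hdν : DifferentiableAt ℝ ν (e x) := (hν.contDiffAt (hU.mem_nhds hy)).differentiableAt (by simp)
  have hdp : ∀ k, DifferentiableAt ℝ (pdv k f) (e x) := fun k =>
    ((contDiffOn_pdv hU hf k).contDiffAt (hU.mem_nhds hy)).differentiableAt (by simp)
  have hpd0 : ∀ i, pd i (fun _ => (0 : ℝ)) (e x) = 0 := fun i => by simp [pd]
  -- Differentiating $\langle\phi,\partial_j\phi\rangle=0$. The surface is curved inside the ambient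
  -- vector space also along its position vector, and this component produces the summand $\kappa$
  -- of the curvature.
  have hpos : ∀ i j, form κ (φ x) (pdv i (pdv j f) (e x)) = -firstForm κ φ x i j := fun i j => by
    have h1 : (fun z => form κ (f z) (pdv j f z)) =ᶠ[𝓝 (e x)] fun _ => 0 := by
      filter_upwards [hU.mem_nhds hy] with z hz using (horth z hz j).1
    have h2 := pd_congr h1 i
    rw [pd_form hdf (hdp j), hpd0, hfx] at h2
    rw [← hfirst, patchMetric]
    linarith
  have hnor : ∀ i j, form κ (N x) (pdv i (pdv j f) (e x)) = secondForm κ φ N x i j := fun i j => by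
    have h1 : (fun z => form κ (ν z) (pdv j f z)) =ᶠ[𝓝 (e x)] fun _ => 0 := by
      filter_upwards [hU.mem_nhds hy] with z hz using (horth z hz j).2
    have h2 := pd_congr h1 i
    rw [pd_form hdν (hdp j), hpd0, hνx, hjN, hj] at h2
    have h3 : secondForm κ φ N x i j =
      -form κ ((jet (n := 2) N x).2 i) ((jet (n := 2) φ x).2 j) := rfl
    rw [h3]
    linarith
  have hfr := h.isFrame hκ x
  have haj : ∀ l, form κ (φ x) (pdv l f (e x)) = 0 := fun l => by rw [hj]; exact hfr.aP _
  have hbj : ∀ l, form κ (N x) (pdv l f (e x)) = 0 := fun l => by rw [hj]; exact hfr.bP _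
  -- The Gauss formula: after removing the tangential part, the second derivative is a combination
  -- of $N$ and $\phi$. It is verified by pairing with $\phi$, $N$ and the tangent vectors.
  have hdecomp : ∀ i j, pdv i (pdv j f) (e x) -
      ∑ l, christoffel (patchMetric κ f) l i j (e x) • pdv l f (e x) =
      secondForm κ φ N x i j • N x - (κ * firstForm κ φ x i j) • φ x := fun i j => by
    rw [← sub_eq_zero]
    refine hfr.eq_zero ?_ ?_ fun v => ?_
    · simp only [Fin.sum_univ_two, form_sub_right, form_add_right, form_smul_right, haj, hpos,
        hfr.aa, hfr.ab]
      linear_combination firstForm κ φ x i j * hκ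
    · simp only [Fin.sum_univ_two, form_sub_right, form_add_right, form_smul_right, hbj, hnor,
        hfr.bb, hfr.ba]
      ring
    · have h1 : dE (n := 2) φ x v = ∑ k, v k • (jet (n := 2) φ x).2 k := diff_eq_sum φ x v
      rw [h1, smoothBilin_form.sum_left (p := (0 : Amb 2))]
      refine Finset.sum_eq_zero fun m _ => ?_
      have h2 := christoffel_mul_metric hU hf hy (hdet _ hy) i j m
      simp only [Fin.sum_univ_two, patchMetric] at h2
      rw [← hj, form_smul_left]
      simp only [Fin.sum_univ_two, form_sub_right, form_add_right, form_smul_right,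
        form_comm _ (N x), form_comm _ (φ x), haj, hbj]
      rw [form_comm (pdv m f (e x)), form_comm (pdv m f (e x)), form_comm (pdv m f (e x))]
      linear_combination (-v m) * h2
  have hdet0 : (firstForm κ φ x).det ≠ 0 := h.detNeZero hκ x
  have hmat : patchMetric κ f (e x) = firstForm κ φ x := Matrix.ext hfirst
  have hR := riemann_patch hU hf hy hdet
  rw [hdecomp, hdecomp, form_sub_left, form_sub_left, form_smul_left, form_smul_left,
    form_smul_left, form_smul_left, hpos, hpos, hnor, hnor] at hR
  have hsym : firstForm κ φ x 1 0 = firstForm κ φ x 0 1 := form_comm _ _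
  have hsym2 : secondForm κ φ N x 1 0 = secondForm κ φ N x 0 1 := (h.isSymm_secondForm x).apply 0 1
  have hK : gaussCurvature κ φ x = (∑ l, riemann (patchMetric κ f) l 1 0 1 (e x) *
      patchMetric κ f (e x) l 0) / (patchMetric κ f (e x)).det := rfl
  rw [hK, hR, hmat, shapeOperator, Matrix.det_mul, Matrix.det_nonsing_inv, Ring.inverse_eq_inv']
  field_simp
  rw [Matrix.det_fin_two, Matrix.det_fin_two, hsym, hsym2]
  ring

end GaussEquation

/-! ## The four variational characterizations -/

section Main

variable {κ : ℝ} {n : ℕ} {S : Type*} [TopologicalSpace S] [T2Space S] [SecondCountableTopology S]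
  [ChartedSpace (EuclideanSpace ℝ (Fin n)) S] [IsManifold (𝓡 n) ∞ S] [MeasurableSpace S]
  [BorelSpace S] {φ N : S → Amb n}

theorem IsHypersurface.isHamiltonianMinimal_metricG_iff (hκ : κ = 1 ∨ κ = -1)
    (h : IsHypersurface κ φ N) (hnd : NondegenerateInduced n (fun _ => metricG κ) (gaussMap φ N)) :
    IsHamiltonianMinimal κ (fun _ => metricG κ) (bigJ κ) (gaussMap φ N) ↔
      IsCriticalPoint κ (fun ψ ν x => Real.sqrt
        ((principalCurvatures κ ψ ν x).map fun k => |1 + κ * k ^ 2|).prod) φ N :=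
  isHamiltonianMinimal_iff_isCriticalPoint one_ne_zero isGeodesicStructure_metricG
    (by rcases hκ with rfl | rfl <;> norm_num)
    (fun _ _ hψ x => by rw [one_mul]; exact hψ.density_metricG hκ x) h hnd

end Main

section MainNeutral

variable {κ : ℝ} {S : Type*} [TopologicalSpace S] [T2Space S] [SecondCountableTopology S]
  [ChartedSpace (EuclideanSpace ℝ (Fin 2)) S] [IsManifold (𝓡 2) ∞ S] [MeasurableSpace S]
  [BorelSpace S] {φ N : S → Amb 2}

/-- The density identity is stated with the extrinsic quantity $k_1k_2$; the Gauss equation replaces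
it by $K-\kappa$. -/
theorem IsHypersurface.isHamiltonianMinimal_metricG'_iff (hκ : κ = 1 ∨ κ = -1)
    (h : IsHypersurface κ φ N) (hnd : NondegenerateInduced 2 (metricG' κ) (gaussMap φ N)) :
    IsHamiltonianMinimal κ (metricG' κ) (bigJ' κ) (gaussMap φ N) ↔
      IsCriticalPoint κ (fun ψ ν x => Real.sqrt
        (meanCurvature κ ψ ν x ^ 2 - gaussCurvature κ ψ x + κ)) φ N := by
  have hκ2 : κ * κ = 1 := by rcases hκ with rfl | rfl <;> norm_num
  refine isHamiltonianMinimal_iff_isCriticalPoint (c := 1 / 2) (by norm_num)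
    isGeodesicStructure_metricG' hκ2 (fun ψ ν hψ x => ?_) h hnd
  rw [← hψ.density_metricG' hκ x, hψ.gaussCurvature_eq hκ2 x]
  congr 2
  ring

end MainNeutral

end OrientedGeodesics
end

theorem mainTheorem3 :
    (∀ (n : ℕ) (_ : 1 ≤ n) (S : Type*) [TopologicalSpace S] [T2Space S]
      [SecondCountableTopology S] [ChartedSpace (EuclideanSpace ℝ (Fin n)) S]
      [IsManifold (𝓡 n) ∞ S] [MeasurableSpace S] [BorelSpace S] (φ N : S → Amb n),
      (IsHypersurface 1 φ N →
        (IsHamiltonianMinimal 1 (fun _ => metricG 1) (bigJ 1) (gaussMap φ N) ↔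
          IsCriticalPoint 1 (fun ψ ν x =>
            Real.sqrt ((principalCurvatures 1 ψ ν x).map fun k => 1 + k ^ 2).prod) φ N)) ∧
      (IsHypersurface (-1) φ N →
        NondegenerateInduced n (fun _ => metricG (-1)) (gaussMap φ N) →
        (IsHamiltonianMinimal (-1) (fun _ => metricG (-1)) (bigJ (-1)) (gaussMap φ N) ↔
          IsCriticalPoint (-1) (fun ψ ν x =>
            Real.sqrt ((principalCurvatures (-1) ψ ν x).map fun k => |1 - k ^ 2|).prod) φ N))) ∧
    (∀ (S : Type*) [TopologicalSpace S] [T2Space S]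
      [SecondCountableTopology S] [ChartedSpace (EuclideanSpace ℝ (Fin 2)) S]
      [IsManifold (𝓡 2) ∞ S] [MeasurableSpace S] [BorelSpace S] (φ N : S → Amb 2),
      (IsHypersurface 1 φ N → NondegenerateInduced 2 (metricG' 1) (gaussMap φ N) →
        (IsHamiltonianMinimal 1 (metricG' 1) (bigJ' 1) (gaussMap φ N) ↔
          IsCriticalPoint 1 (fun ψ ν x =>
            Real.sqrt (meanCurvature 1 ψ ν x ^ 2 - gaussCurvature 1 ψ x + 1)) φ N)) ∧
      (IsHypersurface (-1) φ N → NondegenerateInduced 2 (metricG' (-1)) (gaussMap φ N) →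
        (IsHamiltonianMinimal (-1) (metricG' (-1)) (bigJ' (-1)) (gaussMap φ N) ↔
          IsCriticalPoint (-1) (fun ψ ν x =>
            Real.sqrt (meanCurvature (-1) ψ ν x ^ 2 - gaussCurvature (-1) ψ x - 1)) φ N))) := by
  refine ⟨fun n _ S _ _ _ _ _ _ _ φ N => ⟨fun h => ?_, fun h hnd => ?_⟩,
    fun S _ _ _ _ _ _ _ φ N => ⟨fun h hnd => ?_, fun h hnd => ?_⟩⟩
  · have h1 := h.isHamiltonianMinimal_metricG_iff (Or.inl rfl) h.nondegenerate_sphere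
    have h2 : ∀ k : ℝ, |1 + 1 * k ^ 2| = 1 + k ^ 2 := fun k => by
      rw [one_mul, abs_of_pos (by positivity)]
    simpa only [h2] using h1
  · have h1 := h.isHamiltonianMinimal_metricG_iff (Or.inr rfl) hnd
    have h2 : ∀ k : ℝ, |1 + -1 * k ^ 2| = |1 - k ^ 2| := fun k => by
      rw [neg_one_mul, ← sub_eq_add_neg]
    simpa only [h2] using h1
  · exact h.isHamiltonianMinimal_metricG'_iff (Or.inl rfl) hnd
  · exact h.isHamiltonianMinimal_metricG'_iff (Or.inr rfl) hnd
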